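/- Let $n\ge 1$ and let $d\ge 2$ be even. Let $C_d$ be the group of $d$-th roots of unity, $t_g$ a symbol for a generator of the cyclic group of order $d$ identified with $\operatorname{Hom}(C_d,\mathbb C^\times)$ so that $t_g^{k}$ is the character $t\mapsto t^{k}$, let $\mathcal P$ be the set of partitions, and for $\lambda\in\mathcal P$ let $\mathbb S^\lambda$ be the complex Specht module of $\mathbb S_{|\lambda|}$. Let $W_m=\{\pm1\}^m\rtimes\mathbb S_m$, and let $W_m'\le W_m$ be the subgroup of elements with an even number of entries $-1$. The group $W_m$ acts on $C_d^m$ by permuting and inverting the entries. Put $$S^{A}_{d,n}=C_d^n\rtimes\mathbb S_n,\quad S^{A^*}_{d,n}=T'\rtimes\mathbb S_n,\quad S^{B}_{d,n}=S^{C}_{d,n}=C_d^n\rtimes W_n,\quad S^{D}_{d,n}=C_d^n\rtimes W_n',$$ where $T'=\{t\in C_d^n:\prod_a t_a=1\}$; thus $S^{A^*}_{d,n}\trianglelefteq S^{A}_{d,n}$ and $S^{D}_{d,n}\trianglelefteq S^{B}_{d,n}$. For $\lambda\in\mathcal P$ of size $m$ write $\chi_{\lambda,k}=\mathbb S^\lambda\otimes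 t_g^k$ for the representation of $C_d^m\rtimes\mathbb S_m$ in which $\mathbb S_m$ acts through $\mathbb S^\lambda$ and $t\in C_d^m$ by the scalar $\prod_a t_a^k$. For $\lambda,\mu\in\mathcal P$ with $m=|\lambda|+|\mu|$ put $\chi_{\lambda,\mu}=\operatorname{Ind}_{W_{|\lambda|}\times W_{|\mu|}}^{W_m}\mathbb S^\lambda\otimes(\mathbb S^\mu\otimes\operatorname{sgn})$, where $\operatorname{sgn}(t,\sigma)=\prod_a t_a$; let $\chi_{\lambda,\mu,1}$ and $\chi_{\lambda,\mu,-1}$ be its extensions to $C_d^m\rtimes W_m$ on which $t\in C_d^m$ acts by $1$, respectively by the scalar $\prod_a t_a^{d/2}$. All representations are complex, and $\operatorname{Irr}$ is the set of isomorphism classes of irreducible representations. **Type $A$.** Let $\mathcal Q_{d,n}$ be the set of functions $\Lambda$ from $C_d$ (as the cyclic group $\langle t_g\rangle$) to $\mathcal P$ of total size $n$, written $\Lambda=(\lambda_1,\dots,\lambda_d)$ with $\lambda_i=\Lambda(t_g^i)$ and $n_i=|\lambda_i|$. Let $\psi$ be the character of $C_d^n$ given by the tuple whose first $n_1$ entries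 are $t_g$, next $n_2$ entries are $t_g^2$, and so on. Then $C_d^n\rtimes\mathbf{Stab}_{\mathbb S_n}(\psi)=\prod_iN_i$ with $N_i=C_d^{n_i}\rtimes\mathbb S_{n_i}$ embedded block-diagonally, and $\Lambda\mapsto\chi_\Lambda=\operatorname{Ind}_{\prod N_i}^{S^A_{d,n}}\bigotimes_i\chi_{\lambda_i,i}$ induces a bijection $\mathcal Q_{d,n}\to\operatorname{Irr}(S^A_{d,n})$. **Type $A^*$.** Let $\epsilon(t,\sigma)=\prod_at_a$. For $\Lambda\in\mathcal Q_{d,n}$ let $\Lambda^+$ be the cyclic shift $(\lambda_d,\lambda_1,\dots,\lambda_{d-1})$, and let $o(\Lambda)$ be the least $k>0$ such that $k$ cyclic shifts take $\Lambda$ back to $\Lambda$. Then $\chi_\Lambda\otimes\epsilon\cong\chi_{\Lambda^+}$, $o(\Lambda)$ divides $d$, and the restriction of $\chi_\Lambda$ to $S^{A^*}_{d,n}$ is a direct sum of exactly $d/o(\Lambda)$ pairwise non-isomorphic irreducible representations, which are conjugate under $S^A_{d,n}$. Every irreducible representation of $S^{A^*}_{d,n}$ is a factor of such a restriction. The restrictions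 of $\chi_\Lambda$ and $\chi_{\Lambda'}$ have a common irreducible factor if and only if $\Lambda'$ is an iterated cyclic shift of $\Lambda$, and in that case they are isomorphic. **Types $B$ and $C$.** Let $\mathcal R_{d,n}$ be the set of tuples of partitions $\Lambda=(\lambda_1,\mu_1,\lambda_2,\mu_2,\lambda_3,\dots,\lambda_{(d+2)/2})$ of total size $n$; put $n_i=|\lambda_i|+|\mu_i|$ for $i=1,2$ and $n_i=|\lambda_i|$ for $i>2$. Let $\psi$ be the character of $C_d^n$ given by the tuple whose first $n_1$ entries are $1$, next $n_2$ entries are $t_g^{d/2}$, and then, for $i>2$, $n_i$ entries $t_g^{i-2}$. Then $C_d^n\rtimes\mathbf{Stab}_{W_n}(\psi)=\prod_iN_i$ with $N_i=C_d^{n_i}\rtimes W_{n_i}$ for $i=1,2$ and $N_i=C_d^{n_i}\rtimes\mathbb S_{n_i}$ for $i>2$, embedded block-diagonally, and $$\Lambda\mapsto\chi_\Lambda=\operatorname{Ind}_{\prod N_i}^{S^B_{d,n}}\ (\chi_{\lambda_1,\mu_1,1}\otimes\chi_{\lambda_2,\mu_2,-1})\otimes\bigotimes_{i>2}\chi_{\lambda_i,i-2}$$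 induces a bijection $\mathcal R_{d,n}\to\operatorname{Irr}(S^B_{d,n})$. **Type $D$.** The subgroup $S^D_{d,n}$ has index two in $S^B_{d,n}$. Let $\epsilon:S^B_{d,n}\to\{\pm1\}$ be the character with kernel $S^D_{d,n}$, and for $\Lambda\in\mathcal R_{d,n}$ let $\Lambda^{s}=(\mu_1,\lambda_1,\mu_2,\lambda_2,\lambda_3,\dots)$. Then $\chi_\Lambda\otimes\epsilon\cong\chi_{\Lambda^s}$. If $(\lambda_1,\lambda_2)\ne(\mu_1,\mu_2)$, the restriction of $\chi_\Lambda$ to $S^D_{d,n}$ is irreducible; if $(\lambda_1,\lambda_2)=(\mu_1,\mu_2)$, it is the direct sum of two non-isomorphic irreducible representations $\chi_\Lambda^{\pm}$, conjugate under $S^B_{d,n}$. Every irreducible representation of $S^D_{d,n}$ is a factor of such a restriction. The restrictions of $\chi_\Lambda$ and $\chi_{\Lambda'}$ have a common irreducible factor if and only if $\Lambda'\in\{\Lambda,\Lambda^s\}$, and in that case they are isomorphic. -/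

import Mathlib

open scoped TensorProduct

universe u

noncomputable section

namespace YokonumaIrr

/-! ## Generalities on complex representations -/

/-- `ρ ⊗ c` for a linear character `c`: the tensor product of `ρ` with the one-dimensional
representation `c`, realised on the space of `ρ`. -/
def twist {G : Type*} [Group G] {V : Type*} [AddCommGroup V] [Module ℂ V]
    (c : G →* ℂˣ) (ρ : Representation ℂ G V) : Representation ℂ G V where
  toFun g := (c g : ℂ) • ρ g
  map_one' := by simp
  map_mul' g h := by
    ext v
    simp only [map_mul, Units.val_mul, LinearMap.smul_apply, Module.End.mul_apply,
      map_smul, mul_smul]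
    exact smul_comm _ _ _

/-- External tensor product of representations of two groups. -/
def extTensor {G H V W : Type*} [Group G] [Group H] [AddCommGroup V] [Module ℂ V]
    [AddCommGroup W] [Module ℂ W] (ρ : Representation ℂ G V) (σ : Representation ℂ H W) :
    Representation ℂ (G × H) (V ⊗[ℂ] W) :=
  Representation.tprod (ρ.comp (MonoidHom.fst G H)) (σ.comp (MonoidHom.snd G H))

/-- External tensor product of a finite family of representations `ρ i` of groups `G i`,
as a representation of the direct product of the groups. -/
def piTensor {ι : Type*} {G V : ι → Type*} [∀ i, Group (G i)] [∀ i, AddCommGroup (V i)]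
    [∀ i, Module ℂ (V i)] (ρ : ∀ i, Representation ℂ (G i) (V i)) :
    Representation ℂ (∀ i, G i) (⨂[ℂ] i, V i) where
  toFun g := PiTensorProduct.map fun i => ρ i (g i)
  map_one' := by
    simp only [Pi.one_apply, map_one]
    exact PiTensorProduct.map_one
  map_mul' g h := by
    simp only [Pi.mul_apply, map_mul]
    exact PiTensorProduct.map_mul _ _

/-- The family `χ` is a complete and irredundant list of the irreducible complex
representations of `G` up to isomorphism, i.e. `i ↦ [χ i]` is a bijection onto `Irr G`. -/
def ParametrizesIrr {G : Type*} [Group G] {ι : Type*} {V : ι → Type*}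
    [∀ i, AddCommGroup (V i)] [∀ i, Module ℂ (V i)]
    (χ : ∀ i, Representation ℂ G (V i)) : Prop :=
  (∀ i, (χ i).IsIrreducible) ∧
  (∀ i j, Nonempty ((χ i).Equiv (χ j)) → i = j) ∧
  ∀ (X : Type u) [AddCommGroup X] [Module ℂ X] (ρ : Representation ℂ G X),
    ρ.IsIrreducible → ∃ i, Nonempty (ρ.Equiv (χ i))

/-- Restriction of a representation to a subgroup. -/
def res {G V : Type*} [Group G] [AddCommGroup V] [Module ℂ V] (N : Subgroup G)
    (ρ : Representation ℂ G V) : Representation ℂ N V :=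
  ρ.comp N.subtype

/-- The conjugate `ρ ^ g : h ↦ ρ (g h g⁻¹)` of a representation of a normal subgroup. -/
def conjRep {G V : Type*} [Group G] [AddCommGroup V] [Module ℂ V] (N : Subgroup G) [N.Normal]
    (g : G) (ρ : Representation ℂ N V) : Representation ℂ N V :=
  ρ.comp (MulAut.conjNormal g).toMonoidHom

/-- `ρ` is (isomorphic to) a factor of `σ`. -/
def IsFactor {G V W : Type*} [Group G] [AddCommGroup V] [Module ℂ V] [AddCommGroup W]
    [Module ℂ W] (ρ : Representation ℂ G V) (σ : Representation ℂ G W) : Prop :=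
  ∃ U : Subrepresentation σ, Nonempty (ρ.Equiv U.toRepresentation)

/-- `σ` and `τ` share an irreducible factor. -/
def HaveCommonFactor {G V W : Type*} [Group G] [AddCommGroup V] [Module ℂ V] [AddCommGroup W]
    [Module ℂ W] (σ : Representation ℂ G V) (τ : Representation ℂ G W) : Prop :=
  ∃ U : Subrepresentation σ, U.toRepresentation.IsIrreducible ∧ IsFactor U.toRepresentation τ

/-- The restriction of `ρ` to the normal subgroup `N` is the direct sum of exactly `m`
irreducible subrepresentations, pairwise non-isomorphic, and conjugate to each other under `G`. -/
def RestrictionSplits {G V : Type*} [Group G] [AddCommGroup V] [Module ℂ V]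
    (N : Subgroup G) [N.Normal] (ρ : Representation ℂ G V) (m : ℕ) : Prop :=
  ∃ U : Fin m → Subrepresentation (res N ρ),
    DirectSum.IsInternal (fun i => (U i).toSubmodule) ∧
    (∀ i, (U i).toRepresentation.IsIrreducible) ∧
    (∀ i j, Nonempty ((U i).toRepresentation.Equiv (U j).toRepresentation) → i = j) ∧
    ∀ i j, ∃ g : G,
      Nonempty ((U j).toRepresentation.Equiv (conjRep N g (U i).toRepresentation))

/-! ## Specht modules -/

/-- The permutation representation of `Perm α` on the span of all functions `r : α → ℕ`.
Such a function, read as "`a` is in row `r a`", encodes a tabloid. -/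
def rowRep (α : Type*) : Representation ℂ (Equiv.Perm α) ((α → ℕ) →₀ ℂ) where
  toFun σ := Finsupp.lmapDomain ℂ ℂ fun r a => r (σ.symm a)
  map_one' := by
    ext r : 1
    ext
    simp [Finsupp.mapDomain_single, Equiv.Perm.one_def]
  map_mul' σ τ := by
    ext r : 1
    ext
    simp [Finsupp.mapDomain_single, Equiv.Perm.mul_def]

/-- The polytabloid `e_T = ∑ sgn(π) π{T}`, over `π` in the column stabilizer of the tableau `T`
of shape `μ` with entries in `α`; here `{T}` is the tabloid `a ↦ row of a in T`. -/
def polytabloid {α : Type*} [Fintype α] [DecidableEq α] (μ : YoungDiagram) (T : α ≃ μ.cells) :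
    (α → ℕ) →₀ ℂ :=
  ∑ π : Equiv.Perm α with ∀ a, (T (π a)).1.2 = (T a).1.2,
    ((Equiv.Perm.sign π : ℤ) : ℂ) • rowRep α π (Finsupp.single (fun a => (T a).1.1) 1)

lemma rowRep_polytabloid {α : Type*} [Fintype α] [DecidableEq α] (μ : YoungDiagram)
    (σ : Equiv.Perm α) (T : α ≃ μ.cells) :
    rowRep α σ (polytabloid μ T) = polytabloid μ (σ.symm.trans T) := by
  unfold polytabloid
  rw [map_sum]
  refine Finset.sum_equiv (MulAut.conj σ).toEquiv ?_ ?_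
  · intro π
    simp only [Finset.mem_filter, Finset.mem_univ, true_and]
    constructor
    · intro h a
      have := h (σ.symm a)
      simpa [Equiv.Perm.mul_apply] using this
    · intro h a
      have := h (σ a)
      simpa [Equiv.Perm.mul_apply] using this
  · intro π _
    have h1 : (rowRep α σ) (Finsupp.single (fun a => (T a).1.1) 1)
        = Finsupp.single (fun a => ((σ.symm.trans T) a).1.1) 1 := by
      simp [rowRep, Finsupp.mapDomain_single]
    have h2 : Equiv.Perm.sign ((MulAut.conj σ).toEquiv π) = Equiv.Perm.sign π := by
      change Equiv.Perm.sign (σ * π * σ⁻¹) = _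
      rw [map_mul, map_mul, Equiv.Perm.sign_inv, mul_comm,
        ← mul_assoc, Int.units_mul_self, one_mul]
    rw [map_smul, h2, ← h1]
    congr 1
    rw [← Module.End.mul_apply, ← Module.End.mul_apply, ← map_mul, ← map_mul]
    congr 2
    simp [MulAut.conj_apply]

/-- The Specht module of shape `μ` inside the permutation representation: the span of all
polytabloids of shape `μ`. -/
def spechtSub (μ : YoungDiagram) (α : Type*) [Fintype α] [DecidableEq α] :
    Subrepresentation (rowRep α) where
  toSubmodule := Submodule.span ℂ (Set.range (polytabloid (α := α) μ))
  apply_mem_toSubmodule σ := by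
    intro x hx
    have : Submodule.span ℂ (Set.range (polytabloid (α := α) μ)) ≤
        (Submodule.span ℂ (Set.range (polytabloid (α := α) μ))).comap (rowRep α σ) := by
      rw [Submodule.span_le]
      rintro _ ⟨T, rfl⟩
      exact Submodule.subset_span ⟨σ.symm.trans T, (rowRep_polytabloid μ σ T).symm⟩
    exact this hx

/-- The space of the Specht module `𝕊^μ` of the symmetric group on `|μ|` letters. -/
def SpechtModule (μ : YoungDiagram) : Type :=
  (spechtSub μ (Fin μ.card)).toSubmodule

instance (μ : YoungDiagram) : AddCommGroup (SpechtModule μ) :=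
  inferInstanceAs (AddCommGroup (spechtSub μ (Fin μ.card)).toSubmodule)

instance (μ : YoungDiagram) : Module ℂ (SpechtModule μ) :=
  inferInstanceAs (Module ℂ (spechtSub μ (Fin μ.card)).toSubmodule)

/-- The Specht module `𝕊^μ`, a representation of the symmetric group on `|μ|` letters. -/
def specht (μ : YoungDiagram) :
    Representation ℂ (Equiv.Perm (Fin μ.card)) (SpechtModule μ) :=
  (spechtSub μ (Fin μ.card)).toRepresentation

/-! ## The groups -/

/-- The action of `Perm α` on `C ^ α` by permuting the entries (which is conjugation of diagonal
matrices by permutation matrices). -/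
def permAut (C : Type*) [CommGroup C] (α : Type*) : Equiv.Perm α →* MulAut (α → C) where
  toFun σ :=
    { toFun := fun f a => f (σ.symm a)
      invFun := fun f a => f (σ a)
      left_inv := fun f => by simp
      right_inv := fun f => by simp
      map_mul' := fun f g => rfl }
  map_one' := rfl
  map_mul' σ τ := rfl

/-- `C ^ α ⋊ Perm α`. -/
abbrev Wr (C : Type*) [CommGroup C] (α : Type*) : Type _ := (α → C) ⋊[permAut C α] Equiv.Perm α

/-- The Weyl group `W_n = {±1}^n ⋊ 𝕊_n` of types `B` and `C` (for `α = Fin n`). -/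
abbrev WB (α : Type*) : Type _ := Wr ℤˣ α

/-- The action of `{±1}^α ⋊ Perm α` on `C ^ α` by permuting and inverting the entries. -/
def signedAut (C : Type*) [CommGroup C] (α : Type*) : WB α →* MulAut (α → C) where
  toFun x :=
    { toFun := fun f a => f (x.right.symm a) ^ ((x.left a : ℤˣ) : ℤ)
      invFun := fun f a => f (x.right a) ^ ((x.left (x.right a) : ℤˣ) : ℤ)
      left_inv := fun f => by
        funext a
        rcases Int.units_eq_one_or (x.left (x.right a)) with h | h <;> simp [h]
      right_inv := fun f => by
        funext a
        rcases Int.units_eq_one_or (x.left a) with h | h <;> simp [h]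
      map_mul' := fun f g => by
        funext a
        simp [mul_zpow] }
  map_one' := by
    ext f a
    simp [Equiv.Perm.one_def]
  map_mul' x y := by
    ext f a
    change f ((x.right * y.right).symm a) ^ (((x * y).left a : ℤˣ) : ℤ) =
      (f (y.right.symm (x.right.symm a)) ^ ((y.left (x.right.symm a) : ℤˣ) : ℤ)) ^
        ((x.left a : ℤˣ) : ℤ)
    rw [← zpow_mul, mul_comm]
    congr 1

/-- `C ^ α ⋊ ({±1}^α ⋊ Perm α)`. -/
abbrev SWr (C : Type*) [CommGroup C] (α : Type*) : Type _ := (α → C) ⋊[signedAut C α] WB α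

/-- The cyclic group `C_d` of `d`-th roots of unity. -/
abbrev Cd (d : ℕ) : Type := rootsOfUnity d ℂ

/-- The group `S_{d,n}` of type `A`: `C_d^n ⋊ 𝕊_n`. -/
abbrev SA (d n : ℕ) : Type := Wr (Cd d) (Fin n)

/-- The group `S_{d,n}` of types `B` and `C`: `C_d^n ⋊ W_n`. -/
abbrev SB (d n : ℕ) : Type := SWr (Cd d) (Fin n)

/-- The morphism `C^α ⋊ Perm α → C`, `(t, σ) ↦ ∏ t_a = det t`. -/
def detHom (C : Type*) [CommGroup C] (α : Type*) [Fintype α] : Wr C α →* C where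
  toFun x := ∏ a, x.left a
  map_one' := by simp
  map_mul' x y := by
    simp only [SemidirectProduct.mul_left, Pi.mul_apply, Finset.prod_mul_distrib]
    congr 1
    exact Equiv.prod_comp x.right.symm y.left

/-- The group `S_{d,n}` of type `A*`: `T' ⋊ 𝕊_n` inside `C_d^n ⋊ 𝕊_n`, where `T'` is the group of
diagonal matrices of determinant one; that is, the pairs `(t, σ)` with `∏ t_a = 1`. -/
def SAstar (d n : ℕ) : Subgroup (SA d n) := (detHom (Cd d) (Fin n)).ker

lemma mem_SAstar {d n : ℕ} (g : SA d n) : g ∈ SAstar d n ↔ ∏ a, g.left a = 1 := Iff.rfl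

instance (d n : ℕ) : (SAstar d n).Normal := by
  unfold SAstar
  infer_instance

/-- The Weyl group `W_n'` of type `D`: the elements of `W_n` with an even number of `-1`. -/
def WD (n : ℕ) : Subgroup (WB (Fin n)) := (detHom ℤˣ (Fin n)).ker

lemma mem_WD {n : ℕ} (g : WB (Fin n)) : g ∈ WD n ↔ ∏ a, g.left a = 1 := Iff.rfl

/-- The morphism `ε : C_d^n ⋊ W_n → {±1}`, trivial on `C_d^n` and on `𝕊_n` and sending
`Diag(-1, 1, …, 1)` to `-1`. -/
def epsB (d n : ℕ) : SB d n →* ℤˣ :=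
  (detHom ℤˣ (Fin n)).comp SemidirectProduct.rightHom

/-- The group `S_{d,n}` of type `D`: `C_d^n ⋊ W_n'` inside `C_d^n ⋊ W_n`. -/
def SD (d n : ℕ) : Subgroup (SB d n) := (WD n).comap SemidirectProduct.rightHom

lemma mem_SD {d n : ℕ} (g : SB d n) : g ∈ SD d n ↔ g.right ∈ WD n := Iff.rfl

lemma SD_eq_ker (d n : ℕ) : SD d n = (epsB d n).ker := rfl

instance (d n : ℕ) : (SD d n).Normal := by
  rw [SD_eq_ker]
  infer_instance

/-! ## Block embeddings -/

/-- Relabelling of indices in `C ^ α ⋊ Perm α`. -/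
def Wr.congr {C : Type*} [CommGroup C] {α β : Type*} (e : α ≃ β) : Wr C α →* Wr C β where
  toFun x := ⟨fun b => x.left (e.symm b), e.permCongr x.right⟩
  map_one' := by
    ext b <;> simp
  map_mul' x y := by
    refine SemidirectProduct.ext ?_ ?_
    · funext b
      change x.left (e.symm b) * y.left (x.right.symm (e.symm b)) =
        x.left (e.symm b) * y.left (e.symm (e (x.right.symm (e.symm b))))
      rw [Equiv.symm_apply_apply]
    · ext b
      simp

/-- Block diagonal inclusion of `(C^α ⋊ Perm α) × (C^β ⋊ Perm β)`. -/
def Wr.pair {C : Type*} [CommGroup C] {α β : Type*} : Wr C α × Wr C β →* Wr C (α ⊕ β) where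
  toFun x := ⟨Sum.elim x.1.left x.2.left, Equiv.sumCongr x.1.right x.2.right⟩
  map_one' := by
    refine SemidirectProduct.ext ?_ ?_
    · funext b
      rcases b with b | b <;> rfl
    · ext b
      rcases b with b | b <;> rfl
  map_mul' x y := by
    refine SemidirectProduct.ext ?_ ?_
    · funext b
      rcases b with b | b <;> rfl
    · ext b
      rcases b with b | b <;> rfl

/-- Block diagonal inclusion of `∏ i, (C^(β i) ⋊ Perm (β i))`. -/
def Wr.blocks {C : Type*} [CommGroup C] {ι : Type*} {β : ι → Type*} :
    (∀ i, Wr C (β i)) →* Wr C (Σ i, β i) where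
  toFun x := ⟨fun a => (x a.1).left a.2, Equiv.sigmaCongrRight fun i => (x i).right⟩
  map_one' := rfl
  map_mul' _ _ := rfl

/-- The inclusion `C^α ⋊ Perm α → C^α ⋊ ({±1}^α ⋊ Perm α)`. -/
def Wr.toSWr {C : Type*} [CommGroup C] {α : Type*} : Wr C α →* SWr C α where
  toFun x := ⟨x.left, SemidirectProduct.inr x.right⟩
  map_one' := rfl
  map_mul' x y := by
    refine SemidirectProduct.ext ?_ ?_
    · funext a
      change x.left a * y.left (x.right.symm a) =
        x.left a * (y.left (x.right.symm a)) ^ (((1 : ℤˣ) : ℤ))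
      simp
    · simp

/-- Relabelling of indices in `C^α ⋊ ({±1}^α ⋊ Perm α)`. -/
def SWr.congr {C : Type*} [CommGroup C] {α β : Type*} (e : α ≃ β) : SWr C α →* SWr C β where
  toFun x := ⟨fun b => x.left (e.symm b), Wr.congr e x.right⟩
  map_one' := by
    refine SemidirectProduct.ext ?_ ?_
    · rfl
    · simp
  map_mul' x y := by
    refine SemidirectProduct.ext ?_ ?_
    · funext b
      change x.left (e.symm b) * (y.left (x.right.right.symm (e.symm b))) ^
          ((x.right.left (e.symm b) : ℤˣ) : ℤ) =
        x.left (e.symm b) * (y.left (e.symm (e (x.right.right.symm (e.symm b))))) ^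
          ((x.right.left (e.symm b) : ℤˣ) : ℤ)
      rw [Equiv.symm_apply_apply]
    · simp

/-- Block diagonal inclusion of `(C^α ⋊ W_α) × (C^β ⋊ W_β)`. -/
def SWr.pair {C : Type*} [CommGroup C] {α β : Type*} : SWr C α × SWr C β →* SWr C (α ⊕ β) where
  toFun x := ⟨Sum.elim x.1.left x.2.left, Wr.pair (x.1.right, x.2.right)⟩
  map_one' := by
    refine SemidirectProduct.ext ?_ ?_
    · funext b
      rcases b with b | b <;> rfl
    · exact map_one Wr.pair
  map_mul' x y := by
    refine SemidirectProduct.ext ?_ ?_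
    · funext b
      rcases b with b | b <;> rfl
    · exact map_mul Wr.pair (x.1.right, x.2.right) (y.1.right, y.2.right)

/-! ## Linear characters -/

/-- The character `t ↦ ∏ t_a ^ (ψ a)` of `C_d ^ α` attached to a tuple of exponents `ψ`,
i.e. to the tuple `(t_g ^ (ψ a))_a` of elements of `C_d`. -/
def torusChar {d : ℕ} {α : Type*} [Fintype α] (ψ : α → ℕ) : (α → Cd d) →* ℂˣ where
  toFun t := ∏ a, ((t a : Cd d) : ℂˣ) ^ ψ a
  map_one' := by simp
  map_mul' s t := by simp [mul_pow, Finset.prod_mul_distrib]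

/-- The character `(t, σ) ↦ ∏ t_a ^ k` of `C_d^α ⋊ Perm α`. -/
def charA (d : ℕ) (α : Type*) [Fintype α] (k : ℕ) : Wr (Cd d) α →* ℂˣ :=
  ((rootsOfUnity d ℂ).subtype.comp (detHom (Cd d) α)) ^ k

/-- The character `sgn : (t, σ) ↦ ∏ t_a` of `W_α = {±1}^α ⋊ Perm α`. -/
def sgnW (α : Type*) [Fintype α] : WB α →* ℂˣ :=
  (Units.map (Int.castRingHom ℂ).toMonoidHom).comp (detHom ℤˣ α)

/-- The character of `C_d^α ⋊ W_α` which is trivial on `W_α` and sends `t ∈ C_d^α` to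
`∏ t_a ^ (d / 2)`, for `d` even; it corresponds to the element `-1 = t_g ^ (d / 2)` of `C_d`. -/
def charMinusOne (d : ℕ) (hd : Even d) (α : Type*) [Fintype α] : SWr (Cd d) α →* ℂˣ where
  toFun x := torusChar (fun _ => d / 2) x.left
  map_one' := by simp
  map_mul' x y := by
    rw [SemidirectProduct.mul_left, map_mul]
    congr 1
    have key : ∀ (z : Cd d) (u : ℤˣ), (((z ^ (u : ℤ) : Cd d) : ℂˣ)) ^ (d / 2)
        = ((z : Cd d) : ℂˣ) ^ (d / 2) := by
      intro z u
      have hz : ((z : ℂˣ) ^ (d / 2)) * ((z : ℂˣ) ^ (d / 2)) = 1 := by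
        rw [← pow_add]
        obtain ⟨k, rfl⟩ := hd
        have h2 : (k + k) / 2 + (k + k) / 2 = k + k := by omega
        rw [h2]
        exact (mem_rootsOfUnity _ _).1 z.2
      rcases Int.units_eq_one_or u with h | h
      · simp [h]
      · simp only [h, Units.val_neg, Units.val_one, zpow_neg, zpow_one, InvMemClass.coe_inv,
          inv_pow]
        exact inv_eq_of_mul_eq_one_left hz
    change ∏ a, (((y.left (x.right.right.symm a)) ^ ((x.right.left a : ℤˣ) : ℤ) : Cd d) : ℂˣ)
      ^ (d / 2) = ∏ a, ((y.left a : Cd d) : ℂˣ) ^ (d / 2)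
    simp only [key]
    exact Equiv.prod_comp x.right.right.symm (fun a => ((y.left a : Cd d) : ℂˣ) ^ (d / 2))

/-! ## Type A -/

/-- `𝒬_{d,n}`: functions from the cyclic group `C_d` to the set of partitions (Young diagrams), of
total size `n`. The group `C_d` is written additively as `ZMod d` here, `j` standing for
the power `t_g ^ j` of a fixed generator. -/
def Q (d n : ℕ) [NeZero d] : Type :=
  {Λ : ZMod d → YoungDiagram // ∑ j, (Λ j).card = n}

namespace Q

variable {d n : ℕ} [NeZero d]

/-- The tuple `(λ_1, …, λ_d)` of `Λ`, with `λ_i = Λ (t_g ^ i)`; the entry with index `i : Fin d`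
is `λ_{i+1}`. -/
def part (Λ : Q d n) (i : Fin d) : YoungDiagram := Λ.1 (((i : ℕ) + 1 : ℕ) : ZMod d)

lemma sum_part (Λ : Q d n) : ∑ i : Fin d, (Λ.part i).card = n := by
  have hb : Function.Bijective fun i : Fin d => (((i : ℕ) + 1 : ℕ) : ZMod d) := by
    rw [Fintype.bijective_iff_injective_and_card]
    refine ⟨?_, by simp⟩
    intro i j h
    have h' : ((i : ℕ) : ZMod d) = ((j : ℕ) : ZMod d) := by
      simpa using h
    rw [ZMod.natCast_eq_natCast_iff'] at h'
    rw [Nat.mod_eq_of_lt i.2, Nat.mod_eq_of_lt j.2] at h'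
    exact Fin.ext h'
  have := hb.sum_comp (fun j => (Λ.1 j).card)
  exact this.trans Λ.2

/-- The cyclic shift of `Λ`: `(λ_1, …, λ_d) ↦ (λ_d, λ_1, …, λ_{d-1})`. -/
def shift (Λ : Q d n) : Q d n :=
  ⟨fun j => Λ.1 (j - 1), by
    exact (Equiv.sum_comp (Equiv.subRight (1 : ZMod d)) (fun j => (Λ.1 j).card)).trans Λ.2⟩

/-- `o(Λ)`: the number of distinct cyclic shifts of `(λ_1, …, λ_d)`, that is the least `k > 0` such
that shifting `k` times gives `Λ` back. -/
def o (Λ : Q d n) : ℕ := Function.minimalPeriod shift Λ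

/-- The blocks of sizes `n_1, …, n_d`, from left to right. -/
def blockEquiv (Λ : Q d n) : (Σ i : Fin d, Fin (Λ.part i).card) ≃ Fin n :=
  finSigmaFinEquiv.trans (finCongr Λ.sum_part)

/-- The exponents of the tuple `ψ ∈ C_d^n` which has `t_g ^ i` in the entries of the `i`-th block. -/
def psi (Λ : Q d n) (a : Fin n) : ℕ := ((Λ.blockEquiv.symm a).1 : ℕ) + 1

/-- The inclusion of `∏ N_i` in `C_d^n ⋊ 𝕊_n`, where `N_i = C_d^{n_i} ⋊ 𝕊_{n_i}`. -/
def emb (Λ : Q d n) : (∀ i : Fin d, Wr (Cd d) (Fin (Λ.part i).card)) →* SA d n :=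
  (Wr.congr Λ.blockEquiv).comp Wr.blocks

end Q

/-- `χ_{μ, k} = 𝕊^μ ⊗ t_g ^ k`, a representation of `C_d^m ⋊ 𝕊_m`, `m = |μ|`. -/
def blockA (d : ℕ) (μ : YoungDiagram) (k : ℕ) :
    Representation ℂ (Wr (Cd d) (Fin μ.card)) (SpechtModule μ) :=
  twist (charA d (Fin μ.card) k) ((specht μ).comp SemidirectProduct.rightHom)

/-- The representation `⨂ χ_{λ_i, t_g ^ i}` of `∏ N_i`. -/
def innerA {d n : ℕ} [NeZero d] (Λ : Q d n) :
    Representation ℂ (∀ i : Fin d, Wr (Cd d) (Fin (Λ.part i).card))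
      (⨂[ℂ] i : Fin d, SpechtModule (Λ.part i)) :=
  piTensor fun i => blockA d (Λ.part i) ((i : ℕ) + 1)

/-- `χ_Λ`, the representation of `C_d^n ⋊ 𝕊_n` induced from `∏ N_i`. -/
def chiA {d n : ℕ} [NeZero d] (Λ : Q d n) :
    Representation ℂ (SA d n) (Representation.IndV Λ.emb (innerA Λ)) :=
  Representation.ind Λ.emb (innerA Λ)

/-! ## Types B and C -/

/-- The representation `𝕊^λ ⊗ (𝕊^μ ⊗ sgn)` of `W_{|λ|} × W_{|μ|}`. -/
def innerW (l m : YoungDiagram) :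
    Representation ℂ (WB (Fin l.card) × WB (Fin m.card)) (SpechtModule l ⊗[ℂ] SpechtModule m) :=
  extTensor ((specht l).comp SemidirectProduct.rightHom)
    (twist (sgnW (Fin m.card)) ((specht m).comp SemidirectProduct.rightHom))

/-- The inclusion of `W_a × W_b` in `W_{a+b}`. -/
def embW (a b : ℕ) : WB (Fin a) × WB (Fin b) →* WB (Fin (a + b)) :=
  (Wr.congr finSumFinEquiv).comp Wr.pair

/-- The space of `χ_{λ, μ}`. -/
abbrev VW (l m : YoungDiagram) : Type := Representation.IndV (embW l.card m.card) (innerW l m)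

/-- `χ_{λ, μ}`, the representation of `W_{|λ| + |μ|}` induced from `W_{|λ|} × W_{|μ|}`. -/
def chiW (l m : YoungDiagram) :
    Representation ℂ (WB (Fin (l.card + m.card))) (VW l m) :=
  Representation.ind (embW l.card m.card) (innerW l m)

/-- `ℛ_{d,n}`: tuples of partitions `(λ_1, μ_1, λ_2, μ_2, λ_3, …, λ_{(d+2)/2})` of total size `n`.
The entry with index `i : Fin (d / 2 - 1)` of `tail` is `λ_{i+3}`. -/
@[ext]
structure R (d n : ℕ) where
  /-- `λ_1` -/
  lam1 : YoungDiagram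
  /-- `μ_1` -/
  mu1 : YoungDiagram
  /-- `λ_2` -/
  lam2 : YoungDiagram
  /-- `μ_2` -/
  mu2 : YoungDiagram
  /-- `λ_3, …, λ_{(d+2)/2}` -/
  tail : Fin (d / 2 - 1) → YoungDiagram
  size_eq : (lam1.card + mu1.card) + (lam2.card + mu2.card) + ∑ i, (tail i).card = n

namespace R

variable {d n : ℕ}

/-- `(λ_1, μ_1, λ_2, μ_2, λ_3, …) ↦ (μ_1, λ_1, μ_2, λ_2, λ_3, …)`. -/
def swap (Λ : R d n) : R d n where
  lam1 := Λ.mu1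
  mu1 := Λ.lam1
  lam2 := Λ.mu2
  mu2 := Λ.lam2
  tail := Λ.tail
  size_eq := by
    have := Λ.size_eq
    omega

/-- The blocks of sizes `n_1 = |λ_1| + |μ_1|`, `n_2 = |λ_2| + |μ_2|`, `n_3 = |λ_3|`, …, from left
to right. -/
def blockEquiv (Λ : R d n) :
    (Fin (Λ.lam1.card + Λ.mu1.card) ⊕ Fin (Λ.lam2.card + Λ.mu2.card)) ⊕
      (Σ i, Fin (Λ.tail i).card) ≃ Fin n :=
  ((Equiv.sumCongr finSumFinEquiv finSigmaFinEquiv).trans finSumFinEquiv).trans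
    (finCongr Λ.size_eq)

/-- The exponents of the tuple `ψ ∈ C_d^n` which has `1` in the entries of the first block,
`-1 = t_g ^ (d / 2)` in the second one, and `t_g, t_g ^ 2, …, t_g ^ (d / 2 - 1)` in the others. -/
def psi (Λ : R d n) (a : Fin n) : ℕ :=
  Sum.elim (Sum.elim (fun _ => 0) (fun _ => d / 2)) (fun c => (c.1 : ℕ) + 1) (Λ.blockEquiv.symm a)

/-- `∏ N_i`, where `N_i = C_d^{n_i} ⋊ W_{n_i}` for `i = 1, 2` and `N_i = C_d^{n_i} ⋊ 𝕊_{n_i}` for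
`i > 2`. -/
abbrev Blocks (Λ : R d n) : Type :=
  (SWr (Cd d) (Fin (Λ.lam1.card + Λ.mu1.card)) × SWr (Cd d) (Fin (Λ.lam2.card + Λ.mu2.card))) ×
    (∀ i, Wr (Cd d) (Fin (Λ.tail i).card))

/-- The inclusion of `∏ N_i` in `C_d^n ⋊ W_n`. -/
def emb (Λ : R d n) : Λ.Blocks →* SB d n :=
  (SWr.congr Λ.blockEquiv).comp
    (SWr.pair.comp (MonoidHom.prodMap SWr.pair (Wr.toSWr.comp Wr.blocks)))

end R

/-- The representation `(χ_{λ_1, μ_1, 1} ⊗ χ_{λ_2, μ_2, -1}) ⊗ ⨂_{i > 2} χ_{λ_i, ψ_i}` of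
`∏ N_i`. -/
def innerB {d n : ℕ} (hd : Even d) (Λ : R d n) :
    Representation ℂ Λ.Blocks
      ((VW Λ.lam1 Λ.mu1 ⊗[ℂ] VW Λ.lam2 Λ.mu2) ⊗[ℂ] (⨂[ℂ] i, SpechtModule (Λ.tail i))) :=
  extTensor
    (extTensor
      ((chiW Λ.lam1 Λ.mu1).comp SemidirectProduct.rightHom)
      (twist (charMinusOne d hd _) ((chiW Λ.lam2 Λ.mu2).comp SemidirectProduct.rightHom)))
    (piTensor fun i => blockA d (Λ.tail i) ((i : ℕ) + 1))

/-- `χ_Λ`, the representation of `C_d^n ⋊ W_n` induced from `∏ N_i`. -/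
def chiB {d n : ℕ} (hd : Even d) (Λ : R d n) :
    Representation ℂ (SB d n) (Representation.IndV Λ.emb (innerB hd Λ)) :=
  Representation.ind Λ.emb (innerB hd Λ)

/-! ## The twisting characters -/

/-- `ε : C_d^n ⋊ 𝕊_n → C_d`, `(t, σ) ↦ det t`, as a linear character. -/
def epsCharA (d n : ℕ) : SA d n →* ℂˣ := charA d (Fin n) 1

/-- `ε : C_d^n ⋊ W_n → {±1}`, as a linear character. -/
def epsCharB (d n : ℕ) : SB d n →* ℂˣ :=
  (Units.map (Int.castRingHom ℂ).toMonoidHom).comp (epsB d n)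

end YokonumaIrr

end

set_option linter.unusedSectionVars false

/-! Each big group is `A ⋊ H` with `A = C_d^n` finite abelian, and two classical methods give
everything: little groups for types `A`, `B`, `C`, and Clifford theory for the kernel of a linear
character for types `A*` and `D`. The working notion is `Linked`, the existence of a nonzero
intertwining map. Frobenius reciprocity is a statement about it (`linked_ind`, `Linked.of_ind`), and
between irreducible representations it amounts to isomorphism by Schur's lemma
(`Linked.nonempty_equiv`). Isomorphisms therefore never have to be written down on induced spaces.

Little groups. Suppose `A` acts on a representation `σ` of `N` through a character `ψ`. Then the
induced representation is a sum of `A`-eigenspaces for conjugates of `ψ`, and if `N` contains the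
whole stabilizer of `ψ`, the `ψ`-eigenspace is `σ` itself (`ActsBy.mem_range`). So induction
preserves irreducibility (`ActsBy.isIrreducible_ind`), and the induced representation determines the
orbit of `ψ` (`ActsBy.exists_conj`) and then `σ` (`ActsBy.linked`). Conversely every nonzero
representation has an `A`-eigenvector (`exists_eigen_ne_bot`), and its eigenspace is a
representation of the stabilizer, to which reciprocity applies.

Characters of `C_d^n` are tuples of exponents mod `d`. Under permutations only the block sizes
matter, and the stabilizer is the product of the diagonal blocks. With inversions, exponents can be
moved into `[0, d/2]`; only `0` and `d/2` are fixed by inversion, so these two blocks keep their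
signs and the others lose them (`zpow_powChar_eq_iff`). The Weyl group representations `χ_{λ,μ}` are
the type `A` construction with `{±1}` in place of `C_d`.

What remains are products of symmetric groups. Specht modules are irreducible and distinct by
James's argument with column antisymmetrizers and dominance (`isIrreducible_spechtRep`,
`eq_of_linked_spechtRep`), and complete because there are as many as conjugacy classes
(`covers_spechtRep`). Tensor products are handled by Schur orthogonality in operator form
(`act_mat_self`): rank-one operators on an irreducible space come from explicit functions on the
group.

Clifford theory. For `N = ker c` with `c ^ d = 1`, averaging an `N`-map against all powers of `c`
recovers it up to a nonzero factor (`exists_sum_avg`). Hence a common factor over `N` comes from a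
twist by some `c ^ k` (`exists_linked_twist`), and the restriction of `ρ` splits into the
eigenspaces of an isomorphism from `ρ` to its first isomorphic twist (`restrictionSplits`). The
twist by the determinant shifts the parameters, and the twist by the sign swaps them
(`nonempty_equiv_twist_chiA`, `nonempty_equiv_twist_chiB`). -/

noncomputable section

namespace YokonumaIrr

/-! ## Intertwining maps of complex representations of finite groups -/

section Basics

variable {G V W X : Type*} [Group G] [AddCommGroup V] [Module ℂ V] [AddCommGroup W] [Module ℂ W]
  [AddCommGroup X] [Module ℂ X]

/-- The linear map `f` commutes with the actions `ρ` and `σ`. -/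
def Intw (ρ : Representation ℂ G V) (σ : Representation ℂ G W) (f : V →ₗ[ℂ] W) : Prop :=
  ∀ g v, f (ρ g v) = σ g (f v)

/-- There is a nonzero intertwining map from `ρ` to `σ`. -/
def Linked (ρ : Representation ℂ G V) (σ : Representation ℂ G W) : Prop :=
  ∃ f : V →ₗ[ℂ] W, Intw ρ σ f ∧ f ≠ 0

variable {ρ : Representation ℂ G V} {σ : Representation ℂ G W} {τ : Representation ℂ G X}

lemma rep_inv_apply (ρ : Representation ℂ G V) (g : G) (v : V) : ρ g⁻¹ (ρ g v) = v := by
  rw [← Module.End.mul_apply, ← map_mul]; simp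

lemma rep_apply_inv (ρ : Representation ℂ G V) (g : G) (v : V) : ρ g (ρ g⁻¹ v) = v := by
  rw [← Module.End.mul_apply, ← map_mul]; simp

lemma Intw.comp {f : V →ₗ[ℂ] W} {g : W →ₗ[ℂ] X} (hg : Intw σ τ g) (hf : Intw ρ σ f) :
    Intw ρ τ (g ∘ₗ f) := fun x v => by simp [hf x v, hg x (f v)]

lemma isIrreducible_iff : ρ.IsIrreducible ↔ Nontrivial V ∧
    ∀ U : Submodule ℂ V, (∀ g, ∀ v ∈ U, ρ g v ∈ U) → U = ⊥ ∨ U = ⊤ := by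
  constructor
  · intro h
    refine ⟨?_, fun U hU => ?_⟩
    · by_contra hV
      rw [not_nontrivial_iff_subsingleton] at hV
      have : (⊥ : Subrepresentation ρ) ≠ ⊤ := bot_ne_top
      exact this (Subrepresentation.toSubmodule_injective (Subsingleton.elim _ _))
    · rcases IsSimpleOrder.eq_bot_or_eq_top (⟨U, fun g v hv => hU g v hv⟩ : Subrepresentation ρ)
        with h | h
      · left
        exact congrArg Subrepresentation.toSubmodule h
      · right
        exact congrArg Subrepresentation.toSubmodule h
  · rintro ⟨h1, h2⟩
    refine { exists_pair_ne := ⟨⊥, ⊤, fun h => ?_⟩, eq_bot_or_eq_top := fun U => ?_ }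
    · exact bot_ne_top (α := Submodule ℂ V) (congrArg Subrepresentation.toSubmodule h)
    · rcases h2 U.toSubmodule fun g v hv => U.apply_mem_toSubmodule g hv with h | h
      · left
        exact Subrepresentation.toSubmodule_injective h
      · right
        exact Subrepresentation.toSubmodule_injective h

lemma Intw.injective (hρ : ρ.IsIrreducible) {f : V →ₗ[ℂ] W} (hf : Intw ρ σ f) (h0 : f ≠ 0) :
    Function.Injective f := by
  rcases (isIrreducible_iff.1 hρ).2 (LinearMap.ker f)
    (fun g v hv => by simp_all [hf g v]) with h | h
  · exact LinearMap.ker_eq_bot.1 h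
  · exact absurd (LinearMap.ker_eq_top.1 h) h0

lemma Intw.surjective (hσ : σ.IsIrreducible) {f : V →ₗ[ℂ] W} (hf : Intw ρ σ f) (h0 : f ≠ 0) :
    Function.Surjective f := by
  rcases (isIrreducible_iff.1 hσ).2 (LinearMap.range f) (by
    rintro g _ ⟨v, rfl⟩
    exact ⟨ρ g v, hf g v⟩) with h | h
  · exact absurd (LinearMap.range_eq_bot.1 h) h0
  · exact LinearMap.range_eq_top.1 h

lemma nonempty_equiv_of_intw {e : V ≃ₗ[ℂ] W} (he : Intw ρ σ e.toLinearMap) :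
    Nonempty (ρ.Equiv σ) :=
  ⟨Representation.Equiv.mk e fun g => LinearMap.ext fun v => he g v⟩

lemma exists_intw_of_equiv (e : ρ.Equiv σ) : ∃ e : V ≃ₗ[ℂ] W, Intw ρ σ e.toLinearMap :=
  ⟨e.toLinearEquiv, fun g v => LinearMap.congr_fun (e.toIntertwiningMap.isIntertwining' g) v⟩

lemma nonempty_equiv_iff :
    Nonempty (ρ.Equiv σ) ↔ ∃ e : V ≃ₗ[ℂ] W, Intw ρ σ e.toLinearMap :=
  ⟨fun ⟨e⟩ => exists_intw_of_equiv e, fun ⟨_, he⟩ => nonempty_equiv_of_intw he⟩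

lemma nonempty_equiv_trans (h : Nonempty (ρ.Equiv σ)) (h' : Nonempty (σ.Equiv τ)) :
    Nonempty (ρ.Equiv τ) := ⟨h.some.trans h'.some⟩

lemma nonempty_equiv_symm (h : Nonempty (ρ.Equiv σ)) : Nonempty (σ.Equiv ρ) := ⟨h.some.symm⟩

/-- Schur's lemma: the kernel and the range of an intertwining map are invariant. This is what lets
a single nonzero map replace an explicit isomorphism later on. -/
lemma Linked.nonempty_equiv (h : Linked ρ σ) (hρ : ρ.IsIrreducible) (hσ : σ.IsIrreducible) :
    Nonempty (ρ.Equiv σ) := by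
  obtain ⟨f, hf, h0⟩ := h
  let e := LinearEquiv.ofBijective f ⟨hf.injective hρ h0, hf.surjective hσ h0⟩
  exact nonempty_equiv_of_intw (e := e) fun g v => hf g v

lemma linked_of_equiv [Nontrivial V] (h : Nonempty (ρ.Equiv σ)) : Linked ρ σ := by
  obtain ⟨e, he⟩ := nonempty_equiv_iff.1 h
  refine ⟨e.toLinearMap, he, fun h0 => ?_⟩
  obtain ⟨v, hv⟩ := exists_ne (0 : V)
  exact hv (e.injective (by simpa using LinearMap.congr_fun h0 v))

lemma Linked.trans_equiv (h : Linked ρ σ) (h' : Nonempty (σ.Equiv τ)) : Linked ρ τ := by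
  obtain ⟨f, hf, h0⟩ := h
  obtain ⟨e, he⟩ := nonempty_equiv_iff.1 h'
  refine ⟨e.toLinearMap ∘ₗ f, he.comp hf, fun h => h0 (LinearMap.ext fun v => ?_)⟩
  exact e.injective (by simpa using LinearMap.congr_fun h v)

lemma Linked.of_equiv (h' : Nonempty (ρ.Equiv σ)) (h : Linked σ τ) : Linked ρ τ := by
  obtain ⟨f, hf, h0⟩ := h
  obtain ⟨e, he⟩ := nonempty_equiv_iff.1 h'
  refine ⟨f ∘ₗ e.toLinearMap, hf.comp he, fun h => h0 (LinearMap.ext fun v => ?_)⟩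
  simpa using LinearMap.congr_fun h (e.symm v)

lemma Linked.of_comp {N : Type*} [Group N] {φ : N →* G} (hφ : Function.Surjective φ)
    (h : Linked (ρ.comp φ) (σ.comp φ)) : Linked ρ σ := by
  obtain ⟨f, hf, h0⟩ := h
  refine ⟨f, fun g v => ?_, h0⟩
  obtain ⟨n, rfl⟩ := hφ g
  exact hf n v

lemma isIrreducible_comp {N : Type*} [Group N] {φ : N →* G} (hφ : Function.Surjective φ)
    (hρ : ρ.IsIrreducible) : (Representation.IsIrreducible (ρ.comp φ)) := by
  rw [isIrreducible_iff] at hρ ⊢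
  refine ⟨hρ.1, fun U hU => hρ.2 U fun g v hv => ?_⟩
  obtain ⟨n, rfl⟩ := hφ g
  exact hU n v hv

lemma twist_apply (c : G →* ℂˣ) (ρ : Representation ℂ G V) (g : G) (v : V) :
    twist c ρ g v = (c g : ℂ) • ρ g v := rfl

lemma isIrreducible_twist (c : G →* ℂˣ) (hρ : ρ.IsIrreducible) : (twist c ρ).IsIrreducible := by
  rw [isIrreducible_iff] at hρ ⊢
  refine ⟨hρ.1, fun U hU => hρ.2 U fun g v hv => ?_⟩
  have := U.smul_mem ((c g)⁻¹ : ℂˣ).val (hU g v hv)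
  rwa [twist_apply, smul_smul, ← Units.val_mul, inv_mul_cancel, Units.val_one, one_smul] at this

lemma Intw.twist (c : G →* ℂˣ) {f : V →ₗ[ℂ] W} (hf : Intw ρ σ f) :
    Intw (twist c ρ) (twist c σ) f := fun g v => by simp [twist_apply, hf g v]

lemma Intw.of_twist (c : G →* ℂˣ) {f : V →ₗ[ℂ] W}
    (hf : Intw (YokonumaIrr.twist c ρ) (YokonumaIrr.twist c σ) f) :
    Intw ρ σ f := fun g v => by
  have := hf g v
  simp only [twist_apply, map_smul] at this
  exact (smul_right_injective W (c g).ne_zero) this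

lemma nonempty_equiv_twist (c : G →* ℂˣ) (h : Nonempty (ρ.Equiv σ)) :
    Nonempty ((YokonumaIrr.twist c ρ).Equiv (YokonumaIrr.twist c σ)) := by
  obtain ⟨e, he⟩ := nonempty_equiv_iff.1 h
  exact nonempty_equiv_of_intw (he.twist c)

/-- The average of a linear map over the group. -/
def avg [Fintype G] (ρ : Representation ℂ G V) (σ : Representation ℂ G W) (T : V →ₗ[ℂ] W) :
    V →ₗ[ℂ] W :=
  (Fintype.card G : ℂ)⁻¹ • ∑ g : G, σ g ∘ₗ T ∘ₗ ρ g⁻¹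

lemma avg_apply [Fintype G] (T : V →ₗ[ℂ] W) (v : V) :
    avg ρ σ T v = (Fintype.card G : ℂ)⁻¹ • ∑ g : G, σ g (T (ρ g⁻¹ v)) := by
  simp [avg, LinearMap.sum_apply]

lemma intw_avg [Fintype G] (T : V →ₗ[ℂ] W) : Intw ρ σ (avg ρ σ T) := by
  intro x v
  rw [avg_apply, avg_apply, map_smul, map_sum]
  congr 1
  rw [← Equiv.sum_comp (Equiv.mulLeft x)]
  refine Finset.sum_congr rfl fun g _ => ?_
  simp only [Equiv.coe_mulLeft, mul_inv_rev, map_mul, Module.End.mul_apply, rep_inv_apply]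

lemma card_ne_zero' (G : Type*) [Group G] [Fintype G] : (Fintype.card G : ℂ) ≠ 0 := by
  exact_mod_cast Fintype.card_ne_zero

/-- Maschke's theorem: average any linear projection onto `U` over the group. -/
lemma exists_intw_projection [Finite G] (U : Submodule ℂ V) (hU : ∀ g, ∀ v ∈ U, ρ g v ∈ U) :
    ∃ P : V →ₗ[ℂ] V, Intw ρ ρ P ∧ (∀ v, P v ∈ U) ∧ ∀ u ∈ U, P u = u := by
  cases nonempty_fintype G
  obtain ⟨p, hp⟩ := LinearMap.exists_extend (LinearMap.id : U →ₗ[ℂ] U)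
  refine ⟨avg ρ ρ (U.subtype ∘ₗ p), intw_avg _, fun v => ?_, fun u hu => ?_⟩
  · rw [avg_apply]
    exact U.smul_mem _ (U.sum_mem fun g _ => hU _ _ (p _).2)
  · rw [avg_apply]
    have : ∀ g : G, ρ g ((U.subtype ∘ₗ p) (ρ g⁻¹ u)) = u := fun g => by
      have h1 := LinearMap.congr_fun hp ⟨ρ g⁻¹ u, hU _ _ hu⟩
      simp only [LinearMap.comp_apply, Submodule.subtype_apply, LinearMap.id_apply] at h1 ⊢
      rw [h1, rep_apply_inv]
    simp only [this, Finset.sum_const, Finset.card_univ]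
    rw [← Nat.cast_smul_eq_nsmul ℂ, smul_smul, inv_mul_cancel₀ (card_ne_zero' G), one_smul]

/-- An invariant subspace is the image of an equivariant projection; if that projection is a scalar,
the subspace is zero or everything. Irreducibility of tensor products, induced representations and
Specht modules is checked through this criterion. -/
lemma isIrreducible_of_scalar [Finite G] [Nontrivial V]
    (h : ∀ T, Intw ρ ρ T → ∃ c : ℂ, ∀ v, T v = c • v) : ρ.IsIrreducible := by
  refine isIrreducible_iff.2 ⟨inferInstance, fun U hU => ?_⟩
  obtain ⟨P, hP, hP1, hP2⟩ := exists_intw_projection U hU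
  obtain ⟨c, hc⟩ := h P hP
  by_cases h0 : c = 0
  · left
    rw [eq_bot_iff]
    intro u hu
    have := hP2 u hu
    rw [hc, h0, zero_smul] at this
    simp [← this]
  · right
    rw [eq_top_iff]
    intro v _
    have := U.smul_mem c⁻¹ (hP1 v)
    rwa [hc, smul_smul, inv_mul_cancel₀ h0, one_smul] at this

lemma span_orbit_invariant (ρ : Representation ℂ G V) (v : V) :
    ∀ g, ∀ w ∈ Submodule.span ℂ (Set.range fun g => ρ g v),
      ρ g w ∈ Submodule.span ℂ (Set.range fun g => ρ g v) := by
  intro g w hw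
  have : Submodule.span ℂ (Set.range fun g => ρ g v) ≤
      (Submodule.span ℂ (Set.range fun g => ρ g v)).comap (ρ g) := by
    rw [Submodule.span_le]
    rintro _ ⟨h, rfl⟩
    refine Submodule.subset_span ⟨g * h, ?_⟩
    simp
  exact this hw

/-- The orbit of a nonzero vector is finite and spans an invariant subspace. This allows irreducible
representations to be quantified over without a dimension hypothesis. -/
lemma finiteDimensional_of_isIrreducible [Finite G] (hρ : ρ.IsIrreducible) :
    FiniteDimensional ℂ V := by
  obtain ⟨_, h⟩ := isIrreducible_iff.1 hρ
  obtain ⟨v, hv⟩ := exists_ne (0 : V)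
  rcases h _ (span_orbit_invariant ρ v) with h | h
  · exfalso
    have : v ∈ Submodule.span ℂ (Set.range fun g => ρ g v) :=
      Submodule.subset_span ⟨1, by simp⟩
    rw [h] at this
    exact hv (by simpa using this)
  · exact ⟨(Submodule.fg_def).2 ⟨_, Set.finite_range _, h⟩⟩

/-- Schur's lemma over `ℂ`: some eigenspace of `T` is nonzero, and it is invariant. -/
lemma exists_scalar_of_intw [Finite G] (hρ : ρ.IsIrreducible) {T : V →ₗ[ℂ] V} (hT : Intw ρ ρ T) :
    ∃ c : ℂ, ∀ v, T v = c • v := by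
  have := finiteDimensional_of_isIrreducible hρ
  have := (isIrreducible_iff.1 hρ).1
  obtain ⟨c, hc⟩ := Module.End.exists_eigenvalue T
  refine ⟨c, fun v => ?_⟩
  rcases (isIrreducible_iff.1 hρ).2 (Module.End.eigenspace T c) (fun g v hv => by
    rw [Module.End.mem_eigenspace_iff] at hv ⊢
    rw [hT, hv, map_smul]) with h | h
  · exact absurd h hc
  · have : v ∈ Module.End.eigenspace T c := by rw [h]; trivial
    exact Module.End.mem_eigenspace_iff.1 this

/-- The ambient space may be infinite-dimensional, so minimality is taken among the nonzero
finite-dimensional invariant subspaces; the span of an orbit shows that there is one. -/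
lemma exists_irreducible_sub [Finite G] [Nontrivial V] (ρ : Representation ℂ G V) :
    ∃ U : Subrepresentation ρ, U.toRepresentation.IsIrreducible := by
  obtain ⟨v, hv⟩ := exists_ne (0 : V)
  let P : ℕ → Prop := fun n => ∃ U : Subrepresentation ρ, FiniteDimensional ℂ U.toSubmodule ∧
    U.toSubmodule ≠ ⊥ ∧ Module.finrank ℂ U.toSubmodule = n
  have hP : ∃ n, P n := by
    refine ⟨_, ⟨_, fun g w hw => span_orbit_invariant ρ v g w hw⟩,
      FiniteDimensional.span_of_finite ℂ (Set.finite_range _), fun h => ?_, rfl⟩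
    have : v ∈ Submodule.span ℂ (Set.range fun g => ρ g v) :=
      Submodule.subset_span ⟨1, by simp⟩
    exact hv (by simpa using h.le this)
  classical
  obtain ⟨U, hU1, hU2, hU3⟩ := Nat.find_spec hP
  refine ⟨U, isIrreducible_iff.2 ⟨Submodule.nontrivial_iff_ne_bot.2 hU2, fun M hM => ?_⟩⟩
  by_contra hcon
  push Not at hcon
  have hlt : Module.finrank ℂ M < Module.finrank ℂ U.toSubmodule := Submodule.finrank_lt hcon.2
  rw [hU3] at hlt
  refine Nat.find_min hP hlt ⟨⟨M.map U.toSubmodule.subtype, ?_⟩, ?_, ?_, ?_⟩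
  · rintro g _ ⟨m, hm, rfl⟩
    exact ⟨_, hM g m hm, rfl⟩
  · exact Module.Finite.map M U.toSubmodule.subtype
  · intro h
    apply hcon.1
    exact Submodule.map_injective_of_injective U.toSubmodule.injective_subtype
      (h.trans (Submodule.map_bot _).symm)
  · exact (LinearEquiv.finrank_eq (Submodule.equivMapOfInjective _ U.toSubmodule.injective_subtype M)).symm

lemma Intw.exists_leftInverse [Finite G] {f : V →ₗ[ℂ] W} (hf : Intw ρ σ f)
    (hi : Function.Injective f) : ∃ p : W →ₗ[ℂ] V, Intw σ ρ p ∧ ∀ v, p (f v) = v := by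
  cases nonempty_fintype G
  obtain ⟨q, hq⟩ := LinearMap.exists_leftInverse_of_injective f (LinearMap.ker_eq_bot.2 hi)
  refine ⟨avg σ ρ q, intw_avg _, fun v => ?_⟩
  rw [avg_apply]
  have : ∀ g : G, ρ g (q (σ g⁻¹ (f v))) = v := fun g => by
    have h1 := LinearMap.congr_fun hq (ρ g⁻¹ v)
    simp only [LinearMap.comp_apply, LinearMap.id_apply] at h1
    rw [← hf, h1, rep_apply_inv]
  simp only [this, Finset.sum_const, Finset.card_univ]
  rw [← Nat.cast_smul_eq_nsmul ℂ, smul_smul, inv_mul_cancel₀ (card_ne_zero' G), one_smul]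

/-- Complete reducibility makes the relation symmetric: an embedding has an equivariant left
inverse. -/
lemma Linked.symm_left [Finite G] (hρ : ρ.IsIrreducible) (h : Linked ρ σ) : Linked σ ρ := by
  obtain ⟨f, hf, h0⟩ := h
  obtain ⟨p, hp, hpf⟩ := hf.exists_leftInverse (hf.injective hρ h0)
  refine ⟨p, hp, fun h => h0 (LinearMap.ext fun v => ?_)⟩
  rw [← hpf v, h]
  simp

lemma isFactor_of_injective {f : V →ₗ[ℂ] W} (hf : Intw ρ σ f) (hi : Function.Injective f) :
    IsFactor ρ σ := by
  let U : Subrepresentation σ := ⟨LinearMap.range f, by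
    rintro g _ ⟨v, rfl⟩
    exact ⟨ρ g v, hf g v⟩⟩
  refine ⟨U, ?_⟩
  refine nonempty_equiv_of_intw (e := LinearEquiv.ofInjective f hi) fun g v => ?_
  exact Subtype.ext (hf g v)

lemma intw_subtype (U : Subrepresentation ρ) :
    Intw U.toRepresentation ρ U.toSubmodule.subtype := fun _ _ => rfl

lemma linked_sub {U : Subrepresentation ρ} (h : Linked σ U.toRepresentation) : Linked σ ρ := by
  obtain ⟨f, hf, h0⟩ := h
  refine ⟨U.toSubmodule.subtype ∘ₗ f, (intw_subtype U).comp hf, fun h => h0 ?_⟩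
  ext v
  simpa using LinearMap.congr_fun h v

lemma IsFactor.exists_injective (h : IsFactor ρ σ) :
    ∃ f : V →ₗ[ℂ] W, Intw ρ σ f ∧ Function.Injective f := by
  obtain ⟨U, hU⟩ := h
  obtain ⟨e, he⟩ := nonempty_equiv_iff.1 hU
  exact ⟨_, (intw_subtype U).comp he, U.toSubmodule.injective_subtype.comp e.injective⟩

/-! ## Matrix coefficients -/

/-- The operator `∑ a(h) ρ(h)` attached to a function `a` on the group. -/
def act [Fintype G] (ρ : Representation ℂ G V) : (G → ℂ) →ₗ[ℂ] V →ₗ[ℂ] V :=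
  ∑ h : G, (LinearMap.proj h).smulRight (ρ h)

lemma act_apply [Fintype G] (ρ : Representation ℂ G V) (a : G → ℂ) (v : V) :
    act ρ a v = ∑ h : G, a h • ρ h v := by
  simp [act, LinearMap.sum_apply]

lemma Intw.act [Fintype G] {f : V →ₗ[ℂ] W} (hf : Intw ρ σ f) (a : G → ℂ) (v : V) :
    f (act ρ a v) = YokonumaIrr.act σ a (f v) := by
  simp [act_apply, hf _ _]

/-- The normalized matrix coefficient `h ↦ (dim V / |G|) ℓ (ρ(h)⁻¹ v)`. -/
def mat [Fintype G] (ρ : Representation ℂ G V) (ℓ : V →ₗ[ℂ] ℂ) : V →ₗ[ℂ] (G → ℂ) :=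
  LinearMap.pi fun h => ((Module.finrank ℂ V : ℂ) / Fintype.card G) • (ℓ ∘ₗ ρ h⁻¹)

lemma mat_apply [Fintype G] (ℓ : V →ₗ[ℂ] ℂ) (v : V) (h : G) :
    mat ρ ℓ v h = ((Module.finrank ℂ V : ℂ) / Fintype.card G) * ℓ (ρ h⁻¹ v) := by
  simp [mat]

lemma mat_equivariant [Fintype G] (ℓ : V →ₗ[ℂ] ℂ) (g h : G) (v : V) :
    mat ρ ℓ (ρ g v) h = mat ρ ℓ v (g⁻¹ * h) := by
  simp [mat_apply]

/-- Schur orthogonality in operator form. Up to the factor `dim V`, the left side is the average of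
the rank-one operator `x ↦ ℓ x • u`, applied to `v`. That average is a scalar by Schur, and
comparing traces gives the scalar `ℓ u / dim V`. -/
lemma act_mat_self [Fintype G] (hρ : ρ.IsIrreducible) (ℓ : V →ₗ[ℂ] ℂ) (u v : V) :
    act ρ (mat ρ ℓ v) u = ℓ u • v := by
  have := finiteDimensional_of_isIrreducible hρ
  have := (isIrreducible_iff.1 hρ).1
  have hn : (Module.finrank ℂ V : ℂ) ≠ 0 := by
    exact_mod_cast Module.finrank_pos.ne'
  obtain ⟨c, hc⟩ := exists_scalar_of_intw hρ (intw_avg (ρ := ρ) (σ := ρ) (ℓ.smulRight u))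
  have h1 : act ρ (mat ρ ℓ v) u
      = (Module.finrank ℂ V : ℂ) • avg ρ ρ (ℓ.smulRight u) v := by
    rw [act_apply, avg_apply, smul_smul, Finset.smul_sum]
    refine Finset.sum_congr rfl fun h _ => ?_
    rw [mat_apply, LinearMap.smulRight_apply, map_smul, smul_smul]
    congr 1
  have h2 : LinearMap.trace ℂ V (avg ρ ρ (ℓ.smulRight u)) = ℓ u := by
    rw [avg, map_smul, map_sum]
    -- Conjugation does not change the trace, so every term contributes the trace `ℓ u` of the
    -- rank-one operator.
    have : ∀ g : G, LinearMap.trace ℂ V (ρ g ∘ₗ ℓ.smulRight u ∘ₗ ρ g⁻¹) = ℓ u := fun g => by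
      have hg : ρ g⁻¹ ∘ₗ ρ g = LinearMap.id := LinearMap.ext fun v => rep_inv_apply ρ g v
      rw [← LinearMap.comp_assoc, LinearMap.trace_comp_comm', ← LinearMap.comp_assoc, hg,
        LinearMap.id_comp, LinearMap.trace_smulRight]
    simp only [this, Finset.sum_const, Finset.card_univ, nsmul_eq_mul, smul_eq_mul]
    rw [← mul_assoc, inv_mul_cancel₀ (card_ne_zero' G), one_mul]
  have h3 : avg ρ ρ (ℓ.smulRight u) = c • LinearMap.id := LinearMap.ext fun v => by simp [hc]
  rw [h3, map_smul, LinearMap.trace_id, smul_eq_mul] at h2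
  rw [h1, hc, smul_smul, mul_comm, h2]

/-- The map `v ↦ ∑ (mat v)(h) σ(h) x`, an intertwining map from `ρ` to `σ`. -/
def orbitMap [Fintype G] (ρ : Representation ℂ G V) (σ : Representation ℂ G W) (ℓ : V →ₗ[ℂ] ℂ)
    (x : W) : V →ₗ[ℂ] W := ((act σ).flip x) ∘ₗ mat ρ ℓ

lemma orbitMap_apply [Fintype G] (ℓ : V →ₗ[ℂ] ℂ) (x : W) (v : V) :
    orbitMap ρ σ ℓ x v = act σ (mat ρ ℓ v) x := rfl

lemma intw_orbitMap [Fintype G] (ℓ : V →ₗ[ℂ] ℂ) (x : W) : Intw ρ σ (orbitMap ρ σ ℓ x) := by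
  intro g v
  rw [orbitMap_apply, orbitMap_apply, act_apply, act_apply, map_sum,
    ← Equiv.sum_comp (Equiv.mulLeft g)]
  refine Finset.sum_congr rfl fun h _ => ?_
  rw [mat_equivariant]
  simp

/-- Used in contrapositive form: if `ρ` does not occur in `σ`, the matrix coefficients of `ρ`
annihilate `σ`. -/
lemma linked_of_act_ne_zero [Fintype G] {ℓ : V →ₗ[ℂ] ℂ} {x : W} {v : V}
    (h : act σ (mat ρ ℓ v) x ≠ 0) : Linked ρ σ :=
  ⟨orbitMap ρ σ ℓ x, intw_orbitMap ℓ x, fun h0 => h (by rw [← orbitMap_apply, h0]; rfl)⟩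

lemma exists_functional_ne_zero [Nontrivial V] : ∃ (ℓ : V →ₗ[ℂ] ℂ) (w : V), ℓ w = 1 := by
  obtain ⟨v, hv⟩ := exists_ne (0 : V)
  obtain ⟨ℓ, hℓ⟩ := Module.Projective.exists_dual_ne_zero ℂ hv
  exact ⟨ℓ, (ℓ v)⁻¹ • v, by simp [hℓ]⟩

end Basics

/-- Every nonzero representation of `G` (in the given universe) contains one of the `ρ j`. -/
def Covers {G : Type*} [Group G] {J : Type*} {V : J → Type*} [∀ j, AddCommGroup (V j)]
    [∀ j, Module ℂ (V j)] (ρ : ∀ j, Representation ℂ G (V j)) : Prop :=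
  ∀ (X : Type u) [AddCommGroup X] [Module ℂ X] (σ : Representation ℂ G X), Nontrivial X →
    ∃ j, Linked (ρ j) σ

/-! ## Matrix coefficients span -/

/-- The left regular representation on functions. -/
def leftReg (G : Type*) [Group G] : Representation ℂ G (G → ℂ) where
  toFun g := LinearMap.funLeft ℂ ℂ fun h => g⁻¹ * h
  map_one' := by ext; simp [LinearMap.funLeft_apply]
  map_mul' g h := by ext; simp [LinearMap.funLeft_apply, mul_assoc]

lemma leftReg_apply {G : Type*} [Group G] (g h : G) (a : G → ℂ) :
    leftReg G g a h = a (g⁻¹ * h) := rfl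

/-- The span `M` is stable under left translation, hence has an invariant complement. If the
complement were nonzero it would receive some `ρ j`; but the image vectors of such a map are matrix
coefficients of `ρ j` up to scalars, so they lie in `M` as well and vanish. -/
lemma span_mat_eq_top {G : Type} [Group G] [Fintype G] {J : Type*} {V : J → Type*}
    [∀ j, AddCommGroup (V j)] [∀ j, Module ℂ (V j)] {ρ : ∀ j, Representation ℂ G (V j)}
    (hirr : ∀ j, (ρ j).IsIrreducible) (hcov : Covers.{0} ρ) :
    Submodule.span ℂ (Set.range fun p : Σ j, (V j →ₗ[ℂ] ℂ) × V j => mat (ρ p.1) p.2.1 p.2.2)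
      = ⊤ := by
  set M := Submodule.span ℂ
    (Set.range fun p : Σ j, (V j →ₗ[ℂ] ℂ) × V j => mat (ρ p.1) p.2.1 p.2.2) with hM
  have hinv : ∀ g, ∀ a ∈ M, leftReg G g a ∈ M := by
    intro g a ha
    have : M ≤ M.comap (leftReg G g) := by
      rw [hM, Submodule.span_le]
      rintro _ ⟨⟨j, ℓ, v⟩, rfl⟩
      refine Submodule.subset_span ⟨⟨j, ℓ, ρ j g v⟩, ?_⟩
      funext h
      exact mat_equivariant ℓ g h v
    exact this ha
  obtain ⟨P, hP, hP1, hP2⟩ := exists_intw_projection M hinv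
  by_contra htop
  have hK : Nontrivial (LinearMap.ker P) := by
    rw [Submodule.nontrivial_iff_ne_bot]
    intro hbot
    apply htop
    rw [eq_top_iff]
    intro a _
    have : a - P a ∈ LinearMap.ker P := by
      rw [LinearMap.mem_ker, map_sub, hP2 _ (hP1 a), sub_self]
    rw [hbot, Submodule.mem_bot, sub_eq_zero] at this
    rw [this]
    exact hP1 a
  let K : Subrepresentation (leftReg G) := ⟨LinearMap.ker P, fun g a ha => by
    rw [LinearMap.mem_ker] at ha ⊢
    rw [hP, ha, map_zero]⟩
  obtain ⟨j, f, hf, h0⟩ := hcov _ K.toRepresentation hK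
  apply h0
  ext1 v
  refine Subtype.ext ?_
  -- Evaluation at the identity: by equivariance the function `f v` is then the matrix coefficient
  -- of `v` against this functional.
  let ℓ : V j →ₗ[ℂ] ℂ := LinearMap.proj 1 ∘ₗ K.toSubmodule.subtype ∘ₗ f
  have hval : ∀ h, (f v : G → ℂ) h = ℓ (ρ j h⁻¹ v) := fun h => by
    have : (f (ρ j h⁻¹ v) : G → ℂ) = leftReg G h⁻¹ (f v : G → ℂ) :=
      congrArg Subtype.val (hf h⁻¹ v)
    change _ = (f (ρ j h⁻¹ v) : G → ℂ) 1
    rw [this, leftReg_apply]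
    simp
  have := finiteDimensional_of_isIrreducible (hirr j)
  have := (isIrreducible_iff.1 (hirr j)).1
  have hn : (Module.finrank ℂ (V j) : ℂ) ≠ 0 := by
    exact_mod_cast Module.finrank_pos.ne'
  have hmem : (f v : G → ℂ) ∈ M := by
    have : (f v : G → ℂ) =
        ((Module.finrank ℂ (V j) : ℂ) / Fintype.card G)⁻¹ • mat (ρ j) ℓ v := by
      funext h
      rw [Pi.smul_apply, mat_apply, smul_eq_mul, ← mul_assoc,
        inv_mul_cancel₀ (div_ne_zero hn (card_ne_zero' G)), one_mul, hval]
    rw [this]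
    exact M.smul_mem _ (Submodule.subset_span ⟨⟨j, ℓ, v⟩, rfl⟩)
  rw [← hP2 _ hmem]
  exact LinearMap.mem_ker.1 (f v).2

/-! ## Tensor products of two representations -/

section Two

variable {G H V W V' W' : Type*} [Group G] [Group H]
  [AddCommGroup V] [Module ℂ V] [AddCommGroup W] [Module ℂ W]
  [AddCommGroup V'] [Module ℂ V'] [AddCommGroup W'] [Module ℂ W']
  {ρ : Representation ℂ G V} {σ : Representation ℂ H W}
  {ρ' : Representation ℂ G V'} {σ' : Representation ℂ H W'}

lemma extTensor_tmul (g : G × H) (v : V) (w : W) :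
    extTensor ρ σ g (v ⊗ₜ w) = ρ g.1 v ⊗ₜ σ g.2 w := rfl

lemma act_extTensor [Fintype G] [Fintype H] (a : G → ℂ) (b : H → ℂ) :
    act (extTensor ρ σ) (fun x => a x.1 * b x.2) = TensorProduct.map (act ρ a) (act σ b) := by
  ext v w
  simp only [TensorProduct.AlgebraTensorModule.curry_apply, TensorProduct.curry_apply,
    LinearMap.coe_restrictScalars, TensorProduct.map_tmul, act_apply, extTensor_tmul,
    TensorProduct.sum_tmul, TensorProduct.tmul_sum, Fintype.sum_prod_type, TensorProduct.smul_tmul,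
    TensorProduct.tmul_smul, Finset.smul_sum, smul_smul]
  rw [Finset.sum_comm]
  simp only [mul_comm]

/-- Products of matrix coefficients act as rank-one operators with arbitrary pure tensors as image.
Any intertwining map commutes with these operators, so it is controlled by its value at the single
vector `z`. -/
lemma exists_extTensor_formula [Fintype G] [Fintype H] (hρ : ρ.IsIrreducible)
    (hσ : σ.IsIrreducible) : ∃ (ℓ : V →ₗ[ℂ] ℂ) (m : W →ₗ[ℂ] ℂ) (L : V ⊗[ℂ] W →ₗ[ℂ] ℂ)
      (z : V ⊗[ℂ] W), L z = 1 ∧ ∀ v w y,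
        act (extTensor ρ σ) (fun x => mat ρ ℓ v x.1 * mat σ m w x.2) y = L y • (v ⊗ₜ w) := by
  have := (isIrreducible_iff.1 hρ).1
  have := (isIrreducible_iff.1 hσ).1
  obtain ⟨ℓ, v₀, hℓ⟩ := exists_functional_ne_zero (V := V)
  obtain ⟨m, w₀, hm⟩ := exists_functional_ne_zero (V := W)
  refine ⟨ℓ, m, TensorProduct.lift ((LinearMap.mul ℂ ℂ).compl₁₂ ℓ m), v₀ ⊗ₜ w₀, by simp [hℓ, hm],
    fun v w y => ?_⟩
  rw [act_extTensor]
  induction y with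
  | zero => simp
  | add x y hx hy => rw [map_add, hx, hy, map_add, add_smul]
  | tmul p q =>
    rw [TensorProduct.map_tmul, act_mat_self hρ, act_mat_self hσ]
    simp [TensorProduct.smul_tmul, smul_smul, mul_comm]

lemma isIrreducible_extTensor [Finite G] [Finite H] (hρ : ρ.IsIrreducible)
    (hσ : σ.IsIrreducible) : (extTensor ρ σ).IsIrreducible := by
  cases nonempty_fintype G
  cases nonempty_fintype H
  obtain ⟨ℓ, m, L, z, hz, h⟩ := exists_extTensor_formula hρ hσ
  have : Nontrivial (V ⊗[ℂ] W) := ⟨z, 0, fun h0 => by simp [h0] at hz⟩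
  refine isIrreducible_of_scalar fun T hT => ⟨L (T z), fun v => ?_⟩
  have key : T = L (T z) • LinearMap.id := by
    ext v w
    have h1 := h v w z
    rw [hz, one_smul] at h1
    simp only [TensorProduct.AlgebraTensorModule.curry_apply, TensorProduct.curry_apply,
      LinearMap.coe_restrictScalars, LinearMap.smul_apply, LinearMap.id_apply]
    rw [← h v w (T z), ← hT.act, h1]
  rw [key]
  simp [hz]

/-- If `f (v ⊗ w) ≠ 0`, write `v ⊗ w` as the image of `z` under a product of matrix coefficients and
move that product through `f`. On the target it is a tensor product of two operators, so neither of
them vanishes. -/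
lemma Linked.extTensor [Finite G] [Finite H] (hρ : ρ.IsIrreducible)
    (hσ : σ.IsIrreducible) (hl : Linked (extTensor ρ σ) (extTensor ρ' σ')) :
    Linked ρ ρ' ∧ Linked σ σ' := by
  cases nonempty_fintype G
  cases nonempty_fintype H
  obtain ⟨ℓ, m, L, z, hz, h⟩ := exists_extTensor_formula hρ hσ
  obtain ⟨f, hf, h0⟩ := hl
  have : ∃ v w, f (v ⊗ₜ w) ≠ 0 := by
    by_contra hcon
    push Not at hcon
    exact h0 (TensorProduct.ext' fun v w => by simpa using hcon v w)
  obtain ⟨v, w, hvw⟩ := this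
  have h1 := h v w z
  rw [hz, one_smul] at h1
  rw [← h1, hf.act, act_extTensor] at hvw
  constructor
  · by_contra hcon
    refine hvw ?_
    have : act ρ' (mat ρ ℓ v) = 0 := LinearMap.ext fun x => by
      by_contra hx
      exact hcon (linked_of_act_ne_zero hx)
    rw [this, TensorProduct.map_zero_left]
    rfl
  · by_contra hcon
    refine hvw ?_
    have : act σ' (mat σ m w) = 0 := LinearMap.ext fun x => by
      by_contra hx
      exact hcon (linked_of_act_ne_zero hx)
    rw [this, TensorProduct.map_zero_right]
    rfl

lemma nonempty_equiv_extTensor (h : Nonempty (ρ.Equiv ρ')) (h' : Nonempty (σ.Equiv σ')) :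
    Nonempty ((extTensor ρ σ).Equiv (extTensor ρ' σ')) := by
  obtain ⟨e, he⟩ := nonempty_equiv_iff.1 h
  obtain ⟨e', he'⟩ := nonempty_equiv_iff.1 h'
  refine nonempty_equiv_of_intw (e := TensorProduct.congr e e') fun g x => ?_
  induction x with
  | zero => simp
  | add x y hx hy => rw [map_add, map_add, hx, hy, map_add, map_add]
  | tmul p q =>
    have h1 := he g.1 p
    have h2 := he' g.2 q
    simp only [LinearEquiv.coe_coe] at h1 h2
    simp [extTensor_tmul, h1, h2]

/-- Some `ρ j` occurs over `G`. Its multiplicity space, cut out by an element of the group algebra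
of `G`, is a nonzero representation of `H` and contains some `σ k`. The product map is then
assembled from matrix coefficients. -/
lemma exists_linked_extTensor [Finite G] [Finite H] {J K : Type*} {V : J → Type*} {W : K → Type*}
    [∀ j, AddCommGroup (V j)] [∀ j, Module ℂ (V j)] [∀ j, AddCommGroup (W j)]
    [∀ j, Module ℂ (W j)] {ρ : ∀ j, Representation ℂ G (V j)} {σ : ∀ j, Representation ℂ H (W j)}
    (hirr : ∀ j, (ρ j).IsIrreducible) (hcov : Covers.{u} ρ) (hcov' : Covers.{u} σ)
    {X : Type u} [AddCommGroup X] [Module ℂ X] (τ : Representation ℂ (G × H) X) [Nontrivial X] :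
    ∃ j k, Linked (extTensor (ρ j) (σ k)) τ := by
  cases nonempty_fintype G
  cases nonempty_fintype H
  let τ₁ : Representation ℂ G X := τ.comp (MonoidHom.inl G H)
  let τ₂ : Representation ℂ H X := τ.comp (MonoidHom.inr G H)
  have hcomm : ∀ g h x, τ₁ g (τ₂ h x) = τ₂ h (τ₁ g x) := fun g h x => by
    change τ (g, 1) (τ (1, h) x) = τ (1, h) (τ (g, 1) x)
    rw [← Module.End.mul_apply, ← Module.End.mul_apply, ← map_mul, ← map_mul]
    simp
  have hcomm' : ∀ a h x, act τ₁ a (τ₂ h x) = τ₂ h (act τ₁ a x) := fun a h x => by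
    simp [act_apply, hcomm]
  obtain ⟨j, f, hf, h0⟩ := hcov X τ₁ inferInstance
  have := (isIrreducible_iff.1 (hirr j)).1
  obtain ⟨ℓ, w, hw⟩ := exists_functional_ne_zero (V := V j)
  have hx0 : f w ≠ 0 := fun h => by
    have hi := hf.injective (hirr j) h0
    rw [hi (h.trans f.map_zero.symm)] at hw
    simp at hw
  -- A copy of the multiplicity space: the fixed vectors of the operator of the matrix coefficient
  -- of `w`, which by `ℓ w = 1` fixes the image of `w`. The actions of `G` and `H` commute, so it is
  -- `H`-stable.
  let Y : Subrepresentation τ₂ := ⟨LinearMap.eqLocus (act τ₁ (mat (ρ j) ℓ w)) LinearMap.id, by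
    intro h x hx
    rw [LinearMap.mem_eqLocus] at hx ⊢
    rw [hcomm', hx]
    rfl⟩
  have hY : Nontrivial Y.toSubmodule := by
    refine ⟨⟨f w, ?_⟩, 0, fun h => hx0 (congrArg Subtype.val h)⟩
    change act τ₁ (mat (ρ j) ℓ w) (f w) = f w
    rw [← hf.act, act_mat_self (hirr j), hw, one_smul]
  obtain ⟨k, t, ht, ht0⟩ := hcov' _ Y.toRepresentation hY
  refine ⟨j, k, TensorProduct.lift
    (((act τ₁).compl₂ (Y.toSubmodule.subtype ∘ₗ t)) ∘ₗ mat (ρ j) ℓ), ?_, ?_⟩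
  · intro g x
    induction x with
    | zero => simp
    | add x y hx hy => rw [map_add, map_add, hx, hy, map_add, map_add]
    | tmul p q =>
      rw [extTensor_tmul]
      simp only [TensorProduct.lift.tmul, LinearMap.comp_apply, LinearMap.compl₂_apply]
      have h1 : Y.toSubmodule.subtype (t (σ k g.2 q)) = τ₂ g.2 (Y.toSubmodule.subtype (t q)) :=
        congrArg Subtype.val (ht g.2 q)
      rw [h1, hcomm']
      have h2 := intw_orbitMap (ρ := ρ j) (σ := τ₁) ℓ (Y.toSubmodule.subtype (t q)) g.1 p
      rw [orbitMap_apply, orbitMap_apply] at h2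
      rw [h2]
      change τ (1, g.2) (τ (g.1, 1) _) = τ g _
      rw [← Module.End.mul_apply, ← map_mul]
      simp
  · intro hz
    apply ht0
    ext1 q
    refine Subtype.ext ?_
    -- At `w ⊗ q` the constructed map returns `t q`, because `t q` is fixed by that operator.
    have := LinearMap.congr_fun hz (w ⊗ₜ q)
    simp only [TensorProduct.lift.tmul, LinearMap.comp_apply, LinearMap.compl₂_apply] at this
    have hq : act τ₁ (mat (ρ j) ℓ w) (t q : X) = t q := (t q).2
    rw [Submodule.subtype_apply, hq] at this
    exact this

end Two

/-! ## Tensor products of finite families -/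

section Pi

variable {ι : Type} [Fintype ι] [DecidableEq ι] {G : ι → Type} [∀ i, Group (G i)]
  {V V' : ι → Type*} [∀ i, AddCommGroup (V i)] [∀ i, Module ℂ (V i)]
  [∀ i, AddCommGroup (V' i)] [∀ i, Module ℂ (V' i)]
  {ρ : ∀ i, Representation ℂ (G i) (V i)} {ρ' : ∀ i, Representation ℂ (G i) (V' i)}

/-- The function `g ↦ ∏ a_i (g_i)`, as a multilinear map. -/
def box (G : ι → Type) : MultilinearMap ℂ (fun i => G i → ℂ) ((∀ i, G i) → ℂ) :=
  MultilinearMap.pi fun g =>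
    (MultilinearMap.mkPiAlgebra ℂ ι ℂ).compLinearMap fun i => LinearMap.proj (g i)

lemma box_apply (a : ∀ i, G i → ℂ) (g : ∀ i, G i) : box G a g = ∏ i, a i (g i) := by
  simp [box]

lemma piTensor_tprod (g : ∀ i, G i) (v : ∀ i, V i) :
    piTensor ρ g (PiTensorProduct.tprod ℂ v) = PiTensorProduct.tprod ℂ fun i => ρ i (g i) (v i) :=
  PiTensorProduct.map_tprod _ _

lemma act_piTensor [∀ i, Fintype (G i)] (a : ∀ i, G i → ℂ) :
    act (piTensor ρ) (box G a) = PiTensorProduct.map fun i => act (ρ i) (a i) := by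
  ext v
  simp only [LinearMap.compMultilinearMap_apply, PiTensorProduct.map_tprod, act_apply,
    piTensor_tprod, box_apply]
  rw [MultilinearMap.map_sum]
  refine Finset.sum_congr rfl fun g _ => ?_
  rw [MultilinearMap.map_smul_univ]

/-- The analogue of `exists_extTensor_formula` for finite families, with the same consequences. -/
lemma exists_piTensor_formula [∀ i, Fintype (G i)] (hρ : ∀ i, (ρ i).IsIrreducible) :
    ∃ (ℓ : ∀ i, V i →ₗ[ℂ] ℂ) (L : (⨂[ℂ] i, V i) →ₗ[ℂ] ℂ) (z : ⨂[ℂ] i, V i), L z = 1 ∧ ∀ v y,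
      act (piTensor ρ) (box G fun i => mat (ρ i) (ℓ i) (v i)) y
        = L y • PiTensorProduct.tprod ℂ v := by
  have := fun i => (isIrreducible_iff.1 (hρ i)).1
  choose ℓ w hw using fun i => exists_functional_ne_zero (V := V i)
  let L : (⨂[ℂ] i, V i) →ₗ[ℂ] ℂ :=
    PiTensorProduct.lift ((MultilinearMap.mkPiAlgebra ℂ ι ℂ).compLinearMap ℓ)
  have hL : ∀ u, L (PiTensorProduct.tprod ℂ u) = ∏ i, ℓ i (u i) := fun u => by simp [L]
  refine ⟨ℓ, L, PiTensorProduct.tprod ℂ w, by simp [hL, hw], fun v y => ?_⟩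
  have : act (piTensor ρ) (box G fun i => mat (ρ i) (ℓ i) (v i))
      = L.smulRight (PiTensorProduct.tprod ℂ v) := by
    rw [act_piTensor]
    ext u
    simp only [LinearMap.compMultilinearMap_apply, PiTensorProduct.map_tprod,
      LinearMap.smulRight_apply, hL, fun i => act_mat_self (hρ i)]
    rw [MultilinearMap.map_smul_univ]
  rw [this, LinearMap.smulRight_apply]

lemma isIrreducible_piTensor [∀ i, Finite (G i)] (hρ : ∀ i, (ρ i).IsIrreducible) :
    (piTensor ρ).IsIrreducible := by
  have := fun i => Fintype.ofFinite (G i)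
  obtain ⟨ℓ, L, z, hz, h⟩ := exists_piTensor_formula hρ
  have : Nontrivial (⨂[ℂ] i, V i) := ⟨z, 0, fun h0 => by simp [h0] at hz⟩
  refine isIrreducible_of_scalar fun T hT => ⟨L (T z), fun v => ?_⟩
  have key : T = L (T z) • LinearMap.id := by
    ext v
    have h1 := h v z
    rw [hz, one_smul] at h1
    simp only [LinearMap.compMultilinearMap_apply, LinearMap.smul_apply, LinearMap.id_apply]
    rw [← h v (T z), ← hT.act, h1]
  rw [key]
  simp [hz]

lemma Linked.piTensor [∀ i, Finite (G i)] (hρ : ∀ i, (ρ i).IsIrreducible)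
    (hl : Linked (piTensor ρ) (piTensor ρ')) (i : ι) : Linked (ρ i) (ρ' i) := by
  have := fun i => Fintype.ofFinite (G i)
  obtain ⟨ℓ, L, z, hz, h⟩ := exists_piTensor_formula hρ
  obtain ⟨f, hf, h0⟩ := hl
  have : ∃ v, f (PiTensorProduct.tprod ℂ v) ≠ 0 := by
    by_contra hcon
    push Not at hcon
    exact h0 (PiTensorProduct.ext (MultilinearMap.ext fun v => by simpa using hcon v))
  obtain ⟨v, hv⟩ := this
  have h1 := h v z
  rw [hz, one_smul] at h1
  rw [← h1, hf.act, act_piTensor] at hv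
  by_contra hcon
  refine hv ?_
  have h2 : act (ρ' i) (mat (ρ i) (ℓ i) (v i)) = 0 := LinearMap.ext fun x => by
    by_contra hx
    exact hcon (linked_of_act_ne_zero hx)
  have h3 : PiTensorProduct.map (fun i => act (ρ' i) (mat (ρ i) (ℓ i) (v i))) = 0 := by
    ext u
    simp only [LinearMap.compMultilinearMap_apply, PiTensorProduct.map_tprod]
    refine MultilinearMap.map_coord_zero _ i ?_
    rw [h2]
    rfl
  rw [h3]
  rfl

lemma nonempty_equiv_piTensor (h : ∀ i, Nonempty ((ρ i).Equiv (ρ' i))) :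
    Nonempty ((piTensor ρ).Equiv (piTensor ρ')) := by
  choose e he using fun i => nonempty_equiv_iff.1 (h i)
  refine nonempty_equiv_of_intw (e := PiTensorProduct.congr e) fun g x => ?_
  have : (PiTensorProduct.congr e).toLinearMap ∘ₗ piTensor ρ g
      = piTensor ρ' g ∘ₗ (PiTensorProduct.congr e).toLinearMap := by
    ext v
    have h1 := fun i => he i (g i) (v i)
    simp only [LinearEquiv.coe_coe] at h1
    simp [piTensor_tprod, h1]
  exact LinearMap.congr_fun this x

/-- If no tensor product occurred in `τ`, all products of matrix coefficients would act by zero.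
Since the matrix coefficients of each factor span all functions, so would the whole group algebra,
including the identity. Coverage of each factor in `Type` is enough here, whatever the universe of
`X`. -/
lemma exists_linked_piTensor [∀ i, Finite (G i)] {J : ι → Type*} {V : ∀ i, J i → Type*}
    [∀ i j, AddCommGroup (V i j)] [∀ i j, Module ℂ (V i j)]
    {ρ : ∀ i (j : J i), Representation ℂ (G i) (V i j)}
    (hirr : ∀ i j, (ρ i j).IsIrreducible) (hcov : ∀ i, Covers.{0} (ρ i))
    {X : Type*} [AddCommGroup X] [Module ℂ X] (τ : Representation ℂ (∀ i, G i) X) [Nontrivial X] :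
    ∃ j : ∀ i, J i, Linked (piTensor fun i => ρ i (j i)) τ := by
  have := fun i => Fintype.ofFinite (G i)
  by_contra hcon
  push Not at hcon
  have hzero : ∀ (j : ∀ i, J i) (ℓ : ∀ i, V i (j i) →ₗ[ℂ] ℂ) (v : ∀ i, V i (j i)),
      act τ (box G fun i => mat (ρ i (j i)) (ℓ i) (v i)) = 0 := by
    intro j ℓ v
    ext x
    let f : (⨂[ℂ] i, V i (j i)) →ₗ[ℂ] X := PiTensorProduct.lift
      (((act τ).flip x).compMultilinearMap
        ((box G).compLinearMap fun i => mat (ρ i (j i)) (ℓ i)))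
    have hfv : ∀ v, f (PiTensorProduct.tprod ℂ v)
        = act τ (box G fun i => mat (ρ i (j i)) (ℓ i) (v i)) x := fun v => by simp [f]
    have hf : Intw (piTensor fun i => ρ i (j i)) τ f := by
      intro g y
      have : f ∘ₗ piTensor (fun i => ρ i (j i)) g = τ g ∘ₗ f := by
        ext v
        simp only [LinearMap.compMultilinearMap_apply, LinearMap.comp_apply, piTensor_tprod, hfv]
        rw [act_apply, act_apply, map_sum, ← Equiv.sum_comp (Equiv.mulLeft g)]
        refine Finset.sum_congr rfl fun h _ => ?_
        simp only [box_apply, mat_equivariant, Equiv.coe_mulLeft, Pi.mul_apply,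
          inv_mul_cancel_left, map_mul, Module.End.mul_apply, map_smul]
      exact LinearMap.congr_fun this y
    by_contra hx
    refine hcon j ⟨f, hf, fun h0 => hx ?_⟩
    rw [← hfv, h0]
    rfl
  have hz : (act τ).compMultilinearMap (box G) = 0 := by
    refine MultilinearMap.ext_of_span_eq_top
      (g := fun i (p : Σ j, (V i j →ₗ[ℂ] ℂ) × V i j) => mat (ρ i p.1) p.2.1 p.2.2)
      (fun i => span_mat_eq_top (hirr i) (hcov i)) fun p => ?_
    exact hzero (fun i => (p i).1) (fun i => (p i).2.1) fun i => (p i).2.2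
  obtain ⟨x, hx⟩ := exists_ne (0 : X)
  classical
  -- The product of the delta functions at `1` is the delta function at the identity of the product,
  -- which acts as the identity operator.
  have := LinearMap.congr_fun (MultilinearMap.congr_fun hz fun i => Pi.single 1 1) x
  rw [LinearMap.compMultilinearMap_apply, act_apply, Finset.sum_eq_single 1] at this
  · simp [box_apply] at this
    exact hx this
  · intro g _ hg
    rw [box_apply]
    obtain ⟨i, hi⟩ := Function.ne_iff.1 hg
    rw [Finset.prod_eq_zero (Finset.mem_univ i), zero_smul]
    exact Pi.single_eq_of_ne hi _
  · simp

end Pi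

open Representation (ind IndV)

/-! ## Induced representations -/

section Ind

variable {N N' Γ V V' X : Type*} [Group N] [Group N'] [Group Γ] [AddCommGroup V] [Module ℂ V]
  [AddCommGroup V'] [Module ℂ V'] [AddCommGroup X] [Module ℂ X]
  {φ : N →* Γ} {φ' : N' →* Γ} {σ : Representation ℂ N V} {σ' : Representation ℂ N' V'}
  {τ : Representation ℂ Γ X}

/-- The defining relation of the coinvariants. In this model `N` acts on `Γ` from the left and `Γ`
acts on the induced space by right translation by `g⁻¹`, which is why inverses appear in the
formulas below. -/
lemma indV_mk_mul (φ : N →* Γ) (σ : Representation ℂ N V) (n : N) (h : Γ) (v : V) :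
    IndV.mk φ σ (φ n * h) (σ n v) = IndV.mk φ σ h v := by
  have := Representation.Coinvariants.mk_self_apply
    (Representation.tprod ((Representation.leftRegular ℂ Γ).comp φ) σ) n
    ((MonoidAlgebra.single h (1 : ℂ)) ⊗ₜ v)
  simpa using this

lemma indV_mk_mul' (φ : N →* Γ) (σ : Representation ℂ N V) (n : N) (h : Γ) (v : V) :
    IndV.mk φ σ (φ n * h) v = IndV.mk φ σ h (σ n⁻¹ v) := by
  rw [← indV_mk_mul φ σ n h, rep_apply_inv]

lemma exists_indLift (φ : N →* Γ) (σ : Representation ℂ N V) (f : Γ → V →ₗ[ℂ] X)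
    (hf : ∀ n h v, f (φ n * h) (σ n v) = f h v) :
    ∃ F : IndV φ σ →ₗ[ℂ] X, ∀ h v, F (IndV.mk φ σ h v) = f h v := by
  refine ⟨Representation.Coinvariants.lift _ (TensorProduct.lift ((Finsupp.lift _ _ _ f) ∘ₗ
    (MonoidAlgebra.coeffLinearEquiv ℂ).toLinearMap)) fun n => ?_, fun h v => ?_⟩
  · ext h v
    simp [hf]
  · simp

lemma indV_span_eq_top (φ : N →* Γ) (σ : Representation ℂ N V) :
    Submodule.span ℂ (Set.range fun p : Γ × V => IndV.mk φ σ p.1 p.2) = ⊤ := by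
  rw [← Submodule.ker_mkQ (Submodule.span ℂ _), LinearMap.ker_eq_top]
  refine Representation.IndV.hom_ext φ σ fun h => LinearMap.ext fun v => ?_
  change Submodule.Quotient.mk (IndV.mk φ σ h v) = 0
  rw [Submodule.Quotient.mk_eq_zero]
  exact Submodule.subset_span ⟨(h, v), rfl⟩

lemma ind_apply_mk (φ : N →* Γ) (σ : Representation ℂ N V) (g h : Γ) (v : V) :
    ind φ σ g (IndV.mk φ σ h v) = IndV.mk φ σ (h * g⁻¹) v := Representation.ind_mk φ σ g h v

lemma indV_mk_eq (φ : N →* Γ) (σ : Representation ℂ N V) (h : Γ) (v : V) :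
    IndV.mk φ σ h v = ind φ σ h⁻¹ (IndV.mk φ σ 1 v) := by
  rw [ind_apply_mk]
  simp

lemma ind_apply_mk_one (φ : N →* Γ) (σ : Representation ℂ N V) (n : N) (v : V) :
    ind φ σ (φ n) (IndV.mk φ σ 1 v) = IndV.mk φ σ 1 (σ n v) := by
  rw [ind_apply_mk, one_mul, ← map_inv]
  have := indV_mk_mul' φ σ n⁻¹ 1 v
  rwa [mul_one, inv_inv] at this

/-- Frobenius reciprocity: `f` extends by `mk h v ↦ τ h⁻¹ (f v)`. -/
lemma linked_ind (h : Linked σ (τ.comp φ)) : Linked (ind φ σ) τ := by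
  obtain ⟨f, hf, h0⟩ := h
  obtain ⟨F, hF⟩ := exists_indLift φ σ (fun h => τ h⁻¹ ∘ₗ f) fun n h v => by
    rw [LinearMap.comp_apply, hf n v, mul_inv_rev, map_mul, Module.End.mul_apply]
    change τ h⁻¹ (τ (φ n)⁻¹ (τ (φ n) (f v))) = _
    rw [rep_inv_apply]
    rfl
  refine ⟨F, fun g x => ?_, fun hF0 => h0 (LinearMap.ext fun v => ?_)⟩
  · have : F ∘ₗ ind φ σ g = τ g ∘ₗ F := by
      refine Representation.IndV.hom_ext φ σ fun h => LinearMap.ext fun v => ?_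
      change F (ind φ σ g (IndV.mk φ σ h v)) = τ g (F (IndV.mk φ σ h v))
      rw [ind_apply_mk, hF, hF]
      simp
    exact LinearMap.congr_fun this x
  · have := hF 1 v
    rw [hF0] at this
    simpa using this.symm

lemma intw_mk_one (φ : N →* Γ) (σ : Representation ℂ N V) :
    Intw σ ((ind φ σ).comp φ) (IndV.mk φ σ 1) := fun n v => (ind_apply_mk_one φ σ n v).symm

/-- The converse half of Frobenius reciprocity: the induced space is generated by the vectors `mk 1
v`, so a nonzero map is nonzero on them. -/
lemma Linked.of_ind (h : Linked (ind φ σ) τ) : Linked σ (τ.comp φ) := by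
  obtain ⟨F, hF, h0⟩ := h
  refine ⟨F ∘ₗ IndV.mk φ σ 1, fun n v => ?_, fun hF0 => h0 ?_⟩
  · change F (IndV.mk φ σ 1 (σ n v)) = τ (φ n) (F (IndV.mk φ σ 1 v))
    rw [← ind_apply_mk_one, hF]
  · refine Representation.IndV.hom_ext φ σ fun h => LinearMap.ext fun v => ?_
    change F (IndV.mk φ σ h v) = 0
    rw [indV_mk_eq, hF]
    have : F (IndV.mk φ σ 1 v) = 0 := LinearMap.congr_fun hF0 v
    rw [this, map_zero]

/-- The lift of the function equal to `σ n⁻¹` at `φ n` and to zero off the range of `φ` is a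
retraction; injectivity of `φ` makes the function well defined. -/
lemma indV_mk_one_injective (hφ : Function.Injective φ) (σ : Representation ℂ N V) :
    Function.Injective (IndV.mk φ σ 1) := by
  classical
  let f : Γ → V →ₗ[ℂ] V := fun h => if hn : ∃ n, φ n = h then σ (hn.choose)⁻¹ else 0
  have hf1 : ∀ n, f (φ n) = σ n⁻¹ := fun n => by
    have hn : ∃ m, φ m = φ n := ⟨n, rfl⟩
    have : f (φ n) = σ (hn.choose)⁻¹ := dif_pos hn
    rw [this, hφ hn.choose_spec]
  obtain ⟨F, hF⟩ := exists_indLift φ σ f fun n h v => by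
    by_cases hn : ∃ m, φ m = h
    · obtain ⟨m, rfl⟩ := hn
      rw [← map_mul, hf1, hf1, mul_inv_rev, map_mul, Module.End.mul_apply, rep_inv_apply]
    · have h1 : f h = 0 := dif_neg hn
      have h2 : f (φ n * h) = 0 := dif_neg fun ⟨m, hm⟩ => hn ⟨n⁻¹ * m, by simp [hm]⟩
      rw [h1, h2]
      rfl
  intro v w hvw
  have h1 := hF 1 v
  have h2 := hF 1 w
  rw [hvw, h2, ← map_one φ, hf1] at h1
  simpa using h1.symm

lemma nontrivial_indV (hφ : Function.Injective φ) (σ : Representation ℂ N V) [Nontrivial V] :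
    Nontrivial (IndV φ σ) := (indV_mk_one_injective hφ σ).nontrivial

/-- The element `x` conjugates one embedding into the other, so `v ↦ mk x (f v)` is equivariant and
reciprocity applies. It makes the choice and the order of the blocks irrelevant. -/
lemma linked_ind_ind (hφ' : Function.Injective φ') (θ : N →* N') (x : Γ)
    (hx : ∀ n, φ' (θ n) * x = x * φ n) (h : Linked σ (σ'.comp θ)) :
    Linked (ind φ σ) (ind φ' σ') := by
  obtain ⟨f, hf, h0⟩ := h
  refine linked_ind ⟨IndV.mk φ' σ' x ∘ₗ f, fun n v => ?_, fun hF => h0 (LinearMap.ext fun v => ?_)⟩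
  · change IndV.mk φ' σ' x (f (σ n v)) = ind φ' σ' (φ n) (IndV.mk φ' σ' x (f v))
    rw [hf, ind_apply_mk, ← indV_mk_mul φ' σ' (θ n) (x * (φ n)⁻¹), ← mul_assoc, hx]
    simp
  · apply indV_mk_one_injective hφ' σ'
    have : IndV.mk φ' σ' x (f v) = 0 := LinearMap.congr_fun hF v
    rw [indV_mk_eq] at this
    have h2 := congrArg (ind φ' σ' x) this
    rw [rep_apply_inv, map_zero] at h2
    rw [h2]
    simp

lemma linked_twist_ind (hφ : Function.Injective φ) (c : Γ →* ℂˣ) [Nontrivial V] :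
    Linked (ind φ (twist (c.comp φ) σ)) (twist c (ind φ σ)) := by
  refine linked_ind ⟨IndV.mk φ σ 1, fun n v => ?_, fun h => ?_⟩
  · rw [twist_apply, map_smul, ← ind_apply_mk_one]
    rfl
  · obtain ⟨v, hv⟩ := exists_ne (0 : V)
    exact hv (indV_mk_one_injective hφ σ (by rw [h]; simp))

end Ind

/-! ## Little groups -/

section Little

variable {A H : Type*} [CommGroup A] [Group H] {f : H →* MulAut A}
  {N N' V V' X : Type*} [Group N] [Group N'] [AddCommGroup V] [Module ℂ V]
  [AddCommGroup V'] [Module ℂ V'] [AddCommGroup X] [Module ℂ X]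
  {φ : N →* A ⋊[f] H} {φ' : N' →* A ⋊[f] H}
  {σ : Representation ℂ N V} {σ' : Representation ℂ N' V'} {τ : Representation ℂ (A ⋊[f] H) X}

lemma semi_mul_inl (h : A ⋊[f] H) (a : A) :
    h * SemidirectProduct.inl a = SemidirectProduct.inl (f h.right a) * h := by
  refine SemidirectProduct.ext ?_ ?_
  · simp [mul_comm]
  · simp

/-- The subgroup `A` acts through the character `ψ` in the representation `σ` of `N`. -/
def ActsBy (φ : N →* A ⋊[f] H) (σ : Representation ℂ N V) (ψ : A →* ℂˣ) : Prop :=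
  ∃ j : A → N, (∀ a, φ (j a) = SemidirectProduct.inl a) ∧ ∀ a v, σ (j a) v = (ψ a : ℂ) • v

variable {ψ ψ' : A →* ℂˣ}

/-- Moving `a` past `h` conjugates it, so each `mk h v` is an eigenvector of `A` for the conjugate
of `ψ` by `h`. -/
lemma ActsBy.ind_inl (hψ : ActsBy φ σ ψ) (a : A) (h : A ⋊[f] H) (v : V) :
    ind φ σ (SemidirectProduct.inl a) (IndV.mk φ σ h v)
      = (ψ (f h.right a) : ℂ) • IndV.mk φ σ h v := by
  obtain ⟨j, hj, hψ⟩ := hψ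
  rw [ind_apply_mk, ← map_smul, ← hψ, ← indV_mk_mul φ σ (j (f h.right a)) (h * _), ← mul_assoc,
    hj, ← semi_mul_inl, mul_assoc, mul_inv_cancel, mul_one]

/-- The projector onto the `ψ'`-eigenspace fixes `y` and, by orthogonality of characters of `A`,
kills every `mk h v` whose character differs from `ψ'`. -/
lemma ActsBy.mem_span [Finite A] (hψ : ActsBy φ σ ψ) (y : IndV φ σ)
    (hy : ∀ a, ind φ σ (SemidirectProduct.inl a) y = (ψ' a : ℂ) • y) :
    y ∈ Submodule.span ℂ {z | ∃ (h : A ⋊[f] H) (v : V), (∀ a, ψ (f h.right a) = ψ' a) ∧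
      IndV.mk φ σ h v = z} := by
  cases nonempty_fintype A
  set S := Submodule.span ℂ {z | ∃ (h : A ⋊[f] H) (v : V), (∀ a, ψ (f h.right a) = ψ' a) ∧
      IndV.mk φ σ h v = z} with hS
  -- The idempotent of the group algebra of `A` attached to `ψ'`.
  let p : IndV φ σ →ₗ[ℂ] IndV φ σ := (Fintype.card A : ℂ)⁻¹ • ∑ a : A,
    ((ψ' a)⁻¹ : ℂˣ).val • ind φ σ (SemidirectProduct.inl a)
  have hp : ∀ z, p z = (Fintype.card A : ℂ)⁻¹ • ∑ a : A,
    ((ψ' a)⁻¹ : ℂˣ).val • ind φ σ (SemidirectProduct.inl a) z := fun z => by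
      simp [p, LinearMap.sum_apply]
  have h1 : p y = y := by
    rw [hp]
    have : ∀ a, ((ψ' a)⁻¹ : ℂˣ).val • ind φ σ (SemidirectProduct.inl a) y = y := fun a => by
      rw [hy, smul_smul, ← Units.val_mul, inv_mul_cancel, Units.val_one, one_smul]
    simp only [this, Finset.sum_const, Finset.card_univ]
    rw [← Nat.cast_smul_eq_nsmul ℂ, smul_smul, inv_mul_cancel₀ (card_ne_zero' A), one_smul]
  have h2 : ∀ z, p z ∈ S := by
    intro z
    have hz : z ∈ Submodule.span ℂ (Set.range fun p : (A ⋊[f] H) × V => IndV.mk φ σ p.1 p.2) := by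
      rw [indV_span_eq_top]
      trivial
    suffices hle : Submodule.span ℂ (Set.range fun p : (A ⋊[f] H) × V => IndV.mk φ σ p.1 p.2)
        ≤ S.comap p from hle hz
    rw [Submodule.span_le]
    rintro _ ⟨⟨h, v⟩, rfl⟩
    change p (IndV.mk φ σ h v) ∈ S
    rw [hp]
    simp only [hψ.ind_inl, smul_smul]
    rw [← Finset.sum_smul]
    by_cases hh : ∀ a, ψ (f h.right a) = ψ' a
    · exact S.smul_mem _ (S.smul_mem _ (Submodule.subset_span ⟨h, v, hh, rfl⟩))
    · let χ : A →* ℂ := (Units.coeHom ℂ).comp (ψ'⁻¹ * ψ.comp (f h.right).toMonoidHom)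
      have hχ : χ ≠ 1 := fun h0 => hh fun a => by
        have h3 : ((ψ' a)⁻¹ * ψ (f h.right a) : ℂˣ).val = 1 := DFunLike.congr_fun h0 a
        have h4 : (ψ' a)⁻¹ * ψ (f h.right a) = 1 := Units.ext h3
        exact (inv_mul_eq_one.1 h4).symm
      have := sum_hom_units_eq_zero χ hχ
      rw [show ∑ a, ((ψ' a)⁻¹ : ℂˣ).val * (ψ (f h.right a) : ℂ) = ∑ a, χ a from rfl, this]
      simp
  rw [← h1]
  exact h2 y

/-- The image of `φ` contains the stabilizer of `ψ`. -/
def HasStab (φ : N →* A ⋊[f] H) (ψ : A →* ℂˣ) : Prop :=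
  ∀ h : A ⋊[f] H, (∀ a, ψ (f h.right a) = ψ a) → h ∈ Set.range φ

/-- Only the `mk h v` with `h` in the stabilizer have character `ψ`, and such an `h` lies in the
image of `N`, so it can be absorbed into `v`. -/
lemma ActsBy.mem_range [Finite A] (hψ : ActsBy φ σ ψ) (hst : HasStab φ ψ) (y : IndV φ σ)
    (hy : ∀ a, ind φ σ (SemidirectProduct.inl a) y = (ψ a : ℂ) • y) :
    y ∈ LinearMap.range (IndV.mk φ σ 1) := by
  refine Submodule.span_le.2 ?_ (hψ.mem_span y hy)
  rintro _ ⟨h, v, hh, rfl⟩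
  obtain ⟨n, rfl⟩ := hst h hh
  refine ⟨σ n⁻¹ v, ?_⟩
  rw [← indV_mk_mul', mul_one]

/-- By reciprocity `V` maps nontrivially to the `ψ`-eigenspace of the second induced representation,
which is zero unless `ψ` lies in the orbit of `ψ'`. -/
lemma ActsBy.exists_conj [Finite A] (hψ : ActsBy φ σ ψ) (hψ' : ActsBy φ' σ' ψ')
    (hl : Linked (ind φ σ) (ind φ' σ')) : ∃ h : H, ∀ a, ψ' (f h a) = ψ a := by
  obtain ⟨T, hT, h0⟩ := hl.of_ind
  by_contra hcon
  push Not at hcon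
  apply h0
  ext1 v
  have := hψ'.mem_span (ψ' := ψ) (T v) fun a => by
    obtain ⟨j, hj, hψ⟩ := hψ
    rw [← map_smul, ← hψ a v, hT, ← hj]
    rfl
  have hempty : {z | ∃ (h : A ⋊[f] H) (v : V'), (∀ a, ψ' (f h.right a) = ψ a) ∧
      IndV.mk φ' σ' h v = z} = ∅ := by
    rw [Set.eq_empty_iff_forall_notMem]
    rintro _ ⟨h, v, hh, _⟩
    obtain ⟨a, ha⟩ := hcon h.right
    exact ha (hh a)
  rw [hempty, Submodule.span_empty, Submodule.mem_bot] at this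
  simpa using this

/-- Intertwining maps preserve `ψ`-eigenspaces, and these are the copies of `V` and `V'` at the
identity. So maps between the induced representations come from maps between the inducing ones. -/
lemma ActsBy.exists_intw {σ' : Representation ℂ N V'} [Finite A] (hφ : Function.Injective φ)
    (hψ : ActsBy φ σ ψ) (hψ' : ActsBy φ σ' ψ)
    (hst : HasStab φ ψ) {T : IndV φ σ →ₗ[ℂ] IndV φ σ'} (hT : Intw (ind φ σ) (ind φ σ') T) :
    ∃ t : V →ₗ[ℂ] V', Intw σ σ' t ∧ ∀ v, T (IndV.mk φ σ 1 v) = IndV.mk φ σ' 1 (t v) := by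
  have hi := indV_mk_one_injective hφ σ'
  have hmem : ∀ v, T (IndV.mk φ σ 1 v) ∈ LinearMap.range (IndV.mk φ σ' 1) := fun v => by
    refine hψ'.mem_range hst _ fun a => ?_
    rw [← hT, hψ.ind_inl]
    simp
  let e := LinearEquiv.ofInjective (IndV.mk φ σ' 1) hi
  let t : V →ₗ[ℂ] V' := e.symm.toLinearMap ∘ₗ
    (T ∘ₗ IndV.mk φ σ 1).codRestrict (LinearMap.range (IndV.mk φ σ' 1)) hmem
  have ht : ∀ v, IndV.mk φ σ' 1 (t v) = T (IndV.mk φ σ 1 v) := fun v =>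
    congrArg Subtype.val (e.apply_symm_apply ⟨T (IndV.mk φ σ 1 v), hmem v⟩)
  refine ⟨t, fun n v => hi ?_, fun v => (ht v).symm⟩
  rw [ht, ← ind_apply_mk_one, hT, ← ht, ind_apply_mk_one]

lemma ActsBy.linked {σ' : Representation ℂ N V'} [Finite A] (hφ : Function.Injective φ)
    (hψ : ActsBy φ σ ψ) (hψ' : ActsBy φ σ' ψ)
    (hst : HasStab φ ψ) (hl : Linked (ind φ σ) (ind φ σ')) : Linked σ σ' := by
  obtain ⟨T, hT, h0⟩ := hl
  obtain ⟨t, ht, htT⟩ := hψ.exists_intw hφ hψ' hst hT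
  refine ⟨t, ht, fun ht0 => h0 ?_⟩
  refine Representation.IndV.hom_ext φ σ fun h => LinearMap.ext fun v => ?_
  change T (IndV.mk φ σ h v) = 0
  rw [indV_mk_eq, hT, htT, ht0]
  simp

/-- An endomorphism is a scalar on the copy of `V` at the identity, by Schur, and this copy
generates. -/
lemma ActsBy.isIrreducible_ind [Finite A] [Finite (A ⋊[f] H)] [Finite N]
    (hφ : Function.Injective φ)
    (hψ : ActsBy φ σ ψ) (hst : HasStab φ ψ) (hσ : σ.IsIrreducible) : (ind φ σ).IsIrreducible := by
  have := (isIrreducible_iff.1 hσ).1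
  have := nontrivial_indV hφ σ
  refine isIrreducible_of_scalar fun T hT => ?_
  obtain ⟨t, ht, htT⟩ := hψ.exists_intw hφ hψ hst hT
  obtain ⟨c, hc⟩ := exists_scalar_of_intw hσ ht
  refine ⟨c, fun x => ?_⟩
  have : T = c • LinearMap.id := by
    refine Representation.IndV.hom_ext φ σ fun h => LinearMap.ext fun v => ?_
    change T (IndV.mk φ σ h v) = c • IndV.mk φ σ h v
    rw [indV_mk_eq, hT, htT, hc, map_smul, map_smul]
  rw [this]
  rfl

/-- The `ψ`-eigenspace of `A`. -/
def eigen (τ : Representation ℂ (A ⋊[f] H) X) (ψ : A →* ℂˣ) : Submodule ℂ X :=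
  ⨅ a : A, LinearMap.eqLocus (τ (SemidirectProduct.inl a)) ((ψ a : ℂ) • LinearMap.id)

lemma mem_eigen {x : X} :
    x ∈ eigen τ ψ ↔ ∀ a, τ (SemidirectProduct.inl a) x = (ψ a : ℂ) • x := by
  simp [eigen, Submodule.mem_iInf]

lemma apply_mem_eigen {x : X} (hx : x ∈ eigen τ ψ) (h : A ⋊[f] H)
    (hh : ∀ a, ψ (f h.right a) = ψ' a) : τ h⁻¹ x ∈ eigen τ ψ' := by
  rw [mem_eigen] at hx ⊢
  intro a
  have h1 : (SemidirectProduct.inl a : A ⋊[f] H) * h⁻¹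
      = h⁻¹ * SemidirectProduct.inl (f h.right a) := by
    rw [eq_inv_mul_iff_mul_eq, ← mul_assoc, semi_mul_inl]
    simp
  rw [← Module.End.mul_apply, ← map_mul, h1, map_mul, Module.End.mul_apply, hx, map_smul, hh]

/-- On an irreducible constituent for the abelian group `A`, each element of `A` is itself an
intertwining map, hence a scalar; these scalars form the character. -/
lemma exists_eigen_ne_bot [Finite A] (τ : Representation ℂ (A ⋊[f] H) X) [Nontrivial X] :
    ∃ ψ : A →* ℂˣ, eigen τ ψ ≠ ⊥ := by
  obtain ⟨U, hU⟩ := exists_irreducible_sub (τ.comp (SemidirectProduct.inl (φ := f)))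
  have hsc : ∀ a : A, ∃ c : ℂ, ∀ u, U.toRepresentation a u = c • u := fun a =>
    exists_scalar_of_intw hU fun b v => by
      rw [← Module.End.mul_apply, ← Module.End.mul_apply, ← map_mul, ← map_mul, mul_comm]
  choose c hc using hsc
  have := (isIrreducible_iff.1 hU).1
  obtain ⟨u, hu⟩ := exists_ne (0 : U.toSubmodule)
  let χ : A →* ℂ :=
    { toFun := c
      map_one' := smul_left_injective ℂ hu (by
        change c 1 • u = (1 : ℂ) • u
        rw [← hc, map_one, one_smul]
        rfl)
      map_mul' := fun a b => smul_left_injective ℂ hu (by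
        change c (a * b) • u = (c a * c b) • u
        rw [← hc, map_mul, Module.End.mul_apply, hc b, map_smul, hc a, smul_smul, mul_comm]) }
  refine ⟨χ.toHomUnits, fun h => hu (Subtype.ext ?_)⟩
  have : (u : X) ∈ eigen τ χ.toHomUnits := by
    rw [mem_eigen]
    intro a
    exact congrArg Subtype.val (hc a u)
  rw [h] at this
  simpa using this

/-- The `ψ`-eigenspace of `A` as a representation of a group stabilizing `ψ`. -/
def eigenSub (φ : N →* A ⋊[f] H) (τ : Representation ℂ (A ⋊[f] H) X) (ψ : A →* ℂˣ)
    (hst : ∀ n a, ψ (f (φ n).right a) = ψ a) : Subrepresentation (τ.comp φ) where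
  toSubmodule := eigen τ ψ
  apply_mem_toSubmodule n x hx := by
    have := apply_mem_eigen hx (φ n⁻¹) fun a => hst n⁻¹ a
    simpa using this

end Little

/-! ## Combinatorics of tableaux -/

section Tableaux

variable {α : Type*} [Fintype α] [DecidableEq α] {l m : YoungDiagram}

/-- The row of an entry of a tableau. -/
def rowf (T : α ≃ m.cells) (a : α) : ℕ := (T a).1.1

/-- The column of an entry of a tableau. -/
def colf (T : α ≃ m.cells) (a : α) : ℕ := (T a).1.2

lemma tableau_ext (T : α ≃ m.cells) {a b : α} (h1 : rowf T a = rowf T b)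
    (h2 : colf T a = colf T b) : a = b :=
  T.injective (Subtype.ext (Prod.ext h1 h2))

lemma cell_mem (T : α ≃ m.cells) (a : α) : (rowf T a, colf T a) ∈ m :=
  (YoungDiagram.mem_cells _).1 (T a).2

lemma exists_entry (T : α ≃ m.cells) {i j : ℕ} (h : (i, j) ∈ m) :
    ∃ a, rowf T a = i ∧ colf T a = j :=
  ⟨T.symm ⟨(i, j), (YoungDiagram.mem_cells _).2 h⟩, by simp [rowf], by simp [colf]⟩

lemma card_col_lt (T : α ≃ m.cells) (c k : ℕ) :
    (Finset.univ.filter fun a => colf T a = c ∧ rowf T a < k).card = min k (m.colLen c) := by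
  rw [← Finset.card_range (min k (m.colLen c))]
  refine Finset.card_bij (fun a _ => rowf T a) ?_ ?_ ?_
  · intro a ha
    rw [Finset.mem_filter] at ha
    have := cell_mem T a
    rw [ha.2.1, YoungDiagram.mem_iff_lt_colLen] at this
    simp [ha.2.2, this]
  · intro a ha b hb h
    rw [Finset.mem_filter] at ha hb
    exact tableau_ext T h (ha.2.1.trans hb.2.1.symm)
  · intro i hi
    rw [Finset.mem_range, lt_min_iff] at hi
    obtain ⟨a, h1, h2⟩ := exists_entry T (YoungDiagram.mem_iff_lt_colLen.2 hi.2)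
    exact ⟨a, by simp [h1, h2, hi.1], h1⟩

lemma card_row_eq (T : α ≃ m.cells) (i : ℕ) :
    (Finset.univ.filter fun a => rowf T a = i).card = m.rowLen i := by
  rw [← Finset.card_range (m.rowLen i)]
  refine Finset.card_bij (fun a _ => colf T a) ?_ ?_ ?_
  · intro a ha
    rw [Finset.mem_filter] at ha
    have := cell_mem T a
    rw [ha.2, YoungDiagram.mem_iff_lt_rowLen] at this
    simpa using this
  · intro a ha b hb h
    rw [Finset.mem_filter] at ha hb
    exact tableau_ext T (ha.2.trans hb.2.symm) h
  · intro j hj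
    rw [Finset.mem_range] at hj
    obtain ⟨a, h1, h2⟩ := exists_entry T (YoungDiagram.mem_iff_lt_rowLen.2 hj)
    exact ⟨a, by simp [h1], h2⟩

lemma card_row_lt_eq (T U : α ≃ m.cells) (k : ℕ) :
    (Finset.univ.filter fun a => rowf T a < k).card =
      (Finset.univ.filter fun a => rowf U a < k).card := by
  refine Finset.card_equiv (T.trans U.symm) fun a => ?_
  have : rowf U (T.trans U.symm a) = rowf T a := by simp [rowf]
  simp only [Finset.mem_filter, Finset.mem_univ, true_and, this]

/-- Within one column the values of `r` are distinct, so at most `k` of them are below `k`, and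
there are at most as many as the column has cells. The tableau `T` attains the minimum of both
bounds. -/
lemma card_col_le {T : α ≃ l.cells} {r : α → ℕ}
    (h : ∀ a b, colf T a = colf T b → r a = r b → a = b) (c k : ℕ) :
    (Finset.univ.filter fun a => colf T a = c ∧ r a < k).card ≤
      (Finset.univ.filter fun a => colf T a = c ∧ rowf T a < k).card := by
  rw [card_col_lt, le_min_iff]
  constructor
  · rw [← Finset.card_range k]
    refine Finset.card_le_card_of_injOn r (fun a ha => ?_) ?_
    · simp only [Finset.coe_filter, Finset.mem_univ, true_and, Set.mem_ofPred_eq] at ha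
      simpa using ha.2
    · intro a ha b hb hab
      simp only [Finset.coe_filter, Finset.mem_univ, true_and, Set.mem_ofPred_eq] at ha hb
      exact h a b (ha.1.trans hb.1.symm) hab
  · rw [← min_self (l.colLen c), ← card_col_lt T c (l.colLen c)]
    refine Finset.card_le_card fun a ha => ?_
    simp only [Finset.mem_filter, Finset.mem_univ, true_and] at ha ⊢
    refine ⟨ha.1, ?_⟩
    have := cell_mem T a
    rwa [ha.1, YoungDiagram.mem_iff_lt_colLen] at this

lemma card_lt_eq_sum (T : α ≃ l.cells) (r : α → ℕ) (k : ℕ) :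
    (Finset.univ.filter fun a => r a < k).card = ∑ c ∈ Finset.univ.image (colf T),
      (Finset.univ.filter fun a => colf T a = c ∧ r a < k).card := by
  rw [Finset.card_eq_sum_card_fiberwise (f := colf T) (t := Finset.univ.image (colf T))
    (fun a _ => by simp)]
  refine Finset.sum_congr rfl fun c _ => ?_
  rw [Finset.filter_filter]
  simp only [and_comm]

/-- If the entries in each column of `T` are in different rows of `U`, then the shape of `T`
dominates the shape of `U`. -/
lemma dominates {T : α ≃ l.cells} {U : α ≃ m.cells}
    (h : ∀ a b, colf T a = colf T b → rowf U a = rowf U b → a = b) (k : ℕ) :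
    (Finset.univ.filter fun a => rowf U a < k).card ≤
      (Finset.univ.filter fun a => rowf T a < k).card := by
  rw [card_lt_eq_sum T, card_lt_eq_sum T]
  exact Finset.sum_le_sum fun c _ => card_col_le h c k

/-- Successive differences of these counts are the row lengths. -/
lemma eq_of_dominates (T : α ≃ l.cells) (U : α ≃ m.cells)
    (h : ∀ k, (Finset.univ.filter fun a => rowf U a < k).card =
      (Finset.univ.filter fun a => rowf T a < k).card) : l = m := by
  have hrow : ∀ {n : YoungDiagram} (S : α ≃ n.cells) (k : ℕ),
      (Finset.univ.filter fun a => rowf S a < k + 1).card =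
        (Finset.univ.filter fun a => rowf S a < k).card + n.rowLen k := by
    intro n S k
    rw [← card_row_eq S, ← Finset.card_union_of_disjoint]
    · congr 1
      ext a
      simp only [Finset.mem_filter, Finset.mem_univ, true_and, Finset.mem_union]
      omega
    · rw [Finset.disjoint_filter]
      intro a _ h1 h2
      omega
  have hlen : ∀ k, l.rowLen k = m.rowLen k := fun k => by
    have h1 := hrow T k
    have h2 := hrow U k
    have h3 := h k
    have h4 := h (k + 1)
    omega
  refine YoungDiagram.ext (Finset.ext ?_)
  rintro ⟨i, j⟩
  rw [YoungDiagram.mem_cells, YoungDiagram.mem_cells, YoungDiagram.mem_iff_lt_rowLen,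
    YoungDiagram.mem_iff_lt_rowLen, hlen]

/-- With equal shapes the domination inequalities are equalities, even column by column. Hence the
cell in the row of `a` in `U` and the column of `a` in `T` exists in the diagram; sending `a` to the
entry of `T` there gives the inverse of `π`. -/
lemma exists_perm_of_injective {T U : α ≃ m.cells}
    (h : ∀ a b, colf T a = colf T b → rowf U a = rowf U b → a = b) :
    ∃ π : Equiv.Perm α, (∀ a, colf T (π a) = colf T a) ∧ ∀ a, rowf T (π.symm a) = rowf U a := by
  have hcount : ∀ k, (Finset.univ.filter fun a => rowf U a < k).card =
      (Finset.univ.filter fun a => rowf T a < k).card := fun k => by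
    exact card_row_lt_eq U T k
  have hcol : ∀ a, rowf U a < m.colLen (colf T a) := by
    intro a
    -- Equality of the totals forces equality in each column. With `k` the length of the column of
    -- `a`, the count for `T` is the whole column, so every entry of it lies in a row of `U` below
    -- that length.
    have h1 := hcount (m.colLen (colf T a))
    rw [card_lt_eq_sum T, card_lt_eq_sum T,
      Finset.sum_eq_sum_iff_of_le fun c _ => card_col_le h c _] at h1
    have h2 := h1 (colf T a) (Finset.mem_image_of_mem _ (Finset.mem_univ a))
    have hsub : (Finset.univ.filter fun b => colf T b = colf T a ∧
        rowf U b < m.colLen (colf T a)) ⊆ Finset.univ.filter fun b => colf T b = colf T a ∧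
        rowf T b < m.colLen (colf T a) := by
      intro b hb
      simp only [Finset.mem_filter, Finset.mem_univ, true_and] at hb ⊢
      refine ⟨hb.1, ?_⟩
      have := cell_mem T b
      rwa [hb.1, YoungDiagram.mem_iff_lt_colLen] at this
    have h3 := Finset.eq_of_subset_of_card_le hsub h2.ge
    have h4 : a ∈ Finset.univ.filter fun b => colf T b = colf T a ∧
        rowf T b < m.colLen (colf T a) := by
      simp only [Finset.mem_filter, Finset.mem_univ, true_and]
      exact YoungDiagram.mem_iff_lt_colLen.1 (cell_mem T a)
    rw [← h3] at h4
    simp only [Finset.mem_filter, Finset.mem_univ, true_and] at h4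
    exact h4
  choose f hf1 hf2 using fun a => exists_entry T (YoungDiagram.mem_iff_lt_colLen.2 (hcol a))
  have hinj : Function.Injective f := fun a b hab =>
    h a b (by rw [← hf2 a, hab, hf2 b]) (by rw [← hf1 a, hab, hf1 b])
  let e := Equiv.ofBijective f (Finite.injective_iff_bijective.1 hinj)
  refine ⟨e.symm, fun a => ?_, fun a => hf1 a⟩
  have := hf2 (e.symm a)
  rw [← this]
  congr 1
  exact e.apply_symm_apply a

end Tableaux

/-! ## Specht modules -/

section Specht

variable {α : Type*} [Fintype α] [DecidableEq α] {l m : YoungDiagram}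

/-- The space of the Specht module of shape `m` for the symmetric group on `α`. -/
def SpechtOn (m : YoungDiagram) (α : Type*) [Fintype α] [DecidableEq α] : Type _ :=
  (spechtSub m α).toSubmodule

instance (m : YoungDiagram) (α : Type*) [Fintype α] [DecidableEq α] :
    AddCommGroup (SpechtOn m α) :=
  inferInstanceAs (AddCommGroup (spechtSub m α).toSubmodule)

instance (m : YoungDiagram) (α : Type*) [Fintype α] [DecidableEq α] :
    Module ℂ (SpechtOn m α) :=
  inferInstanceAs (Module ℂ (spechtSub m α).toSubmodule)

/-- The Specht module of shape `m` for the symmetric group on `α`. -/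
def spechtRep (m : YoungDiagram) (α : Type*) [Fintype α] [DecidableEq α] :
    Representation ℂ (Equiv.Perm α) (SpechtOn m α) :=
  (spechtSub m α).toRepresentation

/-- The inclusion of the Specht module in the space of tabloids. -/
def spechtIncl (m : YoungDiagram) (α : Type*) [Fintype α] [DecidableEq α] :
    SpechtOn m α →ₗ[ℂ] ((α → ℕ) →₀ ℂ) :=
  (spechtSub m α).toSubmodule.subtype

lemma spechtIncl_injective : Function.Injective (spechtIncl m α) :=
  (spechtSub m α).toSubmodule.injective_subtype

lemma intw_spechtIncl : Intw (spechtRep m α) (rowRep α) (spechtIncl m α) := fun _ _ => rfl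

lemma rowRep_single (σ : Equiv.Perm α) (r : α → ℕ) (c : ℂ) :
    rowRep α σ (Finsupp.single r c) = Finsupp.single (fun a => r (σ.symm a)) c := by
  simp [rowRep, Finsupp.mapDomain_single]

/-- The signed indicator function of the column stabilizer. -/
def colSgn (T : α ≃ m.cells) (π : Equiv.Perm α) : ℂ :=
  if ∀ a, (T (π a)).1.2 = (T a).1.2 then ((Equiv.Perm.sign π : ℤ) : ℂ) else 0

lemma polytabloid_eq (T : α ≃ m.cells) :
    polytabloid m T = act (rowRep α) (colSgn T) (Finsupp.single (rowf T) 1) := by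
  rw [polytabloid, act_apply, Finset.sum_filter]
  refine Finset.sum_congr rfl fun π _ => ?_
  unfold colSgn
  split_ifs <;> simp
  rfl

lemma colSgn_mul_right (T : α ≃ m.cells) (π τ : Equiv.Perm α)
    (hτ : ∀ a, (T (τ a)).1.2 = (T a).1.2) :
    colSgn T (π * τ) = colSgn T π * ((Equiv.Perm.sign τ : ℤ) : ℂ) := by
  unfold colSgn
  have : (∀ a, (T ((π * τ) a)).1.2 = (T a).1.2) ↔ ∀ a, (T (π a)).1.2 = (T a).1.2 := by
    constructor
    · intro h a
      have h1 := h (τ.symm a)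
      have h2 := hτ (τ.symm a)
      simp only [Equiv.Perm.mul_apply, Equiv.apply_symm_apply] at h1 h2
      rw [h1, h2]
    · intro h a
      rw [Equiv.Perm.mul_apply, h, hτ]
  rw [if_congr this rfl rfl]
  split_ifs <;> simp

lemma act_colSgn_apply {V : Type*} [AddCommGroup V] [Module ℂ V]
    (ρ : Representation ℂ (Equiv.Perm α) V) (T : α ≃ m.cells) (τ : Equiv.Perm α)
    (hτ : ∀ a, (T (τ a)).1.2 = (T a).1.2) (v : V) :
    act ρ (colSgn T) (ρ τ v) = ((Equiv.Perm.sign τ : ℤ) : ℂ) • act ρ (colSgn T) v := by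
  rw [act_apply, act_apply, ← Equiv.sum_comp (Equiv.mulRight τ) (fun h => colSgn T h • ρ h v),
    Finset.smul_sum]
  refine Finset.sum_congr rfl fun π _ => ?_
  rw [Equiv.coe_mulRight, colSgn_mul_right T π τ hτ, map_mul, Module.End.mul_apply, smul_smul,
    mul_left_comm, ← Int.cast_mul, ← Units.val_mul, Int.units_mul_self]
  simp

/-- The transposition of `a` and `b` fixes the tabloid and lies in the column stabilizer with sign
`-1`, so the result equals its own negative. -/
lemma act_colSgn_single_eq_zero (T : α ≃ m.cells) (r : α → ℕ) {a b : α} (hab : a ≠ b)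
    (hc : colf T a = colf T b) (hr : r a = r b) :
    act (rowRep α) (colSgn T) (Finsupp.single r 1) = 0 := by
  have h := act_colSgn_apply (rowRep α) T (Equiv.swap a b) (fun x => by
    change colf T _ = colf T x
    by_cases hxa : x = a
    · subst hxa; simpa using hc.symm
    · by_cases hxb : x = b
      · subst hxb; simpa using hc
      · rw [Equiv.swap_apply_of_ne_of_ne hxa hxb]) (Finsupp.single r 1)
  have h2 : rowRep α (Equiv.swap a b) (Finsupp.single r 1) = Finsupp.single r 1 := by
    rw [rowRep_single]
    congr 1
    funext x
    rw [Equiv.symm_swap]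
    by_cases hxa : x = a
    · subst hxa; simpa using hr.symm
    · by_cases hxb : x = b
      · subst hxb; simpa using hr
      · rw [Equiv.swap_apply_of_ne_of_ne hxa hxb]
  rw [h2, Equiv.Perm.sign_swap hab] at h
  simp only [Units.val_neg, Units.val_one, Int.cast_neg, Int.cast_one, neg_smul, one_smul] at h
  exact self_eq_neg.1 h

/-- The coefficient of the tabloid of `T` is `1`: a permutation preserving both rows and columns of
`T` is the identity. -/
lemma polytabloid_ne_zero (T : α ≃ m.cells) : polytabloid m T ≠ 0 := by
  intro h
  have := DFunLike.congr_fun h (rowf T)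
  rw [polytabloid_eq, act_apply, Finsupp.finsetSum_apply, Finset.sum_eq_single 1] at this
  · simp [colSgn] at this
  · intro π _ hπ
    rw [Finsupp.smul_apply, rowRep_single, Finsupp.single_apply]
    split_ifs with h1
    · unfold colSgn
      split_ifs with h2
      · exfalso
        apply hπ
        ext a
        have h3 := congrFun h1 (π a)
        rw [Equiv.symm_apply_apply] at h3
        rw [tableau_ext T h3.symm (h2 a)]
        rfl
      · simp
    · simp
  · simp

/-- The permutation module of tabloids of shape `m`. -/
def tabloids (m : YoungDiagram) (α : Type*) : Submodule ℂ ((α → ℕ) →₀ ℂ) :=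
  Submodule.span ℂ (Set.range fun U : α ≃ m.cells => Finsupp.single (rowf U) 1)

lemma polytabloid_mem_tabloids (T : α ≃ m.cells) : polytabloid m T ∈ tabloids m α := by
  rw [polytabloid]
  refine Submodule.sum_mem _ fun π _ => Submodule.smul_mem _ _ ?_
  rw [rowRep_single]
  exact Submodule.subset_span ⟨π.symm.trans T, rfl⟩

lemma spechtSub_le_tabloids : (spechtSub m α).toSubmodule ≤ tabloids m α := by
  refine Submodule.span_le.2 ?_
  rintro _ ⟨T, rfl⟩
  exact polytabloid_mem_tabloids T

/-- James's key fact. A tabloid with two entries in a common row and a common column of `T` is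
killed; any other is a column permutation of the tabloid of `T` and gives plus or minus the
polytabloid. -/
lemma act_colSgn_mem (T : α ≃ m.cells) {x : (α → ℕ) →₀ ℂ} (hx : x ∈ tabloids m α) :
    ∃ c : ℂ, act (rowRep α) (colSgn T) x = c • polytabloid m T := by
  suffices h : tabloids m α ≤
      (Submodule.span ℂ {polytabloid m T}).comap (act (rowRep α) (colSgn T)) by
    obtain ⟨c, hc⟩ := Submodule.mem_span_singleton.1 (h hx)
    exact ⟨c, hc.symm⟩
  refine Submodule.span_le.2 ?_
  rintro _ ⟨U, rfl⟩
  change act (rowRep α) (colSgn T) (Finsupp.single (rowf U) 1) ∈ Submodule.span ℂ {polytabloid m T}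
  by_cases h : ∀ a b, colf T a = colf T b → rowf U a = rowf U b → a = b
  · obtain ⟨π, h1, h2⟩ := exists_perm_of_injective h
    have h3 : Finsupp.single (rowf U) (1 : ℂ) = rowRep α π (Finsupp.single (rowf T) 1) := by
      rw [rowRep_single]
      congr 1
      funext a
      exact (h2 a).symm
    rw [h3, act_colSgn_apply _ T π h1, ← polytabloid_eq]
    exact Submodule.smul_mem _ _ (Submodule.mem_span_singleton_self _)
  · push Not at h
    obtain ⟨a, b, h1, h2, h3⟩ := h
    rw [act_colSgn_single_eq_zero T _ h3 h1 h2]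
    exact Submodule.zero_mem _

lemma injective_of_act_ne_zero (T : α ≃ l.cells) {x : (α → ℕ) →₀ ℂ} (hx : x ∈ tabloids m α)
    (h0 : act (rowRep α) (colSgn T) x ≠ 0) :
    ∃ U : α ≃ m.cells, ∀ a b, colf T a = colf T b → rowf U a = rowf U b → a = b := by
  by_contra hcon
  push Not at hcon
  refine h0 ?_
  suffices h : tabloids m α ≤ LinearMap.ker (act (rowRep α) (colSgn T)) from
    LinearMap.mem_ker.1 (h hx)
  refine Submodule.span_le.2 ?_
  rintro _ ⟨U, rfl⟩
  obtain ⟨a, b, h1, h2, h3⟩ := hcon U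
  exact act_colSgn_single_eq_zero T _ h3 h1 h2

/-- The column antisymmetrizer is idempotent up to the order of the column stabilizer, which is the
constant `c`. -/
lemma exists_act_polytabloid (T : α ≃ m.cells) : ∃ c : ℂ, c ≠ 0 ∧
    act (rowRep α) (colSgn T) (polytabloid m T) = c • polytabloid m T := by
  refine ⟨((Finset.univ.filter
    fun π : Equiv.Perm α => ∀ a, (T (π a)).1.2 = (T a).1.2).card : ℂ), ?_, ?_⟩
  · have : (1 : Equiv.Perm α) ∈ Finset.univ.filter
        fun π : Equiv.Perm α => ∀ a, (T (π a)).1.2 = (T a).1.2 := by simp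
    exact_mod_cast (Finset.card_pos.2 ⟨_, this⟩).ne'
  · conv_lhs => rw [polytabloid, map_sum]
    rw [Nat.cast_smul_eq_nsmul, ← Finset.sum_const]
    refine Finset.sum_congr rfl fun π hπ => ?_
    rw [map_smul, act_colSgn_apply _ T π (Finset.mem_filter.1 hπ).2, smul_smul, ← Int.cast_mul,
      ← Units.val_mul, Int.units_mul_self, polytabloid_eq]
    simp
    rfl

/-- A polytabloid as an element of the Specht module. -/
def poly (T : α ≃ m.cells) : SpechtOn m α :=
  (⟨polytabloid m T, Submodule.subset_span ⟨T, rfl⟩⟩ : (spechtSub m α).toSubmodule)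

lemma spechtIncl_poly (T : α ≃ m.cells) : spechtIncl m α (poly T) = polytabloid m T := rfl

lemma range_spechtIncl : LinearMap.range (spechtIncl m α) = (spechtSub m α).toSubmodule :=
  Submodule.range_subtype _

lemma spechtIncl_mem (x : SpechtOn m α) : spechtIncl m α x ∈ tabloids m α :=
  spechtSub_le_tabloids (range_spechtIncl.le ⟨x, rfl⟩)

lemma poly_span : Submodule.span ℂ (Set.range (poly (α := α) (m := m))) = ⊤ := by
  apply Submodule.map_injective_of_injective (spechtIncl_injective (m := m) (α := α))
  rw [Submodule.map_span, Submodule.map_top, range_spechtIncl, ← Set.range_comp]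
  rfl

lemma spechtIncl_act (a : Equiv.Perm α → ℂ) (x : SpechtOn m α) :
    spechtIncl m α (act (spechtRep m α) a x) = act (rowRep α) a (spechtIncl m α x) :=
  intw_spechtIncl.act a x

lemma exists_act_poly (T : α ≃ m.cells) : ∃ c : ℂ, c ≠ 0 ∧
    act (spechtRep m α) (colSgn T) (poly T) = c • poly T := by
  obtain ⟨c, hc, h⟩ := exists_act_polytabloid T
  refine ⟨c, hc, spechtIncl_injective ?_⟩
  rw [spechtIncl_act, map_smul]
  exact h

lemma spechtRep_poly (σ : Equiv.Perm α) (T : α ≃ m.cells) :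
    spechtRep m α σ (poly T) = poly (σ.symm.trans T) :=
  spechtIncl_injective (rowRep_polytabloid m σ T)

/-- An endomorphism commutes with the column antisymmetrizer of `T`, whose image on tabloids is the
line of the polytabloid of `T`. So it scales that vector, and the vector generates the module. -/
lemma isIrreducible_spechtRep (T : α ≃ m.cells) : (spechtRep m α).IsIrreducible := by
  have : Nontrivial (SpechtOn m α) :=
    ⟨poly T, 0, fun h => polytabloid_ne_zero T (by rw [← spechtIncl_poly, h, map_zero])⟩
  refine isIrreducible_of_scalar fun F hF => ?_
  obtain ⟨c, hc, h⟩ := exists_act_poly T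
  obtain ⟨b, hb⟩ := act_colSgn_mem T (spechtIncl_mem (F (poly T)))
  have h1 : F (poly T) = (c⁻¹ * b) • poly T := by
    have h2 : c • F (poly T) = b • poly T := by
      rw [← map_smul, ← h, hF.act]
      refine spechtIncl_injective ?_
      rw [spechtIncl_act, hb, map_smul, spechtIncl_poly]
    rw [mul_smul, ← h2, smul_smul, inv_mul_cancel₀ hc, one_smul]
  refine ⟨c⁻¹ * b, fun v => ?_⟩
  have h2 : F = (c⁻¹ * b) • LinearMap.id := by
    refine LinearMap.ext_on_range poly_span fun T' => ?_
    -- Any two tableaux differ by a permutation of the entries, so the scalar found at `T`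
    -- propagates to all polytabloids.
    have : T' = ((T'.trans T.symm).symm).symm.trans T := Equiv.ext fun x => by simp
    rw [this, ← spechtRep_poly, hF, h1]
    simp
  rw [h2]
  rfl

/-- A map nonzero on the polytabloid of some `S` gives a vector of tabloids of shape `m` not killed
by the antisymmetrizer of `S`. Hence some tableau of shape `m` has the entries of each column of `S`
in different rows, which is the hypothesis of `dominates`. -/
lemma dominates_of_linked (T : α ≃ l.cells) (U : α ≃ m.cells)
    (h : Linked (spechtRep l α) (spechtRep m α)) (k : ℕ) :
    (Finset.univ.filter fun a => rowf U a < k).card ≤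
      (Finset.univ.filter fun a => rowf T a < k).card := by
  obtain ⟨F, hF, h0⟩ := h
  have : ∃ S : α ≃ l.cells, F (poly S) ≠ 0 := by
    by_contra hcon
    push Not at hcon
    exact h0 (LinearMap.ext_on_range poly_span fun S => by simpa using hcon S)
  obtain ⟨S, hS⟩ := this
  obtain ⟨c, hc, h⟩ := exists_act_poly S
  have h1 : act (rowRep α) (colSgn S) (spechtIncl m α (F (poly S))) ≠ 0 := by
    rw [← spechtIncl_act, ← hF.act, h, map_smul]
    rw [(map_ne_zero_iff _ spechtIncl_injective)]
    exact smul_ne_zero hc hS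
  obtain ⟨U', hU'⟩ := injective_of_act_ne_zero S (spechtIncl_mem _) h1
  have h2 := dominates hU' k
  have h3 : (Finset.univ.filter fun a => rowf U a < k).card =
      (Finset.univ.filter fun a => rowf U' a < k).card :=
    card_row_lt_eq U U' k
  have h4 : (Finset.univ.filter fun a => rowf T a < k).card =
      (Finset.univ.filter fun a => rowf S a < k).card :=
    card_row_lt_eq T S k
  omega

lemma eq_of_linked_spechtRep (T : α ≃ l.cells) (U : α ≃ m.cells)
    (h : Linked (spechtRep l α) (spechtRep m α)) : l = m := by
  refine eq_of_dominates T U fun k => le_antisymm (dominates_of_linked T U h k) ?_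
  exact dominates_of_linked U T (h.symm_left (isIrreducible_spechtRep T)) k

end Specht

/-! ## Counting irreducible representations -/

section Counting

variable {G : Type} [Group G] [Finite G]

/-- Orthogonality makes the functions linearly independent in the space of functions on the
conjugacy classes, whose dimension is the number of classes. -/
lemma card_le_card_conjClasses [Fintype G] {K : Type*} (χ : K → G → ℂ)
    (hcl : ∀ k g h, χ k (h * g * h⁻¹) = χ k g)
    (hχ : ∀ i j, (Nat.card G : ℂ)⁻¹ * ∑ g : G, χ i g * χ j g⁻¹ = 0 ↔ i ≠ j) :
    Finite K ∧ Nat.card K ≤ Nat.card (ConjClasses G) := by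
  let cl : K → ConjClasses G → ℂ := fun k c => χ k (Quotient.out c)
  have hcl' : ∀ k g, cl k (ConjClasses.mk g) = χ k g := fun k g => by
    have h1 : IsConj (Quotient.out (ConjClasses.mk g)) g :=
      ConjClasses.mk_eq_mk_iff_isConj.1 (Quotient.out_eq _)
    obtain ⟨c, hc⟩ := isConj_iff.1 h1
    change χ k (Quotient.out (ConjClasses.mk g)) = χ k g
    rw [← hcl k _ c, hc]
  have hli : LinearIndependent ℂ cl := by
    rw [linearIndependent_iff']
    intro s c hs j hj
    have h1 : ∀ g, ∑ i ∈ s, c i * χ i g = 0 := fun g => by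
      have := congrFun hs (ConjClasses.mk g)
      simpa [Finset.sum_apply, hcl'] using this
    have h2 : ∑ i ∈ s, c i * ((Nat.card G : ℂ)⁻¹ * ∑ g : G, χ i g * χ j g⁻¹) = 0 := by
      calc _ = (Nat.card G : ℂ)⁻¹ * ∑ g : G, (∑ i ∈ s, c i * χ i g) * χ j g⁻¹ := by
            simp only [Finset.mul_sum, Finset.sum_mul]
            rw [Finset.sum_comm]
            refine Finset.sum_congr rfl fun g _ => Finset.sum_congr rfl fun i _ => by ring
        _ = 0 := by simp [h1]
    rw [Finset.sum_eq_single j (fun i _ hij => by rw [(hχ i j).2 hij, mul_zero])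
      (fun h => absurd hj h)] at h2
    rcases mul_eq_zero.1 h2 with h | h
    · exact h
    · exact absurd rfl ((hχ j j).1 h)
  have hfin : Finite K := hli.finite
  refine ⟨hfin, ?_⟩
  cases nonempty_fintype K
  have := Fintype.ofFinite (ConjClasses G)
  have h := hli.fintype_card_le_finrank
  rwa [Module.finrank_fintype_fun_eq_card, ← Nat.card_eq_fintype_card,
    ← Nat.card_eq_fintype_card] at h

/-- A family of pairwise inequivalent irreducible representations, at least as numerous as the
conjugacy classes, is exhaustive. -/
lemma covers_of_card_le {J : Type} {V : J → Type*} [∀ j, AddCommGroup (V j)]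
    [∀ j, Module ℂ (V j)] (ρ : ∀ j, Representation ℂ G (V j))
    (hirr : ∀ j, (ρ j).IsIrreducible) (hne : ∀ i j, Linked (ρ i) (ρ j) → i = j)
    (hcard : Finite J → Nat.card (ConjClasses G) ≤ Nat.card J) : Covers.{u} ρ := by
  intro X _ _ σ hX
  cases nonempty_fintype G
  obtain ⟨U, hU⟩ := exists_irreducible_sub σ
  suffices h : ∃ j, Linked (ρ j) U.toRepresentation from h.imp fun j hj => linked_sub hj
  by_contra hcon
  push Not at hcon
  have := fun j => finiteDimensional_of_isIrreducible (hirr j)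
  have := finiteDimensional_of_isIrreducible hU
  have : Invertible (Nat.card G : ℂ) := invertibleOfNonzero (by
    rw [Nat.card_eq_fintype_card]; exact card_ne_zero' G)
  have hUn := (isIrreducible_iff.1 hU).1
  have hVn := fun j => (isIrreducible_iff.1 (hirr j)).1
  -- The characters of the family together with that of the missing irreducible, which has index
  -- `none`; one more than the number of conjugacy classes allows.
  let χ : Option J → G → ℂ := fun o =>
    o.elim (Representation.character U.toRepresentation) fun j => (ρ j).character
  obtain ⟨hfin, hle⟩ := card_le_card_conjClasses χ (by
    rintro (_ | j) g h
    · exact Representation.char_conj _ _ _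
    · exact Representation.char_conj _ _ _) (by
    rintro (_ | i) (_ | j)
    · have := Representation.char_orthonormal U.toRepresentation U.toRepresentation
      rw [if_pos ⟨Representation.Equiv.refl _⟩] at this
      simp only [χ, Option.elim, this]
      simp
    · have := Representation.char_orthonormal U.toRepresentation (ρ j)
      rw [if_neg fun h => hcon j (linked_of_equiv h)] at this
      simp only [χ, Option.elim, this]
      simp
    · have := Representation.char_orthonormal (ρ i) U.toRepresentation
      rw [if_neg fun h => hcon i (linked_of_equiv (nonempty_equiv_symm h))] at this
      simp only [χ, Option.elim, this]
      simp
    · have := Representation.char_orthonormal (ρ i) (ρ j)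
      simp only [χ, Option.elim, this]
      by_cases hij : i = j
      · subst hij
        rw [if_pos ⟨Representation.Equiv.refl _⟩]
        simp
      · rw [if_neg fun h => hij (hne j i (linked_of_equiv h)).symm]
        simp [hij])
  -- Finiteness of `J` results from the count, so `hcard` can assume it; without it `Nat.card J`
  -- would be the default value `0`.
  have hJ : Finite J := Finite.of_injective some (Option.some_injective J)
  have h1 := hcard hJ
  rw [Finite.card_option] at hle
  omega

end Counting

/-! ## Partitions and Young diagrams -/

lemma card_eq_sum_rowLens (m : YoungDiagram) : m.card = m.rowLens.sum := by
  have h1 : m.card = ∑ i ∈ Finset.range (m.colLen 0), m.rowLen i := by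
    rw [YoungDiagram.card, Finset.card_eq_sum_card_fiberwise (f := Prod.fst)
      (t := Finset.range (m.colLen 0))]
    · refine Finset.sum_congr rfl fun i _ => ?_
      rw [YoungDiagram.rowLen_eq_card]
      rfl
    · rintro ⟨i, j⟩ h
      simp only [Finset.coe_range, Set.mem_Iio]
      rw [← YoungDiagram.mem_iff_lt_colLen]
      exact m.up_left_mem le_rfl (Nat.zero_le _) ((YoungDiagram.mem_cells _).1 h)
  rw [h1, YoungDiagram.rowLens]
  rfl

/-- The Young diagram of a partition. -/
def diagram {n : ℕ} (p : n.Partition) : YoungDiagram :=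
  YoungDiagram.ofRowLens (p.parts.sort (· ≥ ·)) (Multiset.pairwise_sort _ _).sortedGE

lemma rowLens_diagram {n : ℕ} (p : n.Partition) :
    (diagram p).rowLens = p.parts.sort (· ≥ ·) :=
  YoungDiagram.rowLens_ofRowLens_eq_self fun x hx => p.parts_pos (by simpa using hx)

lemma card_diagram {n : ℕ} (p : n.Partition) : (diagram p).card = n := by
  rw [card_eq_sum_rowLens, rowLens_diagram, ← Multiset.sum_coe, Multiset.sort_eq, p.parts_sum]

lemma diagram_injective {n : ℕ} : Function.Injective (diagram (n := n)) := by
  intro p q h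
  have h1 := congrArg YoungDiagram.rowLens h
  rw [rowLens_diagram, rowLens_diagram] at h1
  apply Nat.Partition.ext
  rw [← Multiset.sort_eq p.parts (· ≥ ·), h1, Multiset.sort_eq]

/-! ## Completeness of the Specht modules -/

section Complete

variable {α β : Type} [Fintype α] [DecidableEq α] [Fintype β] [DecidableEq β] {l m : YoungDiagram}

lemma exists_tableau (h : m.card = Fintype.card α) : Nonempty (α ≃ m.cells) :=
  ⟨Fintype.equivOfCardEq (by rw [← h, Fintype.card_coe])⟩

lemma isIrreducible_spechtRep' (h : m.card = Fintype.card α) : (spechtRep m α).IsIrreducible :=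
  isIrreducible_spechtRep (exists_tableau h).some

/-- Cycle types inject the conjugacy classes into the partitions of the number of letters, that is,
into the available shapes. -/
lemma covers_spechtRep (α : Type) [Fintype α] [DecidableEq α] :
    Covers.{u} fun m : {m : YoungDiagram // m.card = Fintype.card α} => spechtRep m.1 α := by
  refine covers_of_card_le _ (fun m => isIrreducible_spechtRep' m.2) (fun l m h => ?_)
    fun hfin => ?_
  · exact Subtype.ext
      (eq_of_linked_spechtRep (exists_tableau l.2).some (exists_tableau m.2).some h)
  · refine Nat.card_le_card_of_injective
      (fun c : ConjClasses (Equiv.Perm α) => ⟨diagram (Equiv.Perm.partition (Quotient.out c)),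
        card_diagram _⟩) fun c c' h => ?_
    have h1 := diagram_injective (congrArg Subtype.val h)
    have h2 := Equiv.Perm.partition_eq_of_isConj.2 h1
    rw [← Quotient.out_eq c, ← Quotient.out_eq c']
    exact ConjClasses.mk_eq_mk_iff_isConj.2 h2

/-- Transport of Specht modules along a bijection. -/
lemma linked_spechtRep_congr (e : α ≃ β) (h : m.card = Fintype.card α) :
    Linked (spechtRep m α) ((spechtRep m β).comp e.permCongrHom.toMonoidHom) := by
  let F : ((α → ℕ) →₀ ℂ) →ₗ[ℂ] ((β → ℕ) →₀ ℂ) :=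
    Finsupp.lmapDomain ℂ ℂ fun r b => r (e.symm b)
  have hF : ∀ σ x, F (rowRep α σ x) = rowRep β (e.permCongrHom σ) (F x) := fun σ x => by
    have : F ∘ₗ rowRep α σ = rowRep β (e.permCongrHom σ) ∘ₗ F := by
      refine Finsupp.lhom_ext fun r c => ?_
      simp only [F, LinearMap.comp_apply, rowRep_single, Finsupp.lmapDomain_apply,
        Finsupp.mapDomain_single]
      congr 1
      funext b
      change _ = r (e.symm (e (σ.symm (e.symm b))))
      rw [e.symm_apply_apply]
    exact LinearMap.congr_fun this x
  have hpoly : ∀ T : α ≃ m.cells, F (polytabloid m T) = polytabloid m (e.symm.trans T) := by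
    intro T
    rw [polytabloid_eq, polytabloid_eq, act_apply, act_apply, map_sum,
      ← Equiv.sum_comp e.permCongrHom.toEquiv]
    refine Finset.sum_congr rfl fun π _ => ?_
    have h1 : colSgn (e.symm.trans T) (e.permCongrHom.toEquiv π) = colSgn T π := by
      unfold colSgn
      have h2 : Equiv.Perm.sign (e.permCongrHom.toEquiv π) = Equiv.Perm.sign π :=
        Equiv.Perm.sign_permCongr e π
      rw [h2]
      refine if_congr ?_ rfl rfl
      rw [← e.forall_congr_right]
      simp
    rw [map_smul, hF, h1]
    congr 2
    simp only [F, Finsupp.lmapDomain_apply, Finsupp.mapDomain_single]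
    rfl
  have hmem : ∀ x : SpechtOn m α, F (spechtIncl m α x) ∈ (spechtSub m β).toSubmodule := by
    intro x
    have hx : spechtIncl m α x ∈ (spechtSub m α).toSubmodule := range_spechtIncl.le ⟨x, rfl⟩
    suffices hle : (spechtSub m α).toSubmodule ≤ (spechtSub m β).toSubmodule.comap F from hle hx
    refine Submodule.span_le.2 ?_
    rintro _ ⟨T, rfl⟩
    change F (polytabloid m T) ∈ (spechtSub m β).toSubmodule
    rw [hpoly]
    exact Submodule.subset_span ⟨_, rfl⟩
  let f : SpechtOn m α →ₗ[ℂ] SpechtOn m β := (F ∘ₗ spechtIncl m α).codRestrict _ hmem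
  have hf : ∀ x, spechtIncl m β (f x) = F (spechtIncl m α x) := fun _ => rfl
  refine ⟨f, fun σ x => spechtIncl_injective ?_, fun h0 => ?_⟩
  · rw [hf, intw_spechtIncl, hF]
    exact (intw_spechtIncl (e.permCongrHom σ) (f x)).symm
  · obtain ⟨T⟩ := exists_tableau h
    have := hf (poly T)
    rw [h0, spechtIncl_poly, hpoly] at this
    exact polytabloid_ne_zero _ (this.symm.trans (map_zero _))

lemma isIrreducible_specht (m : YoungDiagram) : (specht m).IsIrreducible :=
  isIrreducible_spechtRep' (α := Fin m.card) (by simp)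

lemma linked_specht_spechtRep (e : Fin m.card ≃ α) :
    Linked (specht m) ((spechtRep m α).comp e.permCongrHom.toMonoidHom) :=
  linked_spechtRep_congr e (by simp)

/-- Both modules are moved to the letters `Fin m.card`, where dominance separates shapes. -/
lemma eq_of_linked_specht (e : Fin l.card ≃ Fin m.card)
    (h : Linked (specht l) ((specht m).comp e.permCongrHom.toMonoidHom)) : l = m := by
  have hc : l.card = m.card := by simpa using Fintype.card_congr e
  have h1 : Linked (spechtRep l (Fin m.card)) (spechtRep m (Fin m.card)) := by
    have h2 := linked_specht_spechtRep e
    have h3 : Function.Surjective e.permCongrHom.toMonoidHom := e.permCongrHom.surjective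
    have hi : (spechtRep l (Fin m.card)).IsIrreducible := isIrreducible_spechtRep' (by simp [hc])
    refine Linked.of_comp h3 ?_
    exact (h2.symm_left (isIrreducible_specht l)).trans_equiv
      (h.nonempty_equiv (isIrreducible_specht l) (isIrreducible_comp h3 (isIrreducible_specht m)))
  exact eq_of_linked_spechtRep (exists_tableau (by simp [hc])).some
    (exists_tableau (by simp)).some h1

end Complete

open Representation (ind IndV)

instance {N G : Type*} [Group N] [Group G] [Finite N] [Finite G] (f : G →* MulAut N) :
    Finite (N ⋊[f] G) := Finite.of_equiv _ SemidirectProduct.equivProd.symm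

/-! ## Wreath products with a finite abelian group -/

section Wreath

variable {C : Type} [CommGroup C] {α : Type} [Fintype α] [DecidableEq α]
  {I I' : Type} [Fintype I] [DecidableEq I] [Fintype I'] [DecidableEq I']
  {β : I → Type} [∀ i, Fintype (β i)] [∀ i, DecidableEq (β i)]
  {β' : I' → Type} [∀ i, Fintype (β' i)] [∀ i, DecidableEq (β' i)]
  {V : I → Type*} [∀ i, AddCommGroup (V i)] [∀ i, Module ℂ (V i)]
  {V' : I' → Type*} [∀ i, AddCommGroup (V' i)] [∀ i, Module ℂ (V' i)]

/-- The block diagonal embedding relative to a decomposition of the index set. -/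
def embA (C : Type) [CommGroup C] (e : (Σ i, β i) ≃ α) : (∀ i, Wr C (β i)) →* Wr C α :=
  (Wr.congr e).comp Wr.blocks

/-- The block containing an index. -/
def color (e : (Σ i, β i) ≃ α) (a : α) : I := (e.symm a).1

lemma color_apply (e : (Σ i, β i) ≃ α) (i : I) (b : β i) : color e (e ⟨i, b⟩) = i := by
  simp [color]

lemma embA_left (e : (Σ i, β i) ≃ α) (x : ∀ i, Wr C (β i)) (i : I) (b : β i) :
    (embA C e x).left (e ⟨i, b⟩) = (x i).left b := by
  change (x (e.symm (e ⟨i, b⟩)).1).left (e.symm (e ⟨i, b⟩)).2 = _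
  rw [e.symm_apply_apply]

lemma embA_right (e : (Σ i, β i) ≃ α) (x : ∀ i, Wr C (β i)) (i : I) (b : β i) :
    (embA C e x).right (e ⟨i, b⟩) = e ⟨i, (x i).right b⟩ := by
  change e (Equiv.sigmaCongrRight (fun i => (x i).right) (e.symm (e ⟨i, b⟩))) = _
  rw [e.symm_apply_apply]
  rfl

lemma embA_injective (e : (Σ i, β i) ≃ α) : Function.Injective (embA C e) := by
  intro x y h
  funext i
  refine SemidirectProduct.ext (funext fun b => ?_) (Equiv.ext fun b => ?_)
  · rw [← embA_left e x, ← embA_left e y, h]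
  · have h1 : e ⟨i, (x i).right b⟩ = e ⟨i, (y i).right b⟩ := by
      rw [← embA_right, ← embA_right, h]
    simpa using h1

lemma exists_blocks_perm (e : (Σ i, β i) ≃ α) (π : Equiv.Perm α)
    (h : ∀ a, color e (π a) = color e a) :
    ∃ ρ : ∀ i, Equiv.Perm (β i), ∀ i b, π (e ⟨i, b⟩) = e ⟨i, ρ i b⟩ := by
  have h1 : ∀ i b, ∃ b' : β i, π (e ⟨i, b⟩) = e ⟨i, b'⟩ := by
    intro i b
    have h2 := h (e ⟨i, b⟩)
    rw [color_apply] at h2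
    obtain ⟨⟨j, b'⟩, hb⟩ := e.surjective (π (e ⟨i, b⟩))
    rw [← hb, color_apply] at h2
    subst h2
    exact ⟨b', hb.symm⟩
  choose f hf using h1
  have hinj : ∀ i, Function.Injective (f i) := fun i b b' hb => by
    have : π (e ⟨i, b⟩) = π (e ⟨i, b'⟩) := by rw [hf, hf, hb]
    simpa using this
  exact ⟨fun i => Equiv.ofBijective (f i) (Finite.injective_iff_bijective.1 (hinj i)),
    fun i b => hf i b⟩

/-- The torus part is unrestricted; a permutation comes from the blocks exactly when it preserves
the colouring by blocks. -/
lemma mem_range_embA (e : (Σ i, β i) ≃ α) (g : Wr C α) :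
    g ∈ Set.range (embA C e) ↔ ∀ a, color e (g.right a) = color e a := by
  constructor
  · rintro ⟨x, rfl⟩ a
    obtain ⟨⟨i, b⟩, rfl⟩ := e.surjective a
    rw [embA_right, color_apply, color_apply]
  · intro h
    obtain ⟨ρ, hρ⟩ := exists_blocks_perm e g.right h
    refine ⟨fun i => ⟨fun b => g.left (e ⟨i, b⟩), ρ i⟩, ?_⟩
    refine SemidirectProduct.ext (funext fun a => ?_) (Equiv.ext fun a => ?_)
    · obtain ⟨⟨i, b⟩, rfl⟩ := e.surjective a
      rw [embA_left]
    · obtain ⟨⟨i, b⟩, rfl⟩ := e.surjective a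
      rw [embA_right, hρ]

/-- The character of `C ^ α` with components `θ (c a)`. -/
def psiA (θ : I → C →* ℂˣ) (c : α → I) : (α → C) →* ℂˣ where
  toFun t := ∏ a, θ (c a) (t a)
  map_one' := by simp
  map_mul' s t := by simp [Finset.prod_mul_distrib]

lemma psiA_apply (θ : I → C →* ℂˣ) (c : α → I) (t : α → C) :
    psiA θ c t = ∏ a, θ (c a) (t a) := rfl

lemma psiA_perm (θ : I → C →* ℂˣ) (c : α → I) (σ : Equiv.Perm α) (t : α → C) :
    psiA θ c (permAut C α σ t) = psiA θ (fun a => c (σ a)) t := by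
  rw [psiA_apply, psiA_apply, ← Equiv.prod_comp σ]
  refine Finset.prod_congr rfl fun a _ => ?_
  change θ (c (σ a)) (t (σ.symm (σ a))) = _
  rw [σ.symm_apply_apply]

lemma psiA_mulSingle (θ : I → C →* ℂˣ) (c : α → I) (a : α) (x : C) :
    psiA θ c (Pi.mulSingle a x) = θ (c a) x := by
  rw [psiA_apply, Finset.prod_eq_single a]
  · simp
  · intro b _ hb
    rw [Pi.mulSingle_eq_of_ne hb, map_one]
  · simp

/-- Tuples supported at one index recover the component there. -/
lemma psiA_injective {θ : I → C →* ℂˣ} (hθ : Function.Injective θ) {c c' : α → I}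
    (h : ∀ t, psiA θ c t = psiA θ c' t) : c = c' := by
  funext a
  apply hθ
  ext x
  rw [← psiA_mulSingle, h, psiA_mulSingle]

lemma exists_psiA {θ : I → C →* ℂˣ} (hθ : Function.Surjective θ) (ψ : (α → C) →* ℂˣ) :
    ∃ c, ψ = psiA θ c := by
  choose c hc using fun a => hθ (ψ.comp (MonoidHom.mulSingle (fun _ : α => C) a))
  refine ⟨c, MonoidHom.functions_ext _ _ _ fun a x => ?_⟩
  rw [psiA_mulSingle, hc]
  rfl

/-- The tensor product of the representations `S i ⊗ θ i` of the blocks. -/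
def innerGen (θ : I → C →* ℂˣ) (S : ∀ i, Representation ℂ (Equiv.Perm (β i)) (V i)) :
    Representation ℂ (∀ i, Wr C (β i)) (⨂[ℂ] i, V i) :=
  piTensor fun i => twist ((θ i).comp (detHom C (β i)))
    ((S i).comp SemidirectProduct.rightHom)

/-- Separates the scalar by which the torus acts from the action of the permutations. The factors of
the scalar, collected over all blocks, are exactly the value of `psiA` on the torus part. -/
lemma innerGen_apply (θ : I → C →* ℂˣ) (S : ∀ i, Representation ℂ (Equiv.Perm (β i)) (V i))
    (e : (Σ i, β i) ≃ α) (x : ∀ i, Wr C (β i)) (v : ⨂[ℂ] i, V i) :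
    innerGen θ S x v = (psiA θ (color e) (embA C e x).left : ℂ) •
      piTensor S (fun i => (x i).right) v := by
  have h : innerGen θ S x = (psiA θ (color e) (embA C e x).left : ℂ) •
      piTensor S (fun i => (x i).right) := by
    ext v
    have h1 : psiA θ (color e) (embA C e x).left = ∏ i, θ i (detHom C (β i) (x i)) := by
      rw [psiA_apply, ← Equiv.prod_comp e, Fintype.prod_sigma]
      refine Finset.prod_congr rfl fun i _ => ?_
      change _ = θ i (∏ b, (x i).left b)
      rw [map_prod]
      refine Finset.prod_congr rfl fun b _ => ?_
      rw [color_apply, embA_left]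
    simp only [LinearMap.compMultilinearMap_apply, LinearMap.smul_apply, innerGen,
      piTensor_tprod, twist_apply]
    rw [h1, MultilinearMap.map_smul_univ, Units.coe_prod]
    rfl
  rw [h]
  rfl

/-- The representation of `C ^ α ⋊ Perm α` induced from the blocks. -/
def genA (θ : I → C →* ℂˣ) (e : (Σ i, β i) ≃ α)
    (S : ∀ i, Representation ℂ (Equiv.Perm (β i)) (V i)) :
    Representation ℂ (Wr C α) (IndV (embA C e) (innerGen θ S)) :=
  ind (embA C e) (innerGen θ S)

lemma actsBy_innerGen (θ : I → C →* ℂˣ) (e : (Σ i, β i) ≃ α)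
    (S : ∀ i, Representation ℂ (Equiv.Perm (β i)) (V i)) :
    ActsBy (embA C e) (innerGen θ S) (psiA θ (color e)) := by
  have h : ∀ t : α → C, embA C e (fun i => SemidirectProduct.inl fun b => t (e ⟨i, b⟩)) =
      SemidirectProduct.inl t := by
    intro t
    refine SemidirectProduct.ext (funext fun a => ?_) (Equiv.ext fun a => ?_)
    · obtain ⟨⟨i, b⟩, rfl⟩ := e.surjective a
      rw [embA_left]
      rfl
    · obtain ⟨⟨i, b⟩, rfl⟩ := e.surjective a
      rw [embA_right]
      rfl
  refine ⟨fun t i => SemidirectProduct.inl fun b => t (e ⟨i, b⟩), h, fun t v => ?_⟩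
  rw [innerGen_apply θ S e, h]
  have : (fun i : I => (SemidirectProduct.inl (fun b => t (e ⟨i, b⟩)) : Wr C (β i)).right) = 1 := by
    funext i
    simp
  rw [this, map_one]
  simp

/-- Distinct blocks carry distinct characters, so a permutation fixing the character preserves the
colouring. -/
lemma hasStab_embA {θ : I → C →* ℂˣ} (hθ : Function.Injective θ) (e : (Σ i, β i) ≃ α) :
    HasStab (embA C e) (psiA θ (color e)) := by
  intro h hh
  rw [mem_range_embA]
  intro a
  have := psiA_injective hθ (c := fun a => color e (h.right a)) (c' := color e) fun t => by
    rw [← psiA_perm, hh]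
  exact congrFun this a

lemma isIrreducible_innerGen [Finite C] (θ : I → C →* ℂˣ)
    {S : ∀ i, Representation ℂ (Equiv.Perm (β i)) (V i)} (hS : ∀ i, (S i).IsIrreducible) :
    (innerGen θ S).IsIrreducible :=
  isIrreducible_piTensor fun i => isIrreducible_twist _
    (isIrreducible_comp SemidirectProduct.rightHom_surjective (hS i))

lemma isIrreducible_genA [Finite C] {θ : I → C →* ℂˣ} (hθ : Function.Injective θ)
    (e : (Σ i, β i) ≃ α)
    {S : ∀ i, Representation ℂ (Equiv.Perm (β i)) (V i)} (hS : ∀ i, (S i).IsIrreducible) :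
    (genA θ e S).IsIrreducible :=
  (actsBy_innerGen θ e S).isIrreducible_ind (embA_injective e) (hasStab_embA hθ e)
    (isIrreducible_innerGen θ hS)

lemma detHom_congr {γ δ : Type*} [Fintype γ] [Fintype δ] (f : γ ≃ δ) (x : Wr C γ) :
    detHom C δ (Wr.congr f x) = detHom C γ x :=
  Equiv.prod_comp f.symm x.left

/-- Relabelling of blocks. -/
def blockMap (C : Type) [CommGroup C] (s : I → I') (f : ∀ i, β' (s i) ≃ β i) :
    (∀ i, Wr C (β' i)) →* ∀ i, Wr C (β i) where
  toFun x i := Wr.congr (f i) (x (s i))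
  map_one' := funext fun _ => map_one _
  map_mul' _ _ := funext fun _ => map_mul _ _ _

lemma linked_innerGen_congr (s : I ≃ I') (f : ∀ i, β' (s i) ≃ β i)
    {θ : I → C →* ℂˣ} {θ' : I' → C →* ℂˣ} (hθ : ∀ i, θ i = θ' (s i))
    {S : ∀ i, Representation ℂ (Equiv.Perm (β i)) (V i)}
    {S' : ∀ i, Representation ℂ (Equiv.Perm (β' i)) (V' i)}
    (hS : ∀ i, (S i).IsIrreducible) (hS' : ∀ i, (S' i).IsIrreducible)
    (hl : ∀ i, Linked (S' (s i)) ((S i).comp (f i).permCongrHom.toMonoidHom)) :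
    Linked (innerGen θ' S') ((innerGen θ S).comp (blockMap C s f)) := by
  choose L hL using fun i => nonempty_equiv_iff.1 ((hl i).nonempty_equiv (hS' _)
    (isIrreducible_comp (f i).permCongrHom.surjective (hS i)))
  let F : (⨂[ℂ] i, V' i) ≃ₗ[ℂ] (⨂[ℂ] i, V i) :=
    (PiTensorProduct.reindex ℂ V' s.symm).trans (PiTensorProduct.congr L)
  have hF : ∀ v, F (PiTensorProduct.tprod ℂ v) =
      PiTensorProduct.tprod ℂ fun i => L i (v (s i)) := fun v => by
    simp only [F, LinearEquiv.trans_apply, PiTensorProduct.reindex_tprod]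
    exact PiTensorProduct.congr_tprod _ _
  have hF1 : Intw (innerGen θ' S') ((innerGen θ S).comp (blockMap C s f)) F.toLinearMap := by
    intro x v
    have : F.toLinearMap ∘ₗ innerGen θ' S' x
        = (innerGen θ S) (blockMap C s f x) ∘ₗ F.toLinearMap := by
      ext v
      simp only [LinearMap.compMultilinearMap_apply, LinearMap.comp_apply, LinearEquiv.coe_coe,
        innerGen, piTensor_tprod, hF, twist_apply]
      congr 1
      funext i
      rw [map_smul, hθ]
      have h1 : detHom C (β i) (blockMap C s f x i) = detHom C _ (x (s i)) := detHom_congr _ _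
      simp only [MonoidHom.comp_apply]
      rw [h1]
      congr 1
      exact hL i (x (s i)).right (v (s i))
    exact LinearMap.congr_fun this v
  have := fun i => (isIrreducible_iff.1 (hS' i)).1
  have hnt : Nontrivial (⨂[ℂ] i, V' i) :=
    (isIrreducible_iff.1 (isIrreducible_piTensor (ρ := S') hS')).1
  exact linked_of_equiv (nonempty_equiv_of_intw hF1)

/-- Two block decompositions with matching blocks differ by a permutation `π` of the indices, and
`π` conjugates one embedding into the other. -/
lemma embA_blockMap (s : I ≃ I') (f : ∀ i, β' (s i) ≃ β i) (e : (Σ i, β i) ≃ α)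
    (e' : (Σ i, β' i) ≃ α) : ∃ π : Equiv.Perm α, ∀ x : ∀ i, Wr C (β' i),
      embA C e (blockMap C s f x) * SemidirectProduct.inr π
        = SemidirectProduct.inr π * embA C e' x := by
  let E : (Σ i, β i) ≃ Σ i, β' i := Equiv.sigmaCongr s fun i => (f i).symm
  have hE : ∀ i b, E.symm ⟨s i, b⟩ = ⟨i, f i b⟩ := fun i b => by
    rw [Equiv.symm_apply_eq]
    change _ = (⟨s i, (f i).symm (f i b)⟩ : Σ i, β' i)
    rw [Equiv.symm_apply_apply]
  let π : Equiv.Perm α := e'.symm.trans (E.symm.trans e)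
  have hπ : ∀ i b, π (e' ⟨s i, b⟩) = e ⟨i, f i b⟩ := fun i b => by
    change e (E.symm (e'.symm (e' _))) = _
    rw [Equiv.symm_apply_apply, hE]
  have hπ' : ∀ i b, π.symm (e ⟨i, b⟩) = e' ⟨s i, (f i).symm b⟩ := fun i b => by
    rw [Equiv.symm_apply_eq, hπ, Equiv.apply_symm_apply]
  refine ⟨π, fun x => SemidirectProduct.ext (funext fun a => ?_) (Equiv.ext fun a => ?_)⟩
  · obtain ⟨⟨i, b⟩, rfl⟩ := e.surjective a
    change (embA C e (blockMap C s f x)).left (e ⟨i, b⟩) * 1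
      = 1 * (embA C e' x).left (π.symm (e ⟨i, b⟩))
    rw [mul_one, one_mul, hπ', embA_left, embA_left]
    rfl
  · obtain ⟨⟨i', b⟩, rfl⟩ := e'.surjective a
    obtain ⟨i, rfl⟩ := s.surjective i'
    change (embA C e (blockMap C s f x)).right (π (e' ⟨s i, b⟩))
      = π ((embA C e' x).right (e' ⟨s i, b⟩))
    rw [hπ, embA_right, embA_right, hπ]
    congr 2
    change (f i) ((x (s i)).right ((f i).symm (f i b))) = _
    rw [Equiv.symm_apply_apply]

lemma linked_genA_congr (s : I ≃ I') (f : ∀ i, β' (s i) ≃ β i) (e : (Σ i, β i) ≃ α)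
    (e' : (Σ i, β' i) ≃ α)
    {θ : I → C →* ℂˣ} {θ' : I' → C →* ℂˣ} (hθ : ∀ i, θ i = θ' (s i))
    {S : ∀ i, Representation ℂ (Equiv.Perm (β i)) (V i)}
    {S' : ∀ i, Representation ℂ (Equiv.Perm (β' i)) (V' i)}
    (hS : ∀ i, (S i).IsIrreducible) (hS' : ∀ i, (S' i).IsIrreducible)
    (hl : ∀ i, Linked (S' (s i)) ((S i).comp (f i).permCongrHom.toMonoidHom)) :
    Linked (genA θ' e' S') (genA θ e S) := by
  obtain ⟨π, hπ⟩ := embA_blockMap (C := C) s f e e'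
  exact linked_ind_ind (embA_injective e) (blockMap C s f) (SemidirectProduct.inr π) hπ
    (linked_innerGen_congr s f hθ hS hS' hl)

/-- Each block is in bijection with a fibre of the colouring, and `σ` carries fibres to fibres. -/
lemma nonempty_block_equiv {β' : I → Type} [∀ i, Fintype (β' i)] [∀ i, DecidableEq (β' i)]
    {e : (Σ i, β i) ≃ α} {e' : (Σ i, β' i) ≃ α}
    (σ : Equiv.Perm α) (h : ∀ a, color e' (σ a) = color e a) (i : I) :
    Nonempty (β i ≃ β' i) := by
  have key : ∀ {γ : I → Type} [∀ i, Fintype (γ i)] [∀ i, DecidableEq (γ i)]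
      (e : (Σ i, γ i) ≃ α), Nonempty (γ i ≃ {a // color e a = i}) := by
    intro γ _ _ e
    refine ⟨Equiv.ofBijective (fun b => ⟨e ⟨i, b⟩, color_apply e i b⟩) ⟨fun b b' hb => ?_, ?_⟩⟩
    · simpa using hb
    · rintro ⟨a, rfl⟩
      refine ⟨(e.symm a).2, Subtype.ext ?_⟩
      exact e.apply_symm_apply a
  exact ⟨(key e).some.trans ((σ.subtypeEquiv fun a => by rw [h]).trans (key e').some.symm)⟩

/-- The torus characters are conjugate, so corresponding blocks have equal sizes. After transporting
`S'` to the blocks of `S`, both representations are induced through the same embedding with the same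
character, and `ActsBy.linked` followed by `Linked.piTensor` compares them factor by factor. -/
lemma exists_block_equiv_of_linked {β' : I → Type} [∀ i, Fintype (β' i)]
    [∀ i, DecidableEq (β' i)] [Finite C]
    {V' : I → Type*} [∀ i, AddCommGroup (V' i)] [∀ i, Module ℂ (V' i)] {θ : I → C →* ℂˣ}
    (hθ : Function.Injective θ) {e : (Σ i, β i) ≃ α} {e' : (Σ i, β' i) ≃ α}
    {S : ∀ i, Representation ℂ (Equiv.Perm (β i)) (V i)}
    {S' : ∀ i, Representation ℂ (Equiv.Perm (β' i)) (V' i)}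
    (hS : ∀ i, (S i).IsIrreducible) (hS' : ∀ i, (S' i).IsIrreducible)
    (hl : Linked (genA θ e S) (genA θ e' S')) :
    ∃ f : ∀ i, β i ≃ β' i, ∀ i, Linked (S i) ((S' i).comp (f i).permCongrHom.toMonoidHom) := by
  obtain ⟨σ, hσ⟩ := (actsBy_innerGen θ e S).exists_conj (actsBy_innerGen θ e' S') hl
  have h1 := psiA_injective hθ (c := fun a => color e' (σ a)) (c' := color e) fun t => by
    rw [← psiA_perm, hσ]
  have f : ∀ i, β i ≃ β' i := fun i =>
    (nonempty_block_equiv (e := e) (e' := e') σ (congrFun h1) i).some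
  refine ⟨f, ?_⟩
  have hS'' : ∀ i, Representation.IsIrreducible ((S' i).comp (f i).permCongrHom.toMonoidHom) :=
    fun i => isIrreducible_comp (f i).permCongrHom.surjective (hS' i)
  have h2 : Linked (genA θ e' S')
      (genA θ e fun i => (S' i).comp (f i).permCongrHom.toMonoidHom) := by
    refine linked_genA_congr (Equiv.refl I) (fun i => (f i).symm) e e' (fun i => rfl) hS'' hS'
      fun i => ?_
    have : Nontrivial (V' ((Equiv.refl I) i)) := (isIrreducible_iff.1 (hS' i)).1
    refine linked_of_equiv (nonempty_equiv_of_intw (e := LinearEquiv.refl ℂ _) fun σ v => ?_)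
    change S' i σ v = S' i ((f i).permCongr ((f i).symm.permCongr σ)) v
    congr 2
    ext a
    change σ a = f i ((f i).symm (σ (f i ((f i).symm a))))
    exact ((congrArg (fun b => f i ((f i).symm (σ b))) ((f i).apply_symm_apply a)).trans
      ((f i).apply_symm_apply (σ a))).symm
  have h3 := hl.trans_equiv (h2.nonempty_equiv (isIrreducible_genA hθ e' hS')
    (isIrreducible_genA hθ e hS''))
  have h4 := (actsBy_innerGen θ e S).linked (embA_injective e) (actsBy_innerGen θ e _)
    (hasStab_embA hθ e) h3
  intro i
  have h5 := Linked.piTensor (fun i => isIrreducible_twist _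
    (isIrreducible_comp SemidirectProduct.rightHom_surjective (hS i))) h4 i
  obtain ⟨F, hF, h0⟩ := h5
  refine ⟨F, fun σ v => ?_, h0⟩
  -- On pure permutations the twisting character is trivial.
  have := hF (SemidirectProduct.inr σ) v
  simpa [twist_apply, detHom] using this

/-- A torus eigenspace is a representation of its stabilizer, a product of wreath blocks. As a
representation of the product of the symmetric groups it contains a tensor product of Specht
modules; the torus acts there by the right scalar, so reciprocity applies. -/
lemma exists_linked_genA [Finite C] {θ : I → C →* ℂˣ}
    (hθ : Function.Bijective θ) {X : Type u} [AddCommGroup X] [Module ℂ X]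
    (τ : Representation ℂ (Wr C α) X) [Nontrivial X] :
    ∃ (c : α → I) (l : I → YoungDiagram),
      (∀ i, (l i).card = Fintype.card {a // c a = i}) ∧
      Linked (genA θ (Equiv.sigmaFiberEquiv c) fun i => spechtRep (l i) {a // c a = i}) τ := by
  obtain ⟨ψ, hψ⟩ := exists_eigen_ne_bot τ
  obtain ⟨c, rfl⟩ := exists_psiA hθ.2 ψ
  set e := Equiv.sigmaFiberEquiv c with he
  have hc : color e = c := by
    funext a
    obtain ⟨⟨i, b⟩, rfl⟩ := e.surjective a
    rw [color_apply]
    exact b.2.symm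
  let Y := eigenSub (embA C e) τ (psiA θ c) fun n t => by
    rw [psiA_perm]
    congr 1
    congr 1
    funext a
    have h := (mem_range_embA e _).1 ⟨n, rfl⟩ a
    rw [congrFun hc, congrFun hc] at h
    exact h
  have hY : Nontrivial Y.toSubmodule := Submodule.nontrivial_iff_ne_bot.2 hψ
  let r : (∀ i, Equiv.Perm {a // c a = i}) →* ∀ i, Wr C {a // c a = i} :=
    MonoidHom.mk' (fun σ i => SemidirectProduct.inr (σ i)) fun σ σ' => by
      funext i
      simp
  let Y' : Representation ℂ (∀ i, Equiv.Perm {a // c a = i}) Y.toSubmodule :=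
    Y.toRepresentation.comp r
  obtain ⟨l, f, hf, h0⟩ := exists_linked_piTensor
    (ρ := fun i (m : {m : YoungDiagram // m.card = Fintype.card {a // c a = i}}) =>
      spechtRep m.1 {a // c a = i})
    (fun i m => isIrreducible_spechtRep' m.2) (fun i => covers_spechtRep _) Y'
  refine ⟨c, fun i => (l i).1, fun i => (l i).2, linked_ind ?_⟩
  refine ⟨Y.toSubmodule.subtype ∘ₗ f, fun x v => ?_, fun h => h0 ?_⟩
  · rw [innerGen_apply θ _ e, map_smul, hc]
    have h1 := congrArg Subtype.val (hf (fun i => (x i).right) v)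
    have h2 : x = (fun i => SemidirectProduct.inl (x i).left) * r fun i => (x i).right := by
      funext i
      exact (SemidirectProduct.inl_left_mul_inr_right _).symm
    have h3 : embA C e (fun i => SemidirectProduct.inl (x i).left)
        = SemidirectProduct.inl (embA C e x).left := by
      refine SemidirectProduct.ext (funext fun a => ?_) (Equiv.ext fun a => ?_)
      · obtain ⟨⟨i, b⟩, rfl⟩ := e.surjective a
        rw [embA_left]
        exact (embA_left e x i b).symm
      · obtain ⟨⟨i, b⟩, rfl⟩ := e.surjective a
        rw [embA_right]
        rfl
    have h4 : ((Y' (fun i => (x i).right) (f v) : Y.toSubmodule) : X)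
        = τ (embA C e (r fun i => (x i).right)) (f v : X) := rfl
    have h5 := mem_eigen.1 (Y' (fun i => (x i).right) (f v)).2 (embA C e x).left
    change _ • (f _ : X) = τ (embA C e x) (f v : X)
    -- Split `x` as torus element times permutations: the torus part acts on the eigenspace by the
    -- character, and `f` already commutes with the rest.
    conv_rhs => rw [h2, map_mul, map_mul, h3, Module.End.mul_apply, ← h4, h5]
    exact congrArg _ h1
  · exact LinearMap.ext fun v => Subtype.ext (LinearMap.congr_fun h v)

/-! ### The irreducible representations -/

/-- The representation of `C ^ α ⋊ Perm α` attached to a family of partitions. -/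
def genS (θ : I → C →* ℂˣ) (l : I → YoungDiagram) (e : (Σ i, Fin (l i).card) ≃ α) :
    Representation ℂ (Wr C α) (IndV (embA C e) (innerGen θ fun i => specht (l i))) :=
  genA θ e fun i => specht (l i)

lemma isIrreducible_genS [Finite C] {θ : I → C →* ℂˣ} (hθ : Function.Injective θ)
    (l : I → YoungDiagram) (e : (Σ i, Fin (l i).card) ≃ α) : (genS θ l e).IsIrreducible :=
  isIrreducible_genA hθ e fun i => isIrreducible_specht (l i)

lemma eq_of_linked_genS [Finite C] {θ : I → C →* ℂˣ} (hθ : Function.Injective θ)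
    {l l' : I → YoungDiagram} {e : (Σ i, Fin (l i).card) ≃ α} {e' : (Σ i, Fin (l' i).card) ≃ α}
    (h : Linked (genS θ l e) (genS θ l' e')) : l = l' := by
  unfold genS at h
  obtain ⟨f, hf⟩ := exists_block_equiv_of_linked (S := fun i => specht (l i))
    (S' := fun i => specht (l' i)) hθ (fun i => isIrreducible_specht (l i))
    (fun i => isIrreducible_specht (l' i)) h
  funext i
  exact eq_of_linked_specht (f i) (hf i)

lemma linked_genS_reindex (s : I ≃ I') {θ : I → C →* ℂˣ} {θ' : I' → C →* ℂˣ}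
    (hθ : ∀ i, θ i = θ' (s i)) {l : I → YoungDiagram} {l' : I' → YoungDiagram}
    (hl : ∀ i, l i = l' (s i)) (e : (Σ i, Fin (l i).card) ≃ α)
    (e' : (Σ i, Fin (l' i).card) ≃ α) : Linked (genS θ' l' e') (genS θ l e) := by
  -- Substituting the equality of shapes makes corresponding blocks literally equal, so no casts
  -- between Specht modules arise.
  have hl' : l = fun i => l' (s i) := funext hl
  subst hl'
  refine linked_genA_congr (β := fun i => Fin (l' (s i)).card) (β' := fun i => Fin (l' i).card)
    (S := fun i => specht (l' (s i))) (S' := fun i => specht (l' i))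
    s (fun _ => Equiv.refl _) e e' hθ
    (fun _ => isIrreducible_specht _) (fun _ => isIrreducible_specht _) fun i => ?_
  have := (isIrreducible_iff.1 (isIrreducible_specht (l' (s i)))).1
  exact linked_of_equiv (nonempty_equiv_of_intw (e := LinearEquiv.refl ℂ _) fun _ _ => rfl)

lemma exists_linked_genS [Finite C] {θ : I → C →* ℂˣ}
    (hθ : Function.Bijective θ) {X : Type u} [AddCommGroup X] [Module ℂ X]
    (τ : Representation ℂ (Wr C α) X) [Nontrivial X] :
    ∃ l : I → YoungDiagram, ∑ i, (l i).card = Fintype.card α ∧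
      ∀ e : (Σ i, Fin (l i).card) ≃ α, Linked (genS θ l e) τ := by
  obtain ⟨c, l, hl, h⟩ := exists_linked_genA hθ τ
  refine ⟨l, ?_, fun e => ?_⟩
  · simp only [hl]
    rw [← Fintype.card_sigma]
    exact Fintype.card_congr (Equiv.sigmaFiberEquiv c)
  · have hS := fun i => isIrreducible_spechtRep' (hl i)
    let f : ∀ i, Fin (l i).card ≃ {a // c a = i} := fun i =>
      Fintype.equivOfCardEq (by simp [hl])
    have h1 : Linked (genS θ l e) (genA θ (Equiv.sigmaFiberEquiv c)
        fun i => spechtRep (l i) {a // c a = i}) :=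
      linked_genA_congr (β' := fun i => Fin (l i).card) (S' := fun i => specht (l i))
        (S := fun i => spechtRep (l i) {a // c a = i}) (Equiv.refl I) f _ e (fun i => rfl) hS
        (fun i => isIrreducible_specht _) fun i => linked_specht_spechtRep (f i)
    exact Linked.of_equiv (h1.nonempty_equiv (isIrreducible_genS hθ.1 l e)
      (isIrreducible_genA hθ.1 _ hS)) h

end Wreath

open Representation (ind IndV)

/-! ## Characters of the group of roots of unity -/

section Roots

variable (d : ℕ) [NeZero d]

lemma exists_primitive : ∃ ζ : Cd d, IsPrimitiveRoot (ζ : ℂˣ) d ∧ ∀ x : Cd d, ∃ k : ℕ, ζ ^ k = x := by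
  have h0 : d ≠ 0 := NeZero.ne d
  have h := (Complex.isPrimitiveRoot_exp d h0).isUnit_unit h0
  refine ⟨⟨_, (mem_rootsOfUnity _ _).2 h.pow_eq_one⟩, h, fun x => ?_⟩
  obtain ⟨k, -, hk⟩ := h.eq_pow_of_mem_rootsOfUnity x.2
  exact ⟨k, Subtype.ext hk⟩

/-- The character `x ↦ x ^ k` of the group of roots of unity. -/
def powChar (k : ℕ) : Cd d →* ℂˣ := (rootsOfUnity d ℂ).subtype ^ k

lemma powChar_apply (k : ℕ) (x : Cd d) : powChar d k x = (x : ℂˣ) ^ k := rfl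

/-- Evaluate at a primitive root, whose order is `d`. -/
lemma powChar_eq_iff {a b : ℕ} : powChar d a = powChar d b ↔ a ≡ b [MOD d] := by
  obtain ⟨ζ, hζ, hs⟩ := exists_primitive d
  constructor
  · intro h
    have := DFunLike.congr_fun h ζ
    rw [powChar_apply, powChar_apply, pow_eq_pow_iff_modEq, ← hζ.eq_orderOf] at this
    exact this
  · intro h
    ext x
    rw [powChar_apply, powChar_apply]
    congr 1
    rw [pow_eq_pow_iff_modEq]
    exact h.of_dvd (orderOf_dvd_of_pow_eq_one ((mem_rootsOfUnity _ _).1 x.2))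

lemma exists_powChar (χ : Cd d →* ℂˣ) : ∃ k < d, χ = powChar d k := by
  obtain ⟨ζ, hζ, hs⟩ := exists_primitive d
  obtain ⟨k, hk, h⟩ := hζ.eq_pow_of_mem_rootsOfUnity (ξ := χ ζ) <| by
    rw [mem_rootsOfUnity, ← map_pow, show ζ ^ d = 1 from Subtype.ext hζ.pow_eq_one, map_one]
  refine ⟨k, hk, ?_⟩
  ext x
  obtain ⟨m, rfl⟩ := hs x
  rw [map_pow, ← h, powChar_apply]
  simp only [SubmonoidClass.coe_pow, ← pow_mul, mul_comm]

/-- The characters attached to the blocks in type `A`. -/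
def thetaA (i : Fin d) : Cd d →* ℂˣ := powChar d ((i : ℕ) + 1)

lemma thetaA_bijective : Function.Bijective (thetaA d) := by
  constructor
  · intro i j h
    have h1 := ((powChar_eq_iff d).1 h).add_right_cancel' 1
    have h2 : (i : ℕ) % d = j % d := h1
    rw [Nat.mod_eq_of_lt i.2, Nat.mod_eq_of_lt j.2] at h2
    exact Fin.ext h2
  · intro χ
    obtain ⟨k, hk, rfl⟩ := exists_powChar d χ
    rcases k with _ | k
    -- Block exponents run from `1` to `d`, so the trivial character belongs to the last block, with
    -- exponent `d` instead of `0`.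
    · refine ⟨⟨d - 1, by omega⟩, ?_⟩
      unfold thetaA
      rw [powChar_eq_iff]
      change d - 1 + 1 ≡ 0 [MOD d]
      rw [Nat.sub_add_cancel (by omega)]
      simp [Nat.ModEq]
    · exact ⟨⟨k, by omega⟩, rfl⟩

end Roots

/-- On the torus, `χ ∘ det` multiplies the character of every block by `χ`; twisting commutes with
induction. -/
lemma linked_genS_twist {C : Type} [CommGroup C] {α : Type} [Fintype α]
    [DecidableEq α] {I : Type} [Fintype I] [DecidableEq I] (χ : C →* ℂˣ) (θ : I → C →* ℂˣ)
    (l : I → YoungDiagram) (e : (Σ i, Fin (l i).card) ≃ α) :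
    Linked (genS (fun i => χ * θ i) l e) (twist (χ.comp (detHom C α)) (genS θ l e)) := by
  have h : innerGen (fun i => χ * θ i) (fun i => specht (l i)) =
      twist ((χ.comp (detHom C α)).comp (embA C e)) (innerGen θ fun i => specht (l i)) := by
    ext x : 1
    refine LinearMap.ext fun v => ?_
    rw [twist_apply, innerGen_apply _ _ e, innerGen_apply _ _ e, smul_smul]
    congr 1
    rw [← Units.val_mul]
    congr 1
    rw [psiA_apply, psiA_apply]
    simp only [MonoidHom.mul_apply, Finset.prod_mul_distrib]
    congr 1
    exact (map_prod χ _ _).symm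
  unfold genS genA
  rw [h]
  have : Nontrivial (⨂[ℂ] i, SpechtModule (l i)) :=
    (isIrreducible_iff.1 (isIrreducible_piTensor fun i => isIrreducible_specht (l i))).1
  exact linked_twist_ind (embA_injective e) _

/-! ## Type A -/

section TypeA

variable {d n : ℕ} [NeZero d]

lemma torusChar_psi (Λ : Q d n) :
    (torusChar Λ.psi : (Fin n → Cd d) →* ℂˣ) = psiA (thetaA d) (color Λ.blockEquiv) := rfl

/-- The stabilizer description passes through the colouring: preserving colours under `g.right` and
under its inverse is the same condition. -/
lemma range_emb (Λ : Q d n) : Set.range Λ.emb = {g : SA d n |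
    ∀ t : Fin n → Cd d, torusChar Λ.psi (permAut _ _ g.right⁻¹ t) = torusChar Λ.psi t} := by
  ext g
  have h1 : g ∈ Set.range Λ.emb ↔ ∀ a, color Λ.blockEquiv (g.right a) = color Λ.blockEquiv a :=
    mem_range_embA Λ.blockEquiv g
  rw [h1, Set.mem_ofPred_eq, torusChar_psi]
  simp only [psiA_perm]
  constructor
  · intro h t
    congr 1
    congr 1
    funext a
    simpa using (h (g.right⁻¹ a)).symm
  · intro h a
    have h2 := congrFun (psiA_injective (thetaA_bijective d).1 h) (g.right a)
    simpa using h2.symm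

lemma exists_part_eq (l : Fin d → YoungDiagram) (hl : ∑ i, (l i).card = n) :
    ∃ Λ : Q d n, Λ.part = l := by
  have hb : Function.Bijective fun i : Fin d => (((i : ℕ) + 1 : ℕ) : ZMod d) := by
    rw [Fintype.bijective_iff_injective_and_card]
    refine ⟨fun i j h => ?_, by simp⟩
    have h' := ((ZMod.natCast_eq_natCast_iff _ _ _).1 h).add_right_cancel' 1
    rw [Nat.ModEq, Nat.mod_eq_of_lt i.2, Nat.mod_eq_of_lt j.2] at h'
    exact Fin.ext h'
  let b := Equiv.ofBijective _ hb
  refine ⟨⟨fun j => l (b.symm j), ?_⟩, ?_⟩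
  · rw [← hl]
    exact Equiv.sum_comp b.symm fun i => (l i).card
  · funext i
    exact congrArg l (b.symm_apply_apply i)

lemma part_injective : Function.Injective (Q.part : Q d n → _) := by
  intro Λ Λ' h
  refine Subtype.ext (funext fun j => ?_)
  have h1 := congrFun h ⟨(j - 1 : ZMod d).val, ZMod.val_lt _⟩
  unfold Q.part at h1
  simpa using h1

lemma isIrreducible_chiA (Λ : Q d n) : (chiA Λ).IsIrreducible :=
  isIrreducible_genS (thetaA_bijective d).1 Λ.part Λ.blockEquiv

lemma eq_of_linked_chiA {Λ Λ' : Q d n} (h : Linked (chiA Λ) (chiA Λ')) : Λ = Λ' :=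
  part_injective (eq_of_linked_genS (e := Λ.blockEquiv) (e' := Λ'.blockEquiv)
    (thetaA_bijective d).1 h)

lemma exists_linked_chiA {X : Type u} [AddCommGroup X] [Module ℂ X]
    (τ : Representation ℂ (SA d n) X) [Nontrivial X] : ∃ Λ : Q d n, Linked (chiA Λ) τ := by
  obtain ⟨l, hl, h⟩ := exists_linked_genS (thetaA_bijective d) τ
  obtain ⟨Λ, rfl⟩ := exists_part_eq l (by simpa using hl)
  exact ⟨Λ, h Λ.blockEquiv⟩

/-- Addition in `Fin d` wraps around, as exponents do mod `d`. -/
lemma thetaA_add_one (i : Fin d) :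
    powChar d 1 * thetaA d i = thetaA d (Equiv.addRight (1 : Fin d) i) := by
  have h : powChar d 1 * thetaA d i = powChar d (1 + ((i : ℕ) + 1)) :=
    (pow_add ((rootsOfUnity d ℂ).subtype : Cd d →* ℂˣ) _ _).symm
  rw [h]
  refine (powChar_eq_iff d).2 ?_
  rw [Equiv.coe_addRight, Fin.val_add, Fin.val_one', Nat.add_mod_mod, add_comm 1]
  exact ((Nat.mod_modEq _ _).add_right 1).symm

lemma Q.part_shift (Λ : Q d n) (i : Fin d) :
    Λ.part i = Λ.shift.part (Equiv.addRight (1 : Fin d) i) := by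
  unfold Q.part Q.shift
  simp [Fin.val_add]

/-- Twisting by the determinant raises each block exponent by one. The result is the same family of
partitions attached to shifted characters, that is, the representation of the shifted family. -/
lemma nonempty_equiv_twist_chiA (Λ : Q d n) :
    Nonempty ((twist (epsCharA d n) (chiA Λ)).Equiv (chiA Λ.shift)) := by
  refine nonempty_equiv_symm (Linked.nonempty_equiv ?_ (isIrreducible_chiA _)
    (isIrreducible_twist _ (isIrreducible_chiA _)))
  have h1 : Linked (genS (fun i => powChar d 1 * thetaA d i) Λ.part Λ.blockEquiv)
    (twist (epsCharA d n) (chiA Λ)) := linked_genS_twist _ _ _ _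
  refine Linked.of_equiv (Linked.nonempty_equiv ?_ (isIrreducible_chiA _) (isIrreducible_genS
    (fun i j h => (thetaA_bijective d).1 (mul_left_cancel h)) _ _)) h1
  · exact linked_genS_reindex (Equiv.addRight (1 : Fin d)) thetaA_add_one Λ.part_shift _ _

lemma shift_iterate (Λ : Q d n) (k : ℕ) (j : ZMod d) : (Q.shift^[k] Λ).1 j = Λ.1 (j - k) := by
  induction k generalizing j with
  | zero => simp
  | succ k ih =>
    rw [Function.iterate_succ_apply']
    change (Q.shift^[k] Λ).1 (j - 1) = _
    rw [ih]
    refine congrArg Λ.1 ?_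
    push_cast
    abel

lemma isPeriodicPt_shift (Λ : Q d n) : Function.IsPeriodicPt Q.shift d Λ := by
  refine Subtype.ext (funext fun j => ?_)
  rw [shift_iterate]
  simp

end TypeA

open Representation (ind IndV)

/-! ## The Weyl groups of type `B` -/

/-- The sign character of `{±1}` with values in `ℂˣ`. -/
def signChar : ℤˣ →* ℂˣ := Units.map (Int.castRingHom ℂ).toMonoidHom

lemma signChar_neg_one : signChar (-1) = -1 := by
  ext
  simp [signChar]

/-- The two characters of `{±1}`. -/
def thetaW (b : Bool) : ℤˣ →* ℂˣ := bif b then signChar else 1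

lemma thetaW_bijective : Function.Bijective thetaW := by
  have hne : signChar ≠ 1 := fun h => by
    have := DFunLike.congr_fun h (-1)
    rw [signChar_neg_one, MonoidHom.one_apply] at this
    have h2 := congrArg Units.val this
    norm_num at h2
  constructor
  · intro a b h
    cases a <;> cases b
    · rfl
    · exact absurd h.symm hne
    · exact absurd h hne
    · rfl
  · intro χ
    have h1 : ((χ (-1) : ℂˣ) : ℂ) * (χ (-1) : ℂˣ) = 1 := by
      rw [← Units.val_mul, ← map_mul]
      simp
    have hext : ∀ χ' : ℤˣ →* ℂˣ, χ' (-1) = χ (-1) → χ' = χ := fun χ' h => by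
      ext x : 1
      rcases Int.units_eq_one_or x with rfl | rfl
      · rw [map_one, map_one]
      · exact h
    rcases mul_self_eq_one_iff.1 h1 with h | h
    · exact ⟨false, hext _ (Units.ext h.symm)⟩
    · refine ⟨true, hext _ (Units.ext ?_)⟩
      rw [h]
      exact congrArg Units.val signChar_neg_one

/-- A pair of partitions as a family. -/
def pairL (l m : YoungDiagram) (b : Bool) : YoungDiagram := bif b then m else l

/-- The two blocks of `Fin (a + b)`. -/
def eW (l m : YoungDiagram) : (Σ b, Fin (pairL l m b).card) ≃ Fin (l.card + m.card) :=
  Equiv.trans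
    { toFun := fun x => match x with
        | ⟨false, a⟩ => Sum.inl a
        | ⟨true, a⟩ => Sum.inr a
      invFun := Sum.elim (fun a => ⟨false, a⟩) (fun a => ⟨true, a⟩)
      left_inv := by rintro ⟨_ | _, a⟩ <;> rfl
      right_inv := by rintro (a | a) <;> rfl }
    finSumFinEquiv

lemma embW_left_inl {a b : ℕ} (x : WB (Fin a) × WB (Fin b)) (i : Fin a) :
    (embW a b x).left (finSumFinEquiv (Sum.inl i)) = x.1.left i := by
  change Sum.elim x.1.left x.2.left (finSumFinEquiv.symm (finSumFinEquiv _)) = _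
  rw [Equiv.symm_apply_apply]
  rfl

lemma embW_left_inr {a b : ℕ} (x : WB (Fin a) × WB (Fin b)) (i : Fin b) :
    (embW a b x).left (finSumFinEquiv (Sum.inr i)) = x.2.left i := by
  change Sum.elim x.1.left x.2.left (finSumFinEquiv.symm (finSumFinEquiv _)) = _
  rw [Equiv.symm_apply_apply]
  rfl

lemma embW_right_inl {a b : ℕ} (x : WB (Fin a) × WB (Fin b)) (i : Fin a) :
    (embW a b x).right (finSumFinEquiv (Sum.inl i)) = finSumFinEquiv (Sum.inl (x.1.right i)) := by
  change finSumFinEquiv (Equiv.sumCongr _ _ (finSumFinEquiv.symm (finSumFinEquiv _))) = _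
  rw [Equiv.symm_apply_apply]
  rfl

lemma embW_right_inr {a b : ℕ} (x : WB (Fin a) × WB (Fin b)) (i : Fin b) :
    (embW a b x).right (finSumFinEquiv (Sum.inr i)) = finSumFinEquiv (Sum.inr (x.2.right i)) := by
  change finSumFinEquiv (Equiv.sumCongr _ _ (finSumFinEquiv.symm (finSumFinEquiv _))) = _
  rw [Equiv.symm_apply_apply]
  rfl

/-- Identifies the embedding of the two Weyl groups with a block embedding indexed by `Bool`, so
that the results on wreath products apply with `C = {±1}`. -/
lemma embW_eq_embA (l m : YoungDiagram) (x : ∀ b, WB (Fin (pairL l m b).card)) :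
    embW l.card m.card (x false, x true) = embA ℤˣ (eW l m) x := by
  refine SemidirectProduct.ext (funext fun a => ?_) (Equiv.ext fun a => ?_)
  · obtain ⟨⟨_ | _, b⟩, rfl⟩ := (eW l m).surjective a
    · exact (embW_left_inl _ _).trans (embA_left (eW l m) x false b).symm
    · exact (embW_left_inr _ _).trans (embA_left (eW l m) x true b).symm
  · obtain ⟨⟨_ | _, b⟩, rfl⟩ := (eW l m).surjective a
    · exact (embW_right_inl _ _).trans (embA_right (eW l m) x false b).symm
    · exact (embW_right_inr _ _).trans (embA_right (eW l m) x true b).symm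

lemma embW_injective (l m : YoungDiagram) : Function.Injective (embW l.card m.card) := by
  intro x y h
  let f (x : WB (Fin l.card) × WB (Fin m.card)) : ∀ b, WB (Fin (pairL l m b).card) :=
    fun b => match b with
    | false => x.1
    | true => x.2
  have h1 : f x = f y := embA_injective (eW l m) (by
    rw [← embW_eq_embA, ← embW_eq_embA]
    exact h)
  exact Prod.ext (congrFun h1 false) (congrFun h1 true)

lemma innerW_tmul {l m : YoungDiagram} (x : WB (Fin l.card) × WB (Fin m.card))
    (v : SpechtModule l) (w : SpechtModule m) : innerW l m x (v ⊗ₜ w) =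
      (specht l x.1.right v) ⊗ₜ ((sgnW _ x.2 : ℂ) • specht m x.2.right w) := rfl

lemma actsBy_innerW (l m : YoungDiagram) :
    ActsBy (embW l.card m.card) (innerW l m) (psiA thetaW (color (eW l m))) := by
  refine ⟨fun t => (SemidirectProduct.inl fun i => t (finSumFinEquiv (Sum.inl i)),
    SemidirectProduct.inl fun i => t (finSumFinEquiv (Sum.inr i))), fun t => ?_, fun t v => ?_⟩
  · refine SemidirectProduct.ext (funext fun a => ?_) (Equiv.ext fun a => ?_)
    · obtain ⟨a | a, rfl⟩ := finSumFinEquiv.surjective a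
      · exact embW_left_inl _ _
      · exact embW_left_inr _ _
    · obtain ⟨a | a, rfl⟩ := finSumFinEquiv.surjective a
      · exact embW_right_inl _ _
      · exact embW_right_inr _ _
  · have h : psiA thetaW (color (eW l m)) t
        = signChar (∏ i : Fin m.card, t (finSumFinEquiv (Sum.inr i))) := by
      rw [psiA_apply, ← Equiv.prod_comp (eW l m), Fintype.prod_sigma, Fintype.prod_bool,
        map_prod]
      simp only [color_apply]
      have h1 : ∀ x : ℤˣ, thetaW false x = 1 := fun _ => rfl
      simp only [h1, Finset.prod_const_one, mul_one]
      rfl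
    rw [h]
    induction v with
    | zero => simp
    | add x y hx hy => rw [map_add, hx, hy, smul_add]
    | tmul v w =>
      rw [innerW_tmul, ← TensorProduct.tmul_smul]
      simp only [SemidirectProduct.right_inl, map_one]
      rfl

/-- The little group argument for `{±1}^m`: the blocks with trivial and with sign character have
stabilizer `W_{|λ|} × W_{|μ|}`. -/
lemma isIrreducible_chiW (l m : YoungDiagram) : (chiW l m).IsIrreducible := by
  refine (actsBy_innerW l m).isIrreducible_ind (embW_injective l m) (fun h hh => ?_)
    (isIrreducible_extTensor
      (isIrreducible_comp SemidirectProduct.rightHom_surjective (isIrreducible_specht l))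
      (isIrreducible_twist _
        (isIrreducible_comp SemidirectProduct.rightHom_surjective (isIrreducible_specht m))))
  obtain ⟨x, rfl⟩ := hasStab_embA thetaW_bijective.1 (eW l m) h hh
  exact ⟨_, embW_eq_embA l m x⟩

lemma congr_embA {C : Type} [CommGroup C] {α α' I : Type} [Fintype α] [DecidableEq α]
    [Fintype α'] [DecidableEq α'] [Fintype I] [DecidableEq I] {β : I → Type}
    [∀ i, Fintype (β i)] [∀ i, DecidableEq (β i)]
    (e : (Σ i, β i) ≃ α) (f : α' ≃ α) (x : ∀ i, Wr C (β i)) :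
    Wr.congr f (embA C (e.trans f.symm) x) = embA C e x := by
  refine SemidirectProduct.ext (funext fun a => ?_) (Equiv.ext fun a => ?_)
  · change (x (e.symm (f (f.symm a))).1).left (e.symm (f (f.symm a))).2 = _
    rw [Equiv.apply_symm_apply]
    rfl
  · change f (f.symm (e (Equiv.sigmaCongrRight (fun i => (x i).right)
      (e.symm (f (f.symm a)))))) = _
    rw [Equiv.apply_symm_apply, Equiv.apply_symm_apply]
    rfl

/-- The tensor product of a family indexed by `Bool` as a tensor product of two spaces. -/
def boolTensor (l m : YoungDiagram) :
    (⨂[ℂ] b, SpechtModule (pairL l m b)) →ₗ[ℂ] SpechtModule l ⊗[ℂ] SpechtModule m :=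
  PiTensorProduct.lift (MultilinearMap.mk' (fun v => (v false : SpechtModule l) ⊗ₜ[ℂ]
      (v true : SpechtModule m))
    (fun v i x y => by
      cases i
      · exact TensorProduct.add_tmul (x : SpechtModule l) y (v true : SpechtModule m)
      · exact TensorProduct.tmul_add (v false : SpechtModule l) (x : SpechtModule m) y)
    (fun v i c x => by
      cases i
      · have h (x : SpechtModule l) (y : SpechtModule m) : (c • x) ⊗ₜ[ℂ] y = c • (x ⊗ₜ[ℂ] y) :=
          (TensorProduct.smul_tmul' _ _ _).symm
        exact h x _
      · have h (x : SpechtModule l) (y : SpechtModule m) : x ⊗ₜ[ℂ] (c • y) = c • (x ⊗ₜ[ℂ] y) :=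
          TensorProduct.tmul_smul _ _ _
        exact h _ x))

lemma boolTensor_tprod (l m : YoungDiagram) (v : ∀ b, SpechtModule (pairL l m b)) :
    boolTensor l m (PiTensorProduct.tprod ℂ v) =
      (v false : SpechtModule l) ⊗ₜ[ℂ] (v true : SpechtModule m) :=
  PiTensorProduct.lift.tprod _

lemma intw_boolTensor (l m : YoungDiagram) (x : ∀ b, WB (Fin (pairL l m b).card))
    (v : ⨂[ℂ] b, SpechtModule (pairL l m b)) :
    boolTensor l m (innerGen thetaW (fun b => specht (pairL l m b)) x v) =
      innerW l m (x false, x true) (boolTensor l m v) := by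
  have : boolTensor l m ∘ₗ innerGen thetaW (fun b => specht (pairL l m b)) x =
      innerW l m (x false, x true) ∘ₗ boolTensor l m := by
    ext v
    simp only [LinearMap.compMultilinearMap_apply, LinearMap.comp_apply, innerGen,
      piTensor_tprod, boolTensor_tprod]
    congr 1
    exact one_smul ℂ _
  exact LinearMap.congr_fun this v

lemma boolTensor_ne_zero (l m : YoungDiagram) : boolTensor l m ≠ 0 := by
  have := (isIrreducible_iff.1 (isIrreducible_specht l)).1
  have := (isIrreducible_iff.1 (isIrreducible_specht m)).1
  obtain ⟨ℓ, v, hv⟩ := exists_functional_ne_zero (V := SpechtModule l)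
  obtain ⟨ℓ', w, hw⟩ := exists_functional_ne_zero (V := SpechtModule m)
  intro h
  let u : ∀ b, SpechtModule (pairL l m b) := fun b => match b with
    | false => v
    | true => w
  have h1 : v ⊗ₜ[ℂ] w = 0 := by
    rw [← show _ = v ⊗ₜ[ℂ] w from boolTensor_tprod l m u, h, LinearMap.zero_apply]
  have h2 := congrArg (LinearMap.mul' ℂ ℂ ∘ₗ TensorProduct.map ℓ ℓ') h1
  simp [hv, hw] at h2

/-- Both sides are irreducible, so it is enough that `boolTensor` is equivariant and nonzero;
bijectivity need not be checked. Through this equivalence uniqueness and completeness of the `chiW`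
are read off from `genS`. -/
lemma nonempty_equiv_chiW {α : Type} [Fintype α] [DecidableEq α] {l m : YoungDiagram}
    (f : α ≃ Fin (l.card + m.card)) :
    Nonempty ((genS thetaW (pairL l m) ((eW l m).trans f.symm)).Equiv
      ((chiW l m).comp (Wr.congr f))) := by
  have hs : Function.Surjective (Wr.congr (C := ℤˣ) f) := by
    intro x
    refine ⟨Wr.congr f.symm x, ?_⟩
    refine SemidirectProduct.ext (funext fun a => ?_) (Equiv.ext fun a => ?_)
    · exact congrArg x.left (f.apply_symm_apply a)
    · change f (f.symm (x.right (f (f.symm a)))) = _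
      rw [Equiv.apply_symm_apply, Equiv.apply_symm_apply]
  refine Linked.nonempty_equiv ?_ (isIrreducible_genS thetaW_bijective.1 _ _)
    (isIrreducible_comp hs (isIrreducible_chiW l m))
  refine linked_ind ⟨IndV.mk (embW l.card m.card) (innerW l m) 1 ∘ₗ boolTensor l m,
    fun x v => ?_, fun h => boolTensor_ne_zero l m (LinearMap.ext fun v => ?_)⟩
  · change IndV.mk _ _ 1 (boolTensor l m _) =
      chiW l m (Wr.congr f (embA ℤˣ _ x)) (IndV.mk _ _ 1 (boolTensor l m v))
    rw [congr_embA, ← embW_eq_embA, intw_boolTensor]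
    exact intw_mk_one _ _ _ _
  · exact indV_mk_one_injective (embW_injective l m) _
      ((LinearMap.congr_fun h v).trans (map_zero _).symm)

lemma eq_of_linked_chiW {l m l' m' : YoungDiagram}
    (f : Fin (l.card + m.card) ≃ Fin (l'.card + m'.card))
    (h : Linked (chiW l m) ((chiW l' m').comp (Wr.congr f))) : l = l' ∧ m = m' := by
  have h1 := Linked.of_equiv (nonempty_equiv_chiW (Equiv.refl _)) h
  have h2 := h1.trans_equiv (nonempty_equiv_symm (nonempty_equiv_chiW f))
  have h3 := eq_of_linked_genS thetaW_bijective.1 h2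
  exact ⟨congrFun h3 false, congrFun h3 true⟩

lemma exists_linked_chiW {α : Type} [Fintype α] [DecidableEq α] {X : Type u} [AddCommGroup X]
    [Module ℂ X] (τ : Representation ℂ (WB α) X) [Nontrivial X] :
    ∃ l m : YoungDiagram, l.card + m.card = Fintype.card α ∧
      ∀ f : α ≃ Fin (l.card + m.card), Linked ((chiW l m).comp (Wr.congr f)) τ := by
  obtain ⟨L, hL, h⟩ := exists_linked_genS thetaW_bijective τ
  have hL' : L = pairL (L false) (L true) := by
    funext b
    cases b <;> rfl
  generalize L false = l at hL'
  generalize L true = m at hL'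
  subst hL'
  refine ⟨l, m, ?_, fun f => ?_⟩
  · rw [← hL, Fintype.sum_bool]
    exact add_comm _ _
  · exact Linked.of_equiv (nonempty_equiv_symm (nonempty_equiv_chiW f)) (h _)

lemma sgnW_congr {α α' : Type} [Fintype α] [Fintype α'] (f : α ≃ α') (x : WB α) :
    sgnW α' (Wr.congr f x) = sgnW α x := congrArg signChar (detHom_congr f x)

lemma signChar_mul_self : signChar * signChar = 1 := by
  ext x
  rcases Int.units_eq_one_or x with rfl | rfl <;> simp [signChar_neg_one]

/-- Multiplication by the sign exchanges the two characters of `{±1}`, hence the roles of the two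
partitions. -/
lemma linked_chiW_swap {l m : YoungDiagram} (f : Fin (m.card + l.card) ≃ Fin (l.card + m.card)) :
    Linked (chiW m l) ((twist (sgnW _) (chiW l m)).comp (Wr.congr f)) := by
  have h1 : Linked (genS (fun b => signChar * thetaW b) (pairL l m) ((eW l m).trans f.symm))
      (twist (sgnW _) (genS thetaW (pairL l m) ((eW l m).trans f.symm))) :=
    linked_genS_twist _ _ _ _
  have hinj : Function.Injective fun b => signChar * thetaW b :=
    fun a b h => thetaW_bijective.1 (mul_left_cancel h)
  have h2 : Linked (genS thetaW (pairL m l) (eW m l))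
      (genS (fun b => signChar * thetaW b) (pairL l m) ((eW l m).trans f.symm)) := by
    refine linked_genS_reindex Equiv.boolNot (fun b => ?_) (fun b => ?_) _ _
    · cases b
      · exact mul_one signChar
      · exact signChar_mul_self
    · cases b <;> rfl
  have h3 : Nonempty (((twist (sgnW _) (genS thetaW (pairL l m) ((eW l m).trans f.symm)))).Equiv
      ((twist (sgnW _) (chiW l m)).comp (Wr.congr f))) := by
    have h4 : (twist (sgnW _) (chiW l m)).comp (Wr.congr f)
        = twist (sgnW _) ((chiW l m).comp (Wr.congr f)) := by
      ext x : 1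
      exact congrArg (fun c : ℂˣ => (c : ℂ) • chiW l m (Wr.congr f x)) (sgnW_congr f x)
    rw [h4]
    exact nonempty_equiv_twist _ (nonempty_equiv_chiW f)
  have h5 : Nonempty ((chiW m l).Equiv (genS thetaW (pairL m l) (eW m l))) :=
    nonempty_equiv_symm (nonempty_equiv_chiW (Equiv.refl _))
  refine Linked.of_equiv h5 (Linked.trans_equiv ?_ h3)
  exact Linked.of_equiv (h2.nonempty_equiv (isIrreducible_genS thetaW_bijective.1 _ _)
    (isIrreducible_genS hinj _ _)) h1

open Representation (ind IndV)

/-! ## The groups of type `B` -/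

section Signed

variable {d : ℕ} [NeZero d] {α : Type} [Fintype α] [DecidableEq α]

lemma half_pos (hd : Even d) : 0 < d / 2 := by
  obtain ⟨k, rfl⟩ := hd
  have := NeZero.ne (k + k)
  omega

lemma torusChar_eq_psiA (c : α → ℕ) :
    (torusChar c : (α → Cd d) →* ℂˣ) = psiA (fun a => powChar d (c a)) id := rfl

lemma torusChar_signed (c : α → ℕ) (h : WB α) (t : α → Cd d) :
    torusChar c (signedAut _ _ h t) =
      ∏ b, powChar d (c (h.right b)) (t b) ^ ((h.left (h.right b) : ℤˣ) : ℤ) := by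
  refine (Equiv.prod_comp h.right _).symm.trans (Finset.prod_congr rfl fun b _ => ?_)
  change ((t (h.right.symm (h.right b)) ^ ((h.left (h.right b) : ℤˣ) : ℤ) : Cd d) : ℂˣ) ^ _
    = powChar d (c (h.right b)) (t b) ^ ((h.left (h.right b) : ℤˣ) : ℤ)
  rw [Equiv.symm_apply_apply, powChar_apply, ← zpow_natCast, ← zpow_natCast, zpow_comm]
  rfl

/-- Test tuples supported at one index reduce the comparison to single entries. -/
lemma torusChar_signed_eq_iff (c c' : α → ℕ) (h : WB α) :
    (∀ t : α → Cd d, torusChar c (signedAut _ _ h t) = torusChar c' t) ↔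
      ∀ b x, powChar d (c (h.right b)) x ^ ((h.left (h.right b) : ℤˣ) : ℤ)
        = powChar d (c' b) x := by
  constructor
  · intro H b x
    have := H (Pi.mulSingle b x)
    rw [torusChar_signed, torusChar_eq_psiA, psiA_mulSingle, Finset.prod_eq_single b] at this
    · rwa [Pi.mulSingle_eq_same] at this
    · intro b' _ hb'
      rw [Pi.mulSingle_eq_of_ne hb', map_one, one_zpow]
    · simp
  · intro H t
    rw [torusChar_signed]
    exact Finset.prod_congr rfl fun b _ => H b (t b)

lemma zpow_powChar_eq_iff (hd : Even d) {a b : ℕ} (ha : a ≤ d / 2) (hb : b ≤ d / 2) (s : ℤˣ) :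
    (∀ x, powChar d a x ^ (s : ℤ) = powChar d b x) ↔
      a = b ∧ (0 < a → a < d / 2 → s = 1) := by
  have hp := half_pos hd
  rcases Int.units_eq_one_or s with rfl | rfl
  · simp only [Units.val_one, zpow_one, implies_true, and_true]
    rw [← DFunLike.ext_iff, powChar_eq_iff, Nat.ModEq, Nat.mod_eq_of_lt (by omega),
      Nat.mod_eq_of_lt (by omega)]
  · have hne : (-1 : ℤˣ) ≠ 1 := by decide
    have hdvd : (∀ x, powChar d a x ^ (((-1 : ℤˣ)) : ℤ) = powChar d b x) ↔ d ∣ a + b := by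
      rw [← Nat.modEq_zero_iff_dvd, Nat.ModEq.comm, ← powChar_eq_iff,
        DFunLike.ext_iff]
      refine forall_congr' fun x => ?_
      simp only [Units.val_neg, Units.val_one, zpow_neg, zpow_one, powChar_apply, pow_zero]
      rw [inv_eq_iff_mul_eq_one, ← pow_add, eq_comm]
    rw [hdvd]
    simp only [hne]
    obtain ⟨k, rfl⟩ := hd
    have h2 : (k + k) / 2 = k := by omega
    rw [h2] at ha hb ⊢
    constructor
    · rintro ⟨m, hm⟩
      rcases m with _ | _ | m
      · omega
      · omega
      · have : (k + k) * (m + 1 + 1) ≥ (k + k) * 2 := Nat.mul_le_mul_left _ (by omega)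
        omega
    · rintro ⟨rfl, h⟩
      by_cases h0 : 0 < a
      · have : a = k := by
          by_contra hk
          exact h h0 (by omega)
        exact ⟨1, by omega⟩
      · exact ⟨0, by omega⟩

lemma torusChar_signed_iff (hd : Even d) {c c' : α → ℕ} (hc : ∀ a, c a ≤ d / 2)
    (hc' : ∀ a, c' a ≤ d / 2) (h : WB α) :
    (∀ t : α → Cd d, torusChar c (signedAut _ _ h t) = torusChar c' t) ↔
      ∀ b, c (h.right b) = c' b ∧
        (0 < c (h.right b) → c (h.right b) < d / 2 → h.left (h.right b) = 1) := by
  rw [torusChar_signed_eq_iff]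
  exact forall_congr' fun b => zpow_powChar_eq_iff hd (hc _) (hc' _) _

lemma exists_torusChar (ψ : (α → Cd d) →* ℂˣ) : ∃ c : α → ℕ, (∀ a, c a < d) ∧ ψ = torusChar c := by
  choose c hc hψ using fun a =>
    exists_powChar d (ψ.comp (MonoidHom.mulSingle (fun _ : α => Cd d) a))
  refine ⟨c, hc, MonoidHom.functions_ext _ _ _ fun a x => ?_⟩
  rw [torusChar_eq_psiA, psiA_mulSingle]
  exact DFunLike.congr_fun (hψ a) x

end Signed

/-! ### Block-diagonal subgroups of `C_d^α ⋊ W_α` and induction from them. -/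

section GenB

variable {d : ℕ} [NeZero d] {α : Type} [Fintype α] [DecidableEq α]
  {β₁ β₂ β₁' β₂' : Type} [Fintype β₁] [DecidableEq β₁] [Fintype β₂] [DecidableEq β₂]
  [Fintype β₁'] [DecidableEq β₁'] [Fintype β₂'] [DecidableEq β₂']
  {γ γ' : Fin (d / 2 - 1) → Type} [∀ i, Fintype (γ i)] [∀ i, DecidableEq (γ i)]
  [∀ i, Fintype (γ' i)] [∀ i, DecidableEq (γ' i)]
  {V₁ V₂ V₁' V₂' : Type*} [AddCommGroup V₁] [Module ℂ V₁] [AddCommGroup V₂] [Module ℂ V₂]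
  [AddCommGroup V₁'] [Module ℂ V₁'] [AddCommGroup V₂'] [Module ℂ V₂']
  {V V' : Fin (d / 2 - 1) → Type*} [∀ i, AddCommGroup (V i)] [∀ i, Module ℂ (V i)]
  [∀ i, AddCommGroup (V' i)] [∀ i, Module ℂ (V' i)]

/-- The product of the diagonal blocks. -/
abbrev BlocksB (d : ℕ) (β₁ β₂ : Type) (γ : Fin (d / 2 - 1) → Type) : Type :=
  (SWr (Cd d) β₁ × SWr (Cd d) β₂) × (∀ i, Wr (Cd d) (γ i))

/-- The disjoint union of the blocks. -/
abbrev SumB (d : ℕ) (β₁ β₂ : Type) (γ : Fin (d / 2 - 1) → Type) : Type :=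
  (β₁ ⊕ β₂) ⊕ (Σ i, γ i)

/-- The block diagonal inclusion before relabelling. -/
def baseB : BlocksB d β₁ β₂ γ →* SWr (Cd d) (SumB d β₁ β₂ γ) :=
  SWr.pair.comp (MonoidHom.prodMap SWr.pair (Wr.toSWr.comp Wr.blocks))

/-- The block diagonal inclusion. -/
def embB (e : SumB d β₁ β₂ γ ≃ α) : BlocksB d β₁ β₂ γ →* SWr (Cd d) α :=
  (SWr.congr e).comp baseB

/-- The exponent attached to a block. -/
def expS : SumB d β₁ β₂ γ → ℕ :=
  Sum.elim (Sum.elim (fun _ => 0) (fun _ => d / 2)) (fun c => (c.1 : ℕ) + 1)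

/-- The exponent attached to an index. -/
def expo (e : SumB d β₁ β₂ γ ≃ α) (a : α) : ℕ := expS (e.symm a)

lemma expo_apply (e : SumB d β₁ β₂ γ ≃ α) (x : SumB d β₁ β₂ γ) : expo e (e x) = expS x := by
  simp [expo]

lemma expo_le (e : SumB d β₁ β₂ γ ≃ α) (a : α) : expo e a ≤ d / 2 := by
  obtain ⟨x, rfl⟩ := e.surjective a
  rw [expo_apply]
  rcases x with (x | x) | ⟨i, x⟩
  · exact Nat.zero_le _
  · exact le_rfl
  · change (i : ℕ) + 1 ≤ _
    omega

lemma swr_congr_left {β : Type} (e : β ≃ α) (y : SWr (Cd d) β) (b : β) :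
    (SWr.congr e y).left (e b) = y.left b := congrArg y.left (e.symm_apply_apply b)

lemma swr_congr_sign {β : Type} (e : β ≃ α) (y : SWr (Cd d) β) (b : β) :
    (SWr.congr e y).right.left (e b) = y.right.left b :=
  congrArg y.right.left (e.symm_apply_apply b)

lemma swr_congr_perm {β : Type} (e : β ≃ α) (y : SWr (Cd d) β) (b : β) :
    (SWr.congr e y).right.right (e b) = e (y.right.right b) :=
  congrArg (fun b => e (y.right.right b)) (e.symm_apply_apply b)

lemma swr_ext {β : Type} {x y : SWr (Cd d) β} (h1 : ∀ b, x.left b = y.left b)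
    (h2 : ∀ b, x.right.left b = y.right.left b) (h3 : ∀ b, x.right.right b = y.right.right b) :
    x = y :=
  SemidirectProduct.ext (funext h1) (SemidirectProduct.ext (funext h2) (Equiv.ext h3))

lemma exists_equiv_of_maps {X X' : Type} {i : X → α} {i' : X' → α} (hi : Function.Injective i)
    (hi' : Function.Injective i') (π : Equiv.Perm α) (h : ∀ x, ∃ x', π (i x) = i' x')
    (h' : ∀ x', ∃ x, i' x' = π (i x)) : ∃ f : X ≃ X', ∀ x, π (i x) = i' (f x) := by
  choose f hf using h
  choose g hg using h'
  refine ⟨⟨f, g, fun x => ?_, fun x' => ?_⟩, hf⟩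
  · apply hi
    apply π.injective
    rw [← hg, hf]
  · apply hi'
    rw [← hf, ← hg]

/-- The exponents `0`, `d/2` and `1, …, d/2 - 1` are pairwise distinct, since `d/2 > 0`. So a
permutation matching exponents carries each block to the block of the same kind. -/
lemma exists_blocks_equivB (hd : Even d) (e : SumB d β₁ β₂ γ ≃ α) (e' : SumB d β₁' β₂' γ' ≃ α)
    (π : Equiv.Perm α) (h : ∀ a, expo e' (π a) = expo e a) :
    ∃ (f₁ : β₁ ≃ β₁') (f₂ : β₂ ≃ β₂') (f₃ : ∀ i, γ i ≃ γ' i),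
      (∀ b, π (e (Sum.inl (Sum.inl b))) = e' (Sum.inl (Sum.inl (f₁ b)))) ∧
      (∀ b, π (e (Sum.inl (Sum.inr b))) = e' (Sum.inl (Sum.inr (f₂ b)))) ∧
      ∀ i b, π (e (Sum.inr ⟨i, b⟩)) = e' (Sum.inr ⟨i, f₃ i b⟩) := by
  have hp := half_pos hd
  have hs : ∀ x, ∃ x', π (e x) = e' x' ∧ expS x' = expS x := fun x => by
    obtain ⟨x', hx'⟩ := e'.surjective (π (e x))
    refine ⟨x', hx'.symm, ?_⟩
    rw [← expo_apply e', hx', h, expo_apply]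
  have hs' : ∀ x', ∃ x, e' x' = π (e x) ∧ expS x' = expS x := fun x' => by
    obtain ⟨x, hx⟩ := e.surjective (π.symm (e' x'))
    have hx2 : e' x' = π (e x) := by rw [hx, Equiv.apply_symm_apply]
    refine ⟨x, hx2, ?_⟩
    rw [← expo_apply e', hx2, h, expo_apply]
  have h1 : ∃ f₁ : β₁ ≃ β₁', ∀ b, π (e (Sum.inl (Sum.inl b))) = e' (Sum.inl (Sum.inl (f₁ b))) := by
    refine exists_equiv_of_maps (i := fun b => e (Sum.inl (Sum.inl b)))
      (i' := fun b => e' (Sum.inl (Sum.inl b))) (fun b b' hb => by simpa using hb)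
      (fun b b' hb => by simpa using hb) π (fun b => ?_) fun b => ?_
    · obtain ⟨(x | x) | ⟨i, x⟩, hx, hx'⟩ := hs (Sum.inl (Sum.inl b))
      · exact ⟨x, hx⟩
      · exact absurd hx' (by simp only [expS, Sum.elim_inl, Sum.elim_inr]; omega)
      · exact absurd hx' (by simp only [expS, Sum.elim_inl, Sum.elim_inr]; omega)
    · obtain ⟨(x | x) | ⟨i, x⟩, hx, hx'⟩ := hs' (Sum.inl (Sum.inl b))
      · exact ⟨x, hx⟩
      · exact absurd hx' (by simp only [expS, Sum.elim_inl, Sum.elim_inr]; omega)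
      · exact absurd hx' (by simp only [expS, Sum.elim_inl, Sum.elim_inr]; omega)
  have h2 : ∃ f₂ : β₂ ≃ β₂', ∀ b, π (e (Sum.inl (Sum.inr b))) = e' (Sum.inl (Sum.inr (f₂ b))) := by
    refine exists_equiv_of_maps (i := fun b => e (Sum.inl (Sum.inr b)))
      (i' := fun b => e' (Sum.inl (Sum.inr b))) (fun b b' hb => by simpa using hb)
      (fun b b' hb => by simpa using hb) π (fun b => ?_) fun b => ?_
    · obtain ⟨(x | x) | ⟨i, x⟩, hx, hx'⟩ := hs (Sum.inl (Sum.inr b))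
      · exact absurd hx' (by simp only [expS, Sum.elim_inl, Sum.elim_inr]; omega)
      · exact ⟨x, hx⟩
      · exact absurd hx' (by simp only [expS, Sum.elim_inl, Sum.elim_inr]; omega)
    · obtain ⟨(x | x) | ⟨i, x⟩, hx, hx'⟩ := hs' (Sum.inl (Sum.inr b))
      · exact absurd hx' (by simp only [expS, Sum.elim_inl, Sum.elim_inr]; omega)
      · exact ⟨x, hx⟩
      · exact absurd hx' (by simp only [expS, Sum.elim_inl, Sum.elim_inr]; omega)
  have h3 : ∀ i, ∃ f : γ i ≃ γ' i, ∀ b, π (e (Sum.inr ⟨i, b⟩)) = e' (Sum.inr ⟨i, f b⟩) := by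
    intro i
    refine exists_equiv_of_maps (i := fun b => e (Sum.inr ⟨i, b⟩))
      (i' := fun b => e' (Sum.inr ⟨i, b⟩)) (fun b b' hb => by simpa using hb)
      (fun b b' hb => by simpa using hb) π (fun b => ?_) fun b => ?_
    · obtain ⟨(x | x) | ⟨j, x⟩, hx, hx'⟩ := hs (Sum.inr ⟨i, b⟩)
      · exact absurd hx' (by simp only [expS, Sum.elim_inl, Sum.elim_inr]; omega)
      · exact absurd hx' (by simp only [expS, Sum.elim_inl, Sum.elim_inr]; omega)
      · obtain rfl : j = i := Fin.ext (by simpa [expS] using hx')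
        exact ⟨x, hx⟩
    · obtain ⟨(x | x) | ⟨j, x⟩, hx, hx'⟩ := hs' (Sum.inr ⟨i, b⟩)
      · exact absurd hx' (by simp only [expS, Sum.elim_inl, Sum.elim_inr]; omega)
      · exact absurd hx' (by simp only [expS, Sum.elim_inl, Sum.elim_inr]; omega)
      · obtain rfl : i = j := Fin.ext (by simpa [expS] using hx')
        exact ⟨x, hx⟩
  choose f₃ h3 using h3
  obtain ⟨f₁, h1⟩ := h1
  obtain ⟨f₂, h2⟩ := h2
  exact ⟨f₁, f₂, f₃, h1, h2, h3⟩

lemma embB_injective (e : SumB d β₁ β₂ γ ≃ α) : Function.Injective (embB e) := by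
  intro x y h
  have hl : ∀ b, (baseB x).left b = (baseB y).left b := fun b => by
    rw [← swr_congr_left e, ← swr_congr_left e]
    exact congrFun (congrArg SemidirectProduct.left h) (e b)
  have hs : ∀ b, (baseB x).right.left b = (baseB y).right.left b := fun b => by
    rw [← swr_congr_sign e, ← swr_congr_sign e]
    exact congrFun (congrArg (fun z : SWr (Cd d) α => z.right.left) h) (e b)
  have hp : ∀ b, (baseB x).right.right b = (baseB y).right.right b := fun b => by
    apply e.injective
    rw [← swr_congr_perm e, ← swr_congr_perm e]
    exact DFunLike.congr_fun (congrArg (fun z : SWr (Cd d) α => z.right.right) h) (e b)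
  refine Prod.ext (Prod.ext ?_ ?_) (funext fun i => ?_)
  · exact swr_ext (fun b => hl (Sum.inl (Sum.inl b))) (fun b => hs (Sum.inl (Sum.inl b)))
      fun b => Sum.inl_injective (Sum.inl_injective (hp (Sum.inl (Sum.inl b))))
  · exact swr_ext (fun b => hl (Sum.inl (Sum.inr b))) (fun b => hs (Sum.inl (Sum.inr b)))
      fun b => Sum.inr_injective (Sum.inl_injective (hp (Sum.inl (Sum.inr b))))
  · refine SemidirectProduct.ext (funext fun b => hl (Sum.inr ⟨i, b⟩)) (Equiv.ext fun b => ?_)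
    have h1 := Sum.inr_injective (hp (Sum.inr ⟨i, b⟩))
    exact sigma_mk_injective h1

lemma mem_range_embB (hd : Even d) (e : SumB d β₁ β₂ γ ≃ α) (g : SWr (Cd d) α) :
    g ∈ Set.range (embB e) ↔ ∀ b, expo e (g.right.right b) = expo e b ∧
      (0 < expo e (g.right.right b) → expo e (g.right.right b) < d / 2 →
        g.right.left (g.right.right b) = 1) := by
  constructor
  · rintro ⟨x, rfl⟩ b
    obtain ⟨b, rfl⟩ := e.surjective b
    have h1 : (embB e x).right.right (e b) = e ((baseB x).right.right b) := swr_congr_perm _ _ _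
    rw [h1, expo_apply, expo_apply]
    have h2 : ∀ b, (embB e x).right.left (e b) = (baseB x).right.left b := swr_congr_sign _ _
    rw [h2]
    rcases b with (b | b) | ⟨i, b⟩
    · exact ⟨rfl, fun h => absurd h (lt_irrefl 0)⟩
    · exact ⟨rfl, fun _ h => absurd h (lt_irrefl (d / 2))⟩
    · exact ⟨rfl, fun _ _ => rfl⟩
  · intro h
    obtain ⟨f₁, f₂, f₃, h1, h2, h3⟩ := exists_blocks_equivB hd e e g.right.right fun a => (h a).1
    -- Tail exponents lie strictly between `0` and `d/2`, so the sign condition forces trivial signs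
    -- on these blocks.
    have hsign : ∀ i b, g.right.left (e (Sum.inr ⟨i, b⟩)) = 1 := fun i b => by
      have := (h (g.right.right.symm (e (Sum.inr ⟨i, b⟩)))).2
      rw [Equiv.apply_symm_apply, expo_apply] at this
      refine this (Nat.succ_pos _) ?_
      change (i : ℕ) + 1 < d / 2
      omega
    refine ⟨((⟨fun b => g.left (e (Sum.inl (Sum.inl b))),
      fun b => g.right.left (e (Sum.inl (Sum.inl b))), f₁⟩,
      ⟨fun b => g.left (e (Sum.inl (Sum.inr b))),
      fun b => g.right.left (e (Sum.inl (Sum.inr b))), f₂⟩),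
      fun i => ⟨fun b => g.left (e (Sum.inr ⟨i, b⟩)), f₃ i⟩), ?_⟩
    refine swr_ext (fun a => ?_) (fun a => ?_) fun a => ?_
    · obtain ⟨x, rfl⟩ := e.surjective a
      refine (swr_congr_left _ _ _).trans ?_
      rcases x with (x | x) | ⟨i, x⟩ <;> rfl
    · obtain ⟨x, rfl⟩ := e.surjective a
      refine (swr_congr_sign _ _ _).trans ?_
      rcases x with (x | x) | ⟨i, x⟩
      · rfl
      · rfl
      · exact (hsign i x).symm
    · obtain ⟨x, rfl⟩ := e.surjective a
      refine (swr_congr_perm _ _ _).trans ?_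
      rcases x with (x | x) | ⟨i, x⟩
      · exact (h1 x).symm
      · exact (h2 x).symm
      · exact (h3 i x).symm

lemma torusChar_embB (hd : Even d) (e : SumB d β₁ β₂ γ ≃ α) (g : SWr (Cd d) α) :
    g ∈ Set.range (embB e) ↔
      ∀ t : α → Cd d, torusChar (expo e) (signedAut _ _ g.right t) = torusChar (expo e) t := by
  rw [mem_range_embB hd, torusChar_signed_iff hd (expo_le e) (expo_le e)]

lemma hasStab_embB (hd : Even d) (e : SumB d β₁ β₂ γ ≃ α) : HasStab (embB e) (torusChar (expo e)) :=
  fun h hh => (torusChar_embB hd e h).2 hh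

/-- The tensor product of representations of the Weyl groups and symmetric groups of the blocks. -/
def outerB (σ₁ : Representation ℂ (WB β₁) V₁) (σ₂ : Representation ℂ (WB β₂) V₂)
    (S : ∀ i, Representation ℂ (Equiv.Perm (γ i)) (V i)) :
    Representation ℂ ((WB β₁ × WB β₂) × ∀ i, Equiv.Perm (γ i)) ((V₁ ⊗[ℂ] V₂) ⊗[ℂ] (⨂[ℂ] i, V i)) :=
  extTensor (extTensor σ₁ σ₂) (piTensor S)

/-- The representation of the product of the blocks that is to be induced. -/
def innerGenB (hd : Even d) (σ₁ : Representation ℂ (WB β₁) V₁)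
    (σ₂ : Representation ℂ (WB β₂) V₂) (S : ∀ i, Representation ℂ (Equiv.Perm (γ i)) (V i)) :
    Representation ℂ (BlocksB d β₁ β₂ γ) ((V₁ ⊗[ℂ] V₂) ⊗[ℂ] (⨂[ℂ] i, V i)) :=
  extTensor
    (extTensor (σ₁.comp SemidirectProduct.rightHom)
      (twist (charMinusOne d hd β₂) (σ₂.comp SemidirectProduct.rightHom)))
    (piTensor fun i => twist (charA d (γ i) ((i : ℕ) + 1)) ((S i).comp SemidirectProduct.rightHom))

/-- The projection of the product of the blocks to its quotient by the torus. -/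
def partR : BlocksB d β₁ β₂ γ →* (WB β₁ × WB β₂) × ∀ i, Equiv.Perm (γ i) where
  toFun x := ((x.1.1.right, x.1.2.right), fun i => (x.2 i).right)
  map_one' := rfl
  map_mul' _ _ := rfl

/-- As in `innerGen_apply`, the torus contributes one scalar. The first block contributes the factor
`1`, the second the character with exponent `d/2`, and the tail the type `A` formula. -/
lemma innerGenB_apply (hd : Even d) (σ₁ : Representation ℂ (WB β₁) V₁)
    (σ₂ : Representation ℂ (WB β₂) V₂) (S : ∀ i, Representation ℂ (Equiv.Perm (γ i)) (V i))
    (e : SumB d β₁ β₂ γ ≃ α) (x : BlocksB d β₁ β₂ γ) (v : (V₁ ⊗[ℂ] V₂) ⊗[ℂ] (⨂[ℂ] i, V i)) :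
    innerGenB hd σ₁ σ₂ S x v = (torusChar (expo e) (embB e x).left : ℂ) •
      outerB σ₁ σ₂ S (partR x) v := by
  have hc : torusChar (expo e) (embB e x).left = charMinusOne d hd β₂ x.1.2 *
      psiA (fun i : Fin (d / 2 - 1) => powChar d ((i : ℕ) + 1)) (color (Equiv.refl (Σ i, γ i)))
        (embA (Cd d) (Equiv.refl (Σ i, γ i)) x.2).left := by
    have h1 : torusChar (expo e) (embB e x).left =
        ∏ s : SumB d β₁ β₂ γ, ((baseB x).left s : ℂˣ) ^ expS s := by
      refine (Equiv.prod_comp e _).symm.trans (Finset.prod_congr rfl fun s _ => ?_)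
      rw [expo_apply]
      congr 2
      exact swr_congr_left _ _ _
    rw [h1, Fintype.prod_sum_type, Fintype.prod_sum_type]
    have h2 : ∏ b : β₁, ((baseB x).left (Sum.inl (Sum.inl b)) : ℂˣ) ^
        expS (d := d) (γ := γ) (β₂ := β₂) (Sum.inl (Sum.inl b)) = 1 :=
      Finset.prod_eq_one fun b _ => pow_zero _
    rw [h2, one_mul]
    rfl
  rw [hc]
  induction v with
  | zero => simp
  | add v w hv hw => rw [map_add, hv, hw, map_add, smul_add]
  | tmul v w =>
    have h3 : piTensor (fun i => twist (charA d (γ i) ((i : ℕ) + 1))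
          ((S i).comp SemidirectProduct.rightHom)) x.2 w = _ :=
      innerGen_apply (fun i : Fin (d / 2 - 1) => powChar d ((i : ℕ) + 1)) S
        (Equiv.refl (Σ i, γ i)) x.2 w
    have h4 : extTensor (σ₁.comp SemidirectProduct.rightHom)
        (twist (charMinusOne d hd β₂) (σ₂.comp SemidirectProduct.rightHom)) x.1 v
        = (charMinusOne d hd β₂ x.1.2 : ℂ) • extTensor σ₁ σ₂ (x.1.1.right, x.1.2.right) v := by
      induction v with
      | zero => simp
      | add v w hv hw => rw [map_add, hv, hw, map_add, smul_add]
      | tmul v w =>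
        rw [extTensor_tmul, extTensor_tmul, twist_apply, TensorProduct.tmul_smul]
        rfl
    change extTensor _ _ x (v ⊗ₜ w) = _ • extTensor _ _ (partR x) (v ⊗ₜ w)
    rw [extTensor_tmul, extTensor_tmul, h3, h4, TensorProduct.smul_tmul_smul, Units.val_mul]
    rfl

/-- The torus, as a subset of the product of the blocks. -/
def torB (e : SumB d β₁ β₂ γ ≃ α) (t : α → Cd d) : BlocksB d β₁ β₂ γ :=
  ((SemidirectProduct.inl fun b => t (e (Sum.inl (Sum.inl b))),
    SemidirectProduct.inl fun b => t (e (Sum.inl (Sum.inr b)))),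
    fun i => SemidirectProduct.inl fun b => t (e (Sum.inr ⟨i, b⟩)))

lemma embB_torB (e : SumB d β₁ β₂ γ ≃ α) (t : α → Cd d) :
    embB e (torB e t) = SemidirectProduct.inl t := by
  refine swr_ext (fun a => ?_) (fun a => ?_) fun a => ?_
  · obtain ⟨x, rfl⟩ := e.surjective a
    refine (swr_congr_left _ _ _).trans ?_
    rcases x with (x | x) | ⟨i, x⟩ <;> rfl
  · obtain ⟨x, rfl⟩ := e.surjective a
    refine (swr_congr_sign _ _ _).trans ?_
    rcases x with (x | x) | ⟨i, x⟩ <;> rfl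
  · obtain ⟨x, rfl⟩ := e.surjective a
    refine (swr_congr_perm _ _ _).trans ?_
    rcases x with (x | x) | ⟨i, x⟩ <;> rfl

lemma actsBy_innerGenB (hd : Even d) (σ₁ : Representation ℂ (WB β₁) V₁)
    (σ₂ : Representation ℂ (WB β₂) V₂) (S : ∀ i, Representation ℂ (Equiv.Perm (γ i)) (V i))
    (e : SumB d β₁ β₂ γ ≃ α) :
    ActsBy (embB e) (innerGenB hd σ₁ σ₂ S) (torusChar (expo e)) := by
  refine ⟨torB e, embB_torB e, fun t v => ?_⟩
  rw [innerGenB_apply hd σ₁ σ₂ S e, embB_torB]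
  have : partR (torB e t) = 1 := rfl
  rw [this, map_one]
  rfl

lemma isIrreducible_innerGenB (hd : Even d) {σ₁ : Representation ℂ (WB β₁) V₁}
    {σ₂ : Representation ℂ (WB β₂) V₂} {S : ∀ i, Representation ℂ (Equiv.Perm (γ i)) (V i)}
    (h₁ : σ₁.IsIrreducible) (h₂ : σ₂.IsIrreducible) (hS : ∀ i, (S i).IsIrreducible) :
    (innerGenB hd σ₁ σ₂ S).IsIrreducible :=
  isIrreducible_extTensor (isIrreducible_extTensor
    (isIrreducible_comp SemidirectProduct.rightHom_surjective h₁)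
    (isIrreducible_twist _ (isIrreducible_comp SemidirectProduct.rightHom_surjective h₂)))
    (isIrreducible_piTensor fun i => isIrreducible_twist _
      (isIrreducible_comp SemidirectProduct.rightHom_surjective (hS i)))

/-- The representation of `C_d ^ α ⋊ W_α` induced from the blocks. -/
def genB (hd : Even d) (e : SumB d β₁ β₂ γ ≃ α) (σ₁ : Representation ℂ (WB β₁) V₁)
    (σ₂ : Representation ℂ (WB β₂) V₂) (S : ∀ i, Representation ℂ (Equiv.Perm (γ i)) (V i)) :
    Representation ℂ (SWr (Cd d) α) (IndV (embB e) (innerGenB hd σ₁ σ₂ S)) :=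
  ind (embB e) (innerGenB hd σ₁ σ₂ S)

lemma isIrreducible_genB (hd : Even d) (e : SumB d β₁ β₂ γ ≃ α)
    {σ₁ : Representation ℂ (WB β₁) V₁}
    {σ₂ : Representation ℂ (WB β₂) V₂} {S : ∀ i, Representation ℂ (Equiv.Perm (γ i)) (V i)}
    (h₁ : σ₁.IsIrreducible) (h₂ : σ₂.IsIrreducible) (hS : ∀ i, (S i).IsIrreducible) :
    (genB hd e σ₁ σ₂ S).IsIrreducible :=
  (actsBy_innerGenB hd σ₁ σ₂ S e).isIrreducible_ind (embB_injective e) (hasStab_embB hd e)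
    (isIrreducible_innerGenB hd h₁ h₂ hS)

end GenB

open Representation (ind IndV)

/-! ### Independence of the labelling of the blocks, and recovery of the factors. -/

section CongrB

variable {d : ℕ} [NeZero d] {α : Type} [Fintype α] [DecidableEq α]
  {β₁ β₂ β₁' β₂' : Type} [Fintype β₁] [DecidableEq β₁] [Fintype β₂] [DecidableEq β₂]
  [Fintype β₁'] [DecidableEq β₁'] [Fintype β₂'] [DecidableEq β₂']
  {γ γ' : Fin (d / 2 - 1) → Type} [∀ i, Fintype (γ i)] [∀ i, DecidableEq (γ i)]
  [∀ i, Fintype (γ' i)] [∀ i, DecidableEq (γ' i)]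
  {V₁ V₂ V₁' V₂' : Type*} [AddCommGroup V₁] [Module ℂ V₁] [AddCommGroup V₂] [Module ℂ V₂]
  [AddCommGroup V₁'] [Module ℂ V₁'] [AddCommGroup V₂'] [Module ℂ V₂']
  {V V' : Fin (d / 2 - 1) → Type*} [∀ i, AddCommGroup (V i)] [∀ i, Module ℂ (V i)]
  [∀ i, AddCommGroup (V' i)] [∀ i, Module ℂ (V' i)]
  {σ₁ : Representation ℂ (WB β₁) V₁} {σ₂ : Representation ℂ (WB β₂) V₂}
  {S : ∀ i, Representation ℂ (Equiv.Perm (γ i)) (V i)}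
  {σ₁' : Representation ℂ (WB β₁') V₁'} {σ₂' : Representation ℂ (WB β₂') V₂'}
  {S' : ∀ i, Representation ℂ (Equiv.Perm (γ' i)) (V' i)}

/-- Relabelling inside the blocks. -/
def blockMapB (f₁ : β₁' ≃ β₁) (f₂ : β₂' ≃ β₂) (f₃ : ∀ i, γ' i ≃ γ i) :
    BlocksB d β₁' β₂' γ' →* BlocksB d β₁ β₂ γ where
  toFun x := ((SWr.congr f₁ x.1.1, SWr.congr f₂ x.1.2), fun i => Wr.congr (f₃ i) (x.2 i))
  map_one' := by
    refine Prod.ext (Prod.ext (map_one _) (map_one _)) (funext fun i => map_one _)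
  map_mul' x y :=
    Prod.ext (Prod.ext (map_mul (SWr.congr f₁) x.1.1 y.1.1) (map_mul (SWr.congr f₂) x.1.2 y.1.2))
      (funext fun i => map_mul (Wr.congr (f₃ i)) (x.2 i) (y.2 i))

/-- Relabelling of the disjoint union of the blocks. -/
def sumMapB (f₁ : β₁' ≃ β₁) (f₂ : β₂' ≃ β₂) (f₃ : ∀ i, γ' i ≃ γ i) :
    SumB d β₁' β₂' γ' ≃ SumB d β₁ β₂ γ :=
  Equiv.sumCongr (Equiv.sumCongr f₁ f₂) (Equiv.sigmaCongrRight f₃)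

lemma baseB_blockMapB (f₁ : β₁' ≃ β₁) (f₂ : β₂' ≃ β₂) (f₃ : ∀ i, γ' i ≃ γ i)
    (x : BlocksB d β₁' β₂' γ') :
    baseB (blockMapB f₁ f₂ f₃ x) = SWr.congr (sumMapB f₁ f₂ f₃) (baseB x) := by
  refine swr_ext (fun a => ?_) (fun a => ?_) fun a => ?_ <;>
  rcases a with (a | a) | ⟨i, a⟩ <;> rfl

/-- The conjugating element `y` is a pure permutation, without signs or torus part. -/
lemma embB_blockMapB (f₁ : β₁' ≃ β₁) (f₂ : β₂' ≃ β₂) (f₃ : ∀ i, γ' i ≃ γ i)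
    (e : SumB d β₁ β₂ γ ≃ α) (e' : SumB d β₁' β₂' γ' ≃ α) :
    ∃ y : SWr (Cd d) α, ∀ x, embB e (blockMapB f₁ f₂ f₃ x) * y = y * embB e' x := by
  let π : Equiv.Perm α := e'.symm.trans ((sumMapB f₁ f₂ f₃).trans e)
  refine ⟨SemidirectProduct.inr (SemidirectProduct.inr π), fun x => ?_⟩
  have h1 : embB e (blockMapB f₁ f₂ f₃ x) =
      SWr.congr ((sumMapB f₁ f₂ f₃).trans e) (baseB x) := by
    change SWr.congr e (baseB _) = _
    rw [baseB_blockMapB]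
    rfl
  have h2 : ∀ a, π.symm ((sumMapB f₁ f₂ f₃).trans e a) = e' a := fun a => by
    simp [π]
  have h3 : ∀ a, π (e' a) = (sumMapB f₁ f₂ f₃).trans e a := fun a => by
    simp [π]
  rw [h1]
  refine swr_ext (fun a => ?_) (fun a => ?_) fun a => ?_
  · obtain ⟨b, rfl⟩ := ((sumMapB f₁ f₂ f₃).trans e).surjective a
    rw [SemidirectProduct.mul_left, SemidirectProduct.mul_left, SemidirectProduct.left_inr,
      map_one, mul_one, one_mul]
    refine (swr_congr_left ((sumMapB f₁ f₂ f₃).trans e) (baseB x) b).trans (Eq.symm ?_)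
    change (embB e' x).left (π.symm ((sumMapB f₁ f₂ f₃).trans e b)) ^ (((1 : ℤˣ) : ℤ)) = _
    rw [h2, Units.val_one, zpow_one]
    exact swr_congr_left _ _ _
  · obtain ⟨b, rfl⟩ := ((sumMapB f₁ f₂ f₃).trans e).surjective a
    refine (mul_one _).trans ((swr_congr_sign ((sumMapB f₁ f₂ f₃).trans e) (baseB x) b).trans
      (Eq.symm ?_))
    refine (one_mul _).trans ?_
    change (embB e' x).right.left (π.symm ((sumMapB f₁ f₂ f₃).trans e b)) = _
    rw [h2]
    exact swr_congr_sign _ _ _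
  · obtain ⟨b, rfl⟩ := e'.surjective a
    change (SWr.congr ((sumMapB f₁ f₂ f₃).trans e) (baseB x)).right.right (π (e' b))
      = π ((SWr.congr e' (baseB x)).right.right (e' b))
    rw [h3, swr_congr_perm, swr_congr_perm, h3]

lemma charMinusOne_congr (hd : Even d) (f : β₂' ≃ β₂) (x : SWr (Cd d) β₂') :
    charMinusOne d hd β₂ (SWr.congr f x) = charMinusOne d hd β₂' x :=
  Equiv.prod_comp f.symm fun b => ((x.left b : Cd d) : ℂˣ) ^ (d / 2)

lemma charA_congr {β β' : Type} [Fintype β] [Fintype β'] (f : β' ≃ β) (k : ℕ)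
    (x : Wr (Cd d) β') : charA d β k (Wr.congr f x) = charA d β' k x :=
  congrArg (fun z : Cd d => (z : ℂˣ) ^ k) (detHom_congr f x)

lemma nonempty_equiv_twist_comp {G H V W : Type*} [Group G] [Group H] [AddCommGroup V]
    [Module ℂ V] [AddCommGroup W] [Module ℂ W] {ρ : Representation ℂ G V}
    {σ : Representation ℂ H W} {φ : G →* H} {c : G →* ℂˣ} {c' : H →* ℂˣ}
    (hc : ∀ g, c' (φ g) = c g) (h : Nonempty (ρ.Equiv (σ.comp φ))) :
    Nonempty ((twist c ρ).Equiv ((twist c' σ).comp φ)) := by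
  obtain ⟨F, hF⟩ := nonempty_equiv_iff.1 h
  refine nonempty_equiv_of_intw (e := F) fun g v => ?_
  change F ((c g : ℂ) • ρ g v) = (c' (φ g) : ℂ) • σ (φ g) (F v)
  rw [map_smul, hc]
  exact congrArg _ (hF g v)

lemma nonempty_equiv_comp {N G V W : Type*} [Group N] [Group G] [AddCommGroup V]
    [Module ℂ V] [AddCommGroup W] [Module ℂ W] {ρ : Representation ℂ G V}
    {σ : Representation ℂ G W} (φ : N →* G) (h : Nonempty (ρ.Equiv σ)) :
    Nonempty (Representation.Equiv (ρ.comp φ) (σ.comp φ)) := by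
  obtain ⟨F, hF⟩ := nonempty_equiv_iff.1 h
  exact nonempty_equiv_of_intw (e := F) fun g v => hF (φ g) v

lemma innerGenB_comp (hd : Even d) (f₁ : β₁' ≃ β₁) (f₂ : β₂' ≃ β₂) (f₃ : ∀ i, γ' i ≃ γ i) :
    (innerGenB hd σ₁ σ₂ S).comp (blockMapB f₁ f₂ f₃) =
    extTensor (extTensor
      ((σ₁.comp (SemidirectProduct.rightHom (φ := signedAut (Cd d) β₁))).comp (SWr.congr f₁))
      ((twist (charMinusOne d hd β₂) (σ₂.comp
        (SemidirectProduct.rightHom (φ := signedAut (Cd d) β₂)))).comp (SWr.congr f₂)))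
      (piTensor fun i => (twist (charA d (γ i) ((i : ℕ) + 1)) ((S i).comp
        (SemidirectProduct.rightHom (φ := permAut (Cd d) (γ i))))).comp (Wr.congr (f₃ i))) := rfl

lemma linked_genB_congr (hd : Even d) (f₁ : β₁' ≃ β₁) (f₂ : β₂' ≃ β₂) (f₃ : ∀ i, γ' i ≃ γ i)
    (e : SumB d β₁ β₂ γ ≃ α) (e' : SumB d β₁' β₂' γ' ≃ α)
    (hi₁ : σ₁'.IsIrreducible) (hi₂ : σ₂'.IsIrreducible) (hiS : ∀ i, (S' i).IsIrreducible)
    (h₁ : Nonempty (σ₁'.Equiv (σ₁.comp (Wr.congr f₁))))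
    (h₂ : Nonempty (σ₂'.Equiv (σ₂.comp (Wr.congr f₂))))
    (hS : ∀ i, Nonempty ((S' i).Equiv ((S i).comp (f₃ i).permCongrHom.toMonoidHom))) :
    Linked (genB hd e' σ₁' σ₂' S') (genB hd e σ₁ σ₂ S) := by
  obtain ⟨y, hy⟩ := embB_blockMapB f₁ f₂ f₃ e e'
  refine linked_ind_ind (embB_injective e) (blockMapB f₁ f₂ f₃) y hy ?_
  have := (isIrreducible_iff.1 (isIrreducible_innerGenB hd hi₁ hi₂ hiS)).1
  rw [innerGenB_comp]
  refine linked_of_equiv ?_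
  have k₁ : Nonempty (Representation.Equiv
      (σ₁'.comp (SemidirectProduct.rightHom (φ := signedAut (Cd d) β₁')))
      ((σ₁.comp (SemidirectProduct.rightHom (φ := signedAut (Cd d) β₁))).comp (SWr.congr f₁))) :=
    nonempty_equiv_comp SemidirectProduct.rightHom h₁
  have k₂ : Nonempty (Representation.Equiv
      (twist (charMinusOne d hd β₂')
        (σ₂'.comp (SemidirectProduct.rightHom (φ := signedAut (Cd d) β₂'))))
      ((twist (charMinusOne d hd β₂) (σ₂.comp
        (SemidirectProduct.rightHom (φ := signedAut (Cd d) β₂)))).comp (SWr.congr f₂))) :=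
    nonempty_equiv_twist_comp (charMinusOne_congr hd f₂)
      (nonempty_equiv_comp SemidirectProduct.rightHom h₂)
  have k₃ : ∀ i, Nonempty (Representation.Equiv
      (twist (charA d (γ' i) ((i : ℕ) + 1))
        ((S' i).comp (SemidirectProduct.rightHom (φ := permAut (Cd d) (γ' i)))))
      ((twist (charA d (γ i) ((i : ℕ) + 1)) ((S i).comp
        (SemidirectProduct.rightHom (φ := permAut (Cd d) (γ i))))).comp (Wr.congr (f₃ i)))) :=
    fun i => nonempty_equiv_twist_comp (charA_congr (f₃ i) _)
      (nonempty_equiv_comp SemidirectProduct.rightHom (hS i))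
  exact nonempty_equiv_extTensor (nonempty_equiv_extTensor k₁ k₂) (nonempty_equiv_piTensor k₃)

lemma wr_congr_symm {C β β' : Type} [CommGroup C] (f : β ≃ β') (x : Wr C β') :
    Wr.congr f (Wr.congr f.symm x) = x := by
  refine SemidirectProduct.ext (funext fun a => ?_) (Equiv.ext fun a => ?_)
  · exact congrArg x.left (f.apply_symm_apply a)
  · change f (f.symm (x.right (f (f.symm a)))) = _
    rw [Equiv.apply_symm_apply, Equiv.apply_symm_apply]

lemma wr_congr_surjective {C β β' : Type} [CommGroup C] (f : β ≃ β') :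
    Function.Surjective (Wr.congr (C := C) f) := fun x => ⟨_, wr_congr_symm f x⟩

/-- A signed permutation matches the two torus characters; its permutation part already preserves
exponents and identifies the blocks. After transport to common blocks, the little group comparison
and the tensor product lemmas separate the factors. -/
lemma exists_equiv_of_linked_genB (hd : Even d) {e : SumB d β₁ β₂ γ ≃ α}
    {e' : SumB d β₁' β₂' γ' ≃ α}
    (h₁ : σ₁.IsIrreducible) (h₂ : σ₂.IsIrreducible) (hS : ∀ i, (S i).IsIrreducible)
    (h₁' : σ₁'.IsIrreducible) (h₂' : σ₂'.IsIrreducible) (hS' : ∀ i, (S' i).IsIrreducible)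
    (h : Linked (genB hd e σ₁ σ₂ S) (genB hd e' σ₁' σ₂' S')) :
    ∃ (f₁ : β₁ ≃ β₁') (f₂ : β₂ ≃ β₂') (f₃ : ∀ i, γ i ≃ γ' i),
      Linked σ₁ (σ₁'.comp (Wr.congr f₁)) ∧ Linked σ₂ (σ₂'.comp (Wr.congr f₂)) ∧
      ∀ i, Linked (S i) ((S' i).comp (f₃ i).permCongrHom.toMonoidHom) := by
  obtain ⟨w, hw⟩ := (actsBy_innerGenB hd σ₁ σ₂ S e).exists_conj
    (actsBy_innerGenB hd σ₁' σ₂' S' e') h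
  have hw' := (torusChar_signed_iff hd (expo_le e') (expo_le e) w).1 hw
  obtain ⟨f₁, f₂, f₃, -⟩ := exists_blocks_equivB hd e e' w.right fun a => (hw' a).1
  refine ⟨f₁, f₂, f₃, ?_⟩
  have k₁ : Representation.IsIrreducible (σ₁'.comp (Wr.congr f₁)) :=
    isIrreducible_comp (wr_congr_surjective f₁) h₁'
  have k₂ : Representation.IsIrreducible (σ₂'.comp (Wr.congr f₂)) :=
    isIrreducible_comp (wr_congr_surjective f₂) h₂'
  have k₃ : ∀ i, Representation.IsIrreducible ((S' i).comp (f₃ i).permCongrHom.toMonoidHom) :=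
    fun i => isIrreducible_comp (f₃ i).permCongrHom.surjective (hS' i)
  have h3 : Linked (genB hd e' σ₁' σ₂' S') (genB hd e (σ₁'.comp (Wr.congr f₁))
      (σ₂'.comp (Wr.congr f₂)) fun i => (S' i).comp (f₃ i).permCongrHom.toMonoidHom) := by
    refine linked_genB_congr hd f₁.symm f₂.symm (fun i => (f₃ i).symm) e e' h₁' h₂' hS' ?_ ?_
      fun i => ?_
    · exact nonempty_equiv_of_intw (e := LinearEquiv.refl ℂ _) fun g v =>
        congrArg (fun g => σ₁' g v) (wr_congr_symm f₁ g).symm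
    · exact nonempty_equiv_of_intw (e := LinearEquiv.refl ℂ _) fun g v =>
        congrArg (fun g => σ₂' g v) (wr_congr_symm f₂ g).symm
    · refine nonempty_equiv_of_intw (e := LinearEquiv.refl ℂ _) fun g v =>
        congrArg (fun g => S' i g v) (Equiv.ext fun a => ?_)
      change g a = f₃ i ((f₃ i).symm (g (f₃ i ((f₃ i).symm a))))
      rw [Equiv.apply_symm_apply, Equiv.apply_symm_apply]
  have h4 := (actsBy_innerGenB hd σ₁ σ₂ S e).linked (embB_injective e)
    (actsBy_innerGenB hd _ _ _ e) (hasStab_embB hd e)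
    (h.trans_equiv (h3.nonempty_equiv (isIrreducible_genB hd e' h₁' h₂' hS')
      (isIrreducible_genB hd e k₁ k₂ k₃)))
  have c₁ : Representation.IsIrreducible
      (σ₁.comp (SemidirectProduct.rightHom (φ := signedAut (Cd d) β₁))) :=
    isIrreducible_comp SemidirectProduct.rightHom_surjective h₁
  have c₂ : Representation.IsIrreducible (twist (charMinusOne d hd β₂)
      (σ₂.comp (SemidirectProduct.rightHom (φ := signedAut (Cd d) β₂)))) :=
    isIrreducible_twist _ (isIrreducible_comp SemidirectProduct.rightHom_surjective h₂)
  have c₃ : ∀ i, Representation.IsIrreducible (twist (charA d (γ i) ((i : ℕ) + 1))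
      ((S i).comp (SemidirectProduct.rightHom (φ := permAut (Cd d) (γ i))))) := fun i =>
    isIrreducible_twist _ (isIrreducible_comp SemidirectProduct.rightHom_surjective (hS i))
  obtain ⟨h5, h6⟩ := Linked.extTensor (isIrreducible_extTensor c₁ c₂)
    (isIrreducible_piTensor c₃) h4
  obtain ⟨h7, h8⟩ := Linked.extTensor c₁ c₂ h5
  refine ⟨Linked.of_comp SemidirectProduct.rightHom_surjective h7, ?_, fun i => ?_⟩
  · obtain ⟨F, hF, h0⟩ := h8
    refine ⟨F, fun g v => ?_, h0⟩
    have h9 := (Intw.of_twist _ hF) (SemidirectProduct.inr g) v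
    exact h9
  · obtain ⟨F, hF, h0⟩ := Linked.piTensor c₃ h6 i
    refine ⟨F, fun g v => ?_, h0⟩
    have h9 := (Intw.of_twist _ hF) (SemidirectProduct.inr g) v
    exact h9

end CongrB

open Representation (ind IndV)

lemma covers_extTensor {G H : Type*} [Group G] [Group H] [Finite G] [Finite H] {J K : Type*}
    {V : J → Type*} {W : K → Type*}
    [∀ j, AddCommGroup (V j)] [∀ j, Module ℂ (V j)] [∀ j, AddCommGroup (W j)]
    [∀ j, Module ℂ (W j)] {ρ : ∀ j, Representation ℂ G (V j)} {σ : ∀ j, Representation ℂ H (W j)}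
    (hirr : ∀ j, (ρ j).IsIrreducible) (hcov : Covers.{u} ρ) (hcov' : Covers.{u} σ) :
    Covers.{u} fun p : J × K => extTensor (ρ p.1) (σ p.2) := by
  intro X _ _ τ hX
  obtain ⟨j, k, h⟩ := exists_linked_extTensor hirr hcov hcov' τ
  exact ⟨(j, k), h⟩

lemma covers_piTensor {ι : Type} [Fintype ι] [DecidableEq ι] {G : ι → Type} [∀ i, Group (G i)]
    [∀ i, Finite (G i)] {J : ι → Type*} {V : ∀ i, J i → Type*}
    [∀ i j, AddCommGroup (V i j)] [∀ i j, Module ℂ (V i j)]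
    {ρ : ∀ i (j : J i), Representation ℂ (G i) (V i j)}
    (hirr : ∀ i j, (ρ i j).IsIrreducible) (hcov : ∀ i, Covers.{0} (ρ i)) :
    Covers.{u} fun j : ∀ i, J i => piTensor fun i => ρ i (j i) := by
  intro X _ _ τ hX
  exact exists_linked_piTensor hirr hcov τ

/-! ### Twisting by the sign character. -/

section TwistB

variable {d : ℕ} [NeZero d] {α : Type} [Fintype α] [DecidableEq α]
  {β₁ β₂ : Type} [Fintype β₁] [DecidableEq β₁] [Fintype β₂] [DecidableEq β₂]
  {γ : Fin (d / 2 - 1) → Type} [∀ i, Fintype (γ i)] [∀ i, DecidableEq (γ i)]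
  {V₁ V₂ : Type*} [AddCommGroup V₁] [Module ℂ V₁] [AddCommGroup V₂] [Module ℂ V₂]
  {V : Fin (d / 2 - 1) → Type*} [∀ i, AddCommGroup (V i)] [∀ i, Module ℂ (V i)]
  {σ₁ : Representation ℂ (WB β₁) V₁} {σ₂ : Representation ℂ (WB β₂) V₂}
  {S : ∀ i, Representation ℂ (Equiv.Perm (γ i)) (V i)}

/-- The character of `C_d ^ α ⋊ W_α` counting signs. -/
def epsChar (d : ℕ) (α : Type) [Fintype α] : SWr (Cd d) α →* ℂˣ :=
  (signChar.comp (detHom ℤˣ α)).comp SemidirectProduct.rightHom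

/-- Tail blocks embed with trivial signs, so only the first two blocks contribute. -/
lemma epsChar_embB (e : SumB d β₁ β₂ γ ≃ α) (x : BlocksB d β₁ β₂ γ) :
    epsChar d α (embB e x) = sgnW β₁ x.1.1.right * sgnW β₂ x.1.2.right := by
  have h : detHom ℤˣ α (embB e x).right = detHom ℤˣ β₁ x.1.1.right * detHom ℤˣ β₂ x.1.2.right := by
    refine (Equiv.prod_comp e _).symm.trans ?_
    have h1 : ∀ s, (embB e x).right.left (e s) = (baseB x).right.left s := swr_congr_sign e _
    simp only [h1]
    rw [Fintype.prod_sum_type, Fintype.prod_sum_type]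
    have h2 : ∏ c : Σ i, γ i, (baseB x).right.left (Sum.inr c) = 1 :=
      Finset.prod_eq_one fun c _ => rfl
    rw [h2, mul_one]
    rfl
  change signChar (detHom ℤˣ α (embB e x).right) = _
  rw [h, map_mul]
  rfl

lemma twist_innerGenB (hd : Even d) (e : SumB d β₁ β₂ γ ≃ α) :
    twist ((epsChar d α).comp (embB e)) (innerGenB hd σ₁ σ₂ S) =
      innerGenB hd (twist (sgnW β₁) σ₁) (twist (sgnW β₂) σ₂) S := by
  ext x : 1
  refine LinearMap.ext fun v => ?_
  rw [twist_apply, innerGenB_apply hd _ _ _ e, innerGenB_apply hd _ _ _ e, smul_comm]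
  congr 1
  rw [MonoidHom.comp_apply, epsChar_embB]
  induction v with
  | zero => simp
  | add v w hv hw => rw [map_add, map_add, smul_add, hv, hw]
  | tmul v w =>
    induction v with
    | zero => simp
    | add v w hv hw => rw [TensorProduct.add_tmul, map_add, map_add, smul_add, hv, hw]
    | tmul v₁ v₂ =>
      change _ • ((σ₁ x.1.1.right v₁ ⊗ₜ σ₂ x.1.2.right v₂) ⊗ₜ _) =
        (((sgnW β₁ x.1.1.right : ℂ) • σ₁ x.1.1.right v₁) ⊗ₜ
          ((sgnW β₂ x.1.2.right : ℂ) • σ₂ x.1.2.right v₂)) ⊗ₜ _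
      rw [TensorProduct.smul_tmul_smul, TensorProduct.smul_tmul', Units.val_mul]

lemma linked_twist_genB (hd : Even d) (e : SumB d β₁ β₂ γ ≃ α)
    (h₁ : σ₁.IsIrreducible) (h₂ : σ₂.IsIrreducible) (hS : ∀ i, (S i).IsIrreducible) :
    Linked (genB hd e (twist (sgnW β₁) σ₁) (twist (sgnW β₂) σ₂) S)
      (twist (epsChar d α) (genB hd e σ₁ σ₂ S)) := by
  unfold genB
  rw [← twist_innerGenB hd e]
  have := (isIrreducible_iff.1 (isIrreducible_innerGenB hd h₁ h₂ hS)).1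
  exact linked_twist_ind (embB_injective e) _

end TwistB

/-! ### Irreducibility, uniqueness and twists in types `B` and `C`. -/

section TypeB

variable {d n : ℕ} [NeZero d]

lemma chiB_eq_genB (hd : Even d) (Λ : R d n) : chiB hd Λ =
    genB hd Λ.blockEquiv (chiW Λ.lam1 Λ.mu1) (chiW Λ.lam2 Λ.mu2) fun i => specht (Λ.tail i) := rfl

lemma embB_blockEquiv_injective (Λ : R d n) : Function.Injective Λ.emb :=
  embB_injective Λ.blockEquiv

lemma range_embB (hd : Even d) (Λ : R d n) : Set.range Λ.emb = {g : SB d n |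
    ∀ t : Fin n → Cd d, torusChar Λ.psi (signedAut _ _ g.right⁻¹ t) = torusChar Λ.psi t} := by
  ext g
  have h1 : g ∈ Set.range Λ.emb ↔ ∀ t : Fin n → Cd d,
      torusChar Λ.psi (signedAut _ _ g.right t) = torusChar Λ.psi t :=
    torusChar_embB hd Λ.blockEquiv g
  rw [h1, Set.mem_ofPred_eq]
  constructor
  · intro h t
    rw [← h (signedAut _ _ g.right⁻¹ t), ← MulAut.mul_apply, ← map_mul, mul_inv_cancel, map_one]
    rfl
  · intro h t
    rw [← h (signedAut _ _ g.right t), ← MulAut.mul_apply, ← map_mul, inv_mul_cancel, map_one]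
    rfl

lemma isIrreducible_chiB (hd : Even d) (Λ : R d n) : (chiB hd Λ).IsIrreducible :=
  isIrreducible_genB (S := fun i => specht (Λ.tail i)) hd Λ.blockEquiv (isIrreducible_chiW _ _)
    (isIrreducible_chiW _ _) fun i => isIrreducible_specht (Λ.tail i)

lemma eq_of_linked_chiB (hd : Even d) {Λ Λ' : R d n} (h : Linked (chiB hd Λ) (chiB hd Λ')) :
    Λ = Λ' := by
  rw [chiB_eq_genB, chiB_eq_genB] at h
  obtain ⟨f₁, f₂, f₃, h1, h2, h3⟩ := exists_equiv_of_linked_genB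
    (S := fun i => specht (Λ.tail i)) (S' := fun i => specht (Λ'.tail i)) hd
    (isIrreducible_chiW _ _) (isIrreducible_chiW _ _) (fun i => isIrreducible_specht (Λ.tail i))
    (isIrreducible_chiW _ _) (isIrreducible_chiW _ _) (fun i => isIrreducible_specht (Λ'.tail i)) h
  obtain ⟨h1, h1'⟩ := eq_of_linked_chiW f₁ h1
  obtain ⟨h2, h2'⟩ := eq_of_linked_chiW f₂ h2
  exact R.ext h1 h1' h2 h2' (funext fun i => eq_of_linked_specht (f₃ i) (h3 i))

/-- The sign character restricts to the signs of the first two blocks, where it swaps the two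
partitions of each pair; the tail is unaffected. -/
lemma nonempty_equiv_twist_chiB (hd : Even d) (Λ : R d n) :
    Nonempty ((twist (epsCharB d n) (chiB hd Λ)).Equiv (chiB hd Λ.swap)) := by
  have h0 : epsCharB d n = epsChar d (Fin n) := rfl
  rw [h0, chiB_eq_genB]
  refine nonempty_equiv_symm (Linked.nonempty_equiv ?_ (isIrreducible_chiB hd _)
    (isIrreducible_twist _ (isIrreducible_chiB hd Λ)))
  have h1 := linked_twist_genB (S := fun i => specht (Λ.tail i)) hd Λ.blockEquiv
    (isIrreducible_chiW Λ.lam1 Λ.mu1) (isIrreducible_chiW Λ.lam2 Λ.mu2)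
    fun i => isIrreducible_specht (Λ.tail i)
  let f (l m : YoungDiagram) : Fin (m.card + l.card) ≃ Fin (l.card + m.card) :=
    finCongr (add_comm _ _)
  have hi (l m : YoungDiagram) : (twist (sgnW _) (chiW l m)).IsIrreducible :=
    isIrreducible_twist _ (isIrreducible_chiW l m)
  have hf (l m : YoungDiagram) :
      Nonempty ((chiW m l).Equiv ((twist (sgnW _) (chiW l m)).comp (Wr.congr (f l m)))) :=
    (linked_chiW_swap (f l m)).nonempty_equiv (isIrreducible_chiW _ _)
      (isIrreducible_comp (wr_congr_surjective _) (hi l m))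
  have h2 : Linked (chiB hd Λ.swap) (genB hd Λ.blockEquiv (twist (sgnW _) (chiW Λ.lam1 Λ.mu1))
      (twist (sgnW _) (chiW Λ.lam2 Λ.mu2)) fun i => specht (Λ.tail i)) := by
    rw [chiB_eq_genB]
    exact linked_genB_congr (S := fun i => specht (Λ.tail i)) (S' := fun i => specht (Λ.tail i))
      (γ := fun i => Fin (Λ.tail i).card) (γ' := fun i => Fin (Λ.tail i).card)
      hd (f _ _) (f _ _) (fun _ => Equiv.refl _) Λ.blockEquiv Λ.swap.blockEquiv
      (isIrreducible_chiW _ _) (isIrreducible_chiW _ _) (fun i => isIrreducible_specht (Λ.tail i))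
      (hf _ _) (hf _ _) fun i => nonempty_equiv_of_intw (e := LinearEquiv.refl ℂ _) fun g v => rfl
  exact Linked.of_equiv (h2.nonempty_equiv (isIrreducible_chiB hd _)
    (isIrreducible_genB (S := fun i => specht (Λ.tail i)) hd Λ.blockEquiv (hi _ _) (hi _ _)
      fun i => isIrreducible_specht (Λ.tail i))) h1

end TypeB

/-! ### Completeness -/

section CompleteB

variable {d : ℕ} [NeZero d] {α : Type} [Fintype α] [DecidableEq α]

/-- Inverting the entries whose exponent exceeds `d/2` replaces that exponent `k` by `d - k`. A
group element carrying out these inversions moves one eigenspace to the other. -/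
lemma exists_eigen_small {X : Type*} [AddCommGroup X] [Module ℂ X]
    (τ : Representation ℂ (SWr (Cd d) α) X) [Nontrivial X] :
    ∃ c : α → ℕ, (∀ a, c a ≤ d / 2) ∧ eigen τ (torusChar c) ≠ ⊥ := by
  obtain ⟨ψ, hψ⟩ := exists_eigen_ne_bot τ
  obtain ⟨k, hk, rfl⟩ := exists_torusChar ψ
  obtain ⟨x, hx, hx0⟩ := Submodule.exists_mem_ne_zero_of_ne_bot hψ
  let c : α → ℕ := fun a => if k a ≤ d / 2 then k a else d - k a
  let s : α → ℤˣ := fun a => if k a ≤ d / 2 then 1 else -1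
  let w : SWr (Cd d) α := SemidirectProduct.inr (SemidirectProduct.inl s)
  have hw : ∀ t : α → Cd d, torusChar k (signedAut _ _ w.right t) = torusChar c t := by
    rw [torusChar_signed_eq_iff]
    intro b x
    change powChar d (k b) x ^ ((s b : ℤˣ) : ℤ) = powChar d (c b) x
    by_cases h : k b ≤ d / 2
    · simp only [s, c, if_pos h, Units.val_one, zpow_one]
    · simp only [s, c, if_neg h, Units.val_neg, Units.val_one, zpow_neg, zpow_one, powChar_apply]
      rw [inv_eq_iff_mul_eq_one, ← pow_add, Nat.add_sub_cancel' (hk b).le]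
      exact (mem_rootsOfUnity _ _).1 x.2
  refine ⟨c, fun a => ?_, fun h => hx0 ?_⟩
  · have := hk a
    simp only [c]
    split_ifs <;> omega
  · have h1 := apply_mem_eigen hx w hw
    rw [h, Submodule.mem_bot] at h1
    rw [← rep_apply_inv τ w x, h1, map_zero]

/-- The indices sorted by exponents. -/
def fiberB (hd : Even d) (c : α → ℕ) (hc : ∀ a, c a ≤ d / 2) :
    SumB d {a // c a = 0} {a // c a = d / 2} (fun i => {a // c a = (i : ℕ) + 1}) ≃ α :=
  Equiv.ofBijective (Sum.elim (Sum.elim Subtype.val Subtype.val) fun p => p.2.1) <| by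
    have hp := half_pos hd
    constructor
    · rintro ((⟨a, ha⟩ | ⟨a, ha⟩) | ⟨i, a, ha⟩) ((⟨b, hb⟩ | ⟨b, hb⟩) | ⟨j, b, hb⟩) h
      all_goals
        simp only [Sum.elim_inl, Sum.elim_inr] at h
        subst h
      · rfl
      · omega
      · omega
      · omega
      · rfl
      · omega
      · omega
      · omega
      · obtain rfl : i = j := Fin.ext (by omega)
        rfl
    · intro a
      have := hc a
      by_cases h0 : c a = 0
      · exact ⟨Sum.inl (Sum.inl ⟨a, h0⟩), rfl⟩
      · by_cases h1 : c a = d / 2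
        · exact ⟨Sum.inl (Sum.inr ⟨a, h1⟩), rfl⟩
        · exact ⟨Sum.inr ⟨⟨c a - 1, by omega⟩, a, by simp only; omega⟩, rfl⟩

lemma expo_fiberB (hd : Even d) (c : α → ℕ) (hc : ∀ a, c a ≤ d / 2) :
    expo (fiberB hd c hc) = c := by
  funext a
  obtain ⟨x, rfl⟩ := (fiberB hd c hc).surjective a
  rw [expo_apply]
  rcases x with (x | x) | ⟨i, x⟩
  · exact x.2.symm
  · exact x.2.symm
  · exact x.2.symm

/-! ### Torus eigenspaces as representations of the blocks. -/

section Eigen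

variable {β₁ β₂ : Type} [Fintype β₁] [DecidableEq β₁] [Fintype β₂] [DecidableEq β₂]
  {γ : Fin (d / 2 - 1) → Type} [∀ i, Fintype (γ i)] [∀ i, DecidableEq (γ i)]

/-- The section of the projection `partR`. -/
def sectR : ((WB β₁ × WB β₂) × ∀ i, Equiv.Perm (γ i)) →* BlocksB d β₁ β₂ γ where
  toFun x := ((SemidirectProduct.inr x.1.1, SemidirectProduct.inr x.1.2),
    fun i => SemidirectProduct.inr (x.2 i))
  map_one' := Prod.ext (Prod.ext (map_one _) (map_one _)) (funext fun _ => map_one _)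
  map_mul' _ _ := Prod.ext (Prod.ext (map_mul _ _ _) (map_mul _ _ _))
    (funext fun _ => map_mul _ _ _)

lemma torB_mul_sectR (e : SumB d β₁ β₂ γ ≃ α) (x : BlocksB d β₁ β₂ γ) :
    torB e (embB e x).left * sectR (partR x) = x := by
  have h1 : ∀ s, (embB e x).left (e s) = (baseB x).left s := swr_congr_left e _
  refine Prod.ext (Prod.ext ?_ ?_) (funext fun i => ?_)
  · change SemidirectProduct.inl (fun b => (embB e x).left (e (Sum.inl (Sum.inl b)))) *
      SemidirectProduct.inr x.1.1.right = x.1.1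
    simp only [h1]
    exact SemidirectProduct.inl_left_mul_inr_right _
  · change SemidirectProduct.inl (fun b => (embB e x).left (e (Sum.inl (Sum.inr b)))) *
      SemidirectProduct.inr x.1.2.right = x.1.2
    simp only [h1]
    exact SemidirectProduct.inl_left_mul_inr_right _
  · change (SemidirectProduct.inl (fun b => (embB e x).left (e (Sum.inr ⟨i, b⟩))) *
      SemidirectProduct.inr (x.2 i).right : Wr (Cd d) (γ i)) = x.2 i
    simp only [h1]
    exact SemidirectProduct.inl_left_mul_inr_right (x.2 i)

/-- The representation `χ_{λ, μ}` of the Weyl group of a set with `|λ| + |μ|` elements. -/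
def chiWOn (β : Type) (p : Σ p : YoungDiagram × YoungDiagram, β ≃ Fin (p.1.card + p.2.card)) :
    Representation ℂ (WB β) (VW p.1.1 p.1.2) :=
  (chiW p.1.1 p.1.2).comp (Wr.congr p.2)

lemma isIrreducible_chiWOn (β : Type)
    (p : Σ p : YoungDiagram × YoungDiagram, β ≃ Fin (p.1.card + p.2.card)) :
    (chiWOn β p).IsIrreducible :=
  isIrreducible_comp (wr_congr_surjective _) (isIrreducible_chiW _ _)

lemma covers_chiWOn (β : Type) [Fintype β] [DecidableEq β] : Covers.{u} (chiWOn β) := by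
  intro X _ _ σ hX
  obtain ⟨l, m, hlm, h⟩ := exists_linked_chiW σ
  exact ⟨⟨(l, m), Fintype.equivOfCardEq (by simp [hlm])⟩, h _⟩

lemma covers_piTensor_spechtRep : Covers.{u}
    fun l : ∀ i, {m : YoungDiagram // m.card = Fintype.card (γ i)} =>
      piTensor fun i => spechtRep (l i).1 (γ i) :=
  covers_piTensor
    (ρ := fun i (m : {m : YoungDiagram // m.card = Fintype.card (γ i)}) => spechtRep m.1 (γ i))
    (fun _ m => isIrreducible_spechtRep' m.2) fun i => covers_spechtRep (γ i)

lemma exists_linked_outerB {X : Type u} [AddCommGroup X] [Module ℂ X]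
    (τ : Representation ℂ ((WB β₁ × WB β₂) × ∀ i, Equiv.Perm (γ i)) X) [Nontrivial X] :
    ∃ p₁ p₂, ∃ l : Fin (d / 2 - 1) → YoungDiagram, (∀ i, (l i).card = Fintype.card (γ i)) ∧
      Linked (outerB (chiWOn β₁ p₁) (chiWOn β₂ p₂) fun i => spechtRep (l i) (γ i)) τ := by
  obtain ⟨p, l, h⟩ := exists_linked_extTensor
    (ρ := fun p : (Σ p : YoungDiagram × YoungDiagram, β₁ ≃ Fin (p.1.card + p.2.card)) ×
      (Σ p : YoungDiagram × YoungDiagram, β₂ ≃ Fin (p.1.card + p.2.card)) =>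
        extTensor (chiWOn β₁ p.1) (chiWOn β₂ p.2))
    (σ := fun l : ∀ i, {m : YoungDiagram // m.card = Fintype.card (γ i)} =>
      piTensor fun i => spechtRep (l i).1 (γ i))
    (fun p => isIrreducible_extTensor (isIrreducible_chiWOn β₁ p.1) (isIrreducible_chiWOn β₂ p.2))
    (covers_extTensor (isIrreducible_chiWOn β₁) (covers_chiWOn β₁) (covers_chiWOn β₂))
    covers_piTensor_spechtRep τ
  exact ⟨p.1, p.2, fun i => (l i).1, fun i => (l i).2, h⟩

/-- It suffices to match the action of the torus-free part through `sectR`: the torus acts by the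
same character on both sides, and each block element factors by `torB_mul_sectR`. -/
lemma linked_genB {V₁ V₂ : Type*} [AddCommGroup V₁] [Module ℂ V₁] [AddCommGroup V₂] [Module ℂ V₂]
    {V : Fin (d / 2 - 1) → Type*} [∀ i, AddCommGroup (V i)] [∀ i, Module ℂ (V i)]
    {σ₁ : Representation ℂ (WB β₁) V₁} {σ₂ : Representation ℂ (WB β₂) V₂}
    {S : ∀ i, Representation ℂ (Equiv.Perm (γ i)) (V i)} (hd : Even d)
    (e : SumB d β₁ β₂ γ ≃ α) {X : Type*} [AddCommGroup X]
    [Module ℂ X] (τ : Representation ℂ (SWr (Cd d) α) X)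
    (Y : Subrepresentation (τ.comp (embB e)))
    (hY : Y.toSubmodule = eigen τ (torusChar (expo e)))
    (h : Linked (outerB σ₁ σ₂ S) (Y.toRepresentation.comp sectR)) :
    Linked (genB hd e σ₁ σ₂ S) τ := by
  obtain ⟨F, hF, h0⟩ := h
  refine linked_ind ⟨Y.toSubmodule.subtype ∘ₗ F, fun x v => ?_, fun h => h0 ?_⟩
  · rw [innerGenB_apply hd _ _ _ e, map_smul]
    have h1 : ((F (outerB σ₁ σ₂ S (partR x) v) : Y.toSubmodule) : X) =
      τ (embB e (sectR (partR x))) (F v : X) := congrArg Subtype.val (hF (partR x) v)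
    have h2 := mem_eigen.1 (hY.le (F (outerB σ₁ σ₂ S (partR x) v)).2) (embB e x).left
    change _ • (F _ : X) = τ (embB e x) (F v : X)
    conv_rhs => rw [← torB_mul_sectR e x, map_mul, map_mul, embB_torB, Module.End.mul_apply,
      ← h1, h2]
  · exact LinearMap.ext fun v => Subtype.ext (LinearMap.congr_fun h v)

lemma exists_linked_genB (hd : Even d) (e : SumB d β₁ β₂ γ ≃ α) {X : Type u} [AddCommGroup X]
    [Module ℂ X] (τ : Representation ℂ (SWr (Cd d) α) X)
    (hτ : eigen τ (torusChar (expo e)) ≠ ⊥) :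
    ∃ (l₁ m₁ l₂ m₂ : YoungDiagram) (f₁ : β₁ ≃ Fin (l₁.card + m₁.card))
      (f₂ : β₂ ≃ Fin (l₂.card + m₂.card)) (l : Fin (d / 2 - 1) → YoungDiagram),
      (∀ i, (l i).card = Fintype.card (γ i)) ∧
      Linked (genB hd e ((chiW l₁ m₁).comp (Wr.congr f₁)) ((chiW l₂ m₂).comp (Wr.congr f₂))
        fun i => spechtRep (l i) (γ i)) τ := by
  let Y := eigenSub (embB e) τ (torusChar (expo e)) fun n => (torusChar_embB hd e _).1 ⟨n, rfl⟩
  have hY : Nontrivial Y.toSubmodule := Submodule.nontrivial_iff_ne_bot.2 hτ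
  obtain ⟨⟨⟨l₁, m₁⟩, f₁⟩, ⟨⟨l₂, m₂⟩, f₂⟩, l, hl, h⟩ :=
    exists_linked_outerB (Y.toRepresentation.comp sectR)
  exact ⟨l₁, m₁, l₂, m₂, f₁, f₂, l, hl, linked_genB hd e τ Y rfl h⟩

end Eigen

/-- An eigenspace with exponents in `[0, d/2]` supplies partitions for blocks that are fibres of the
exponent function. Counting these fibres gives the total size `n`, and relabelling to consecutive
blocks turns the representation into `chiB`. -/
lemma exists_linked_chiB {n : ℕ} (hd : Even d) {X : Type u} [AddCommGroup X] [Module ℂ X]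
    (τ : Representation ℂ (SB d n) X) [Nontrivial X] : ∃ Λ : R d n, Linked (chiB hd Λ) τ := by
  obtain ⟨c, hc, hτ⟩ := exists_eigen_small τ
  rw [← expo_fiberB hd c hc] at hτ
  obtain ⟨l₁, m₁, l₂, m₂, f₁, f₂, l, hl, h⟩ := exists_linked_genB hd (fiberB hd c hc) τ hτ
  have hcard := Fintype.card_congr (fiberB hd c hc)
  rw [Fintype.card_sum, Fintype.card_sum, Fintype.card_sigma, Fintype.card_congr f₁,
    Fintype.card_congr f₂, Fintype.card_fin, Fintype.card_fin, Fintype.card_fin] at hcard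
  simp only [← hl] at hcard
  let Λ : R d n := ⟨l₁, m₁, l₂, m₂, l, hcard⟩
  refine ⟨Λ, Linked.of_equiv ?_ h⟩
  have k₁ := isIrreducible_comp (wr_congr_surjective f₁) (isIrreducible_chiW l₁ m₁)
  have k₂ := isIrreducible_comp (wr_congr_surjective f₂) (isIrreducible_chiW l₂ m₂)
  have k₃ := fun i => isIrreducible_spechtRep' (hl i)
  let f₃ : ∀ i, Fin (l i).card ≃ {a // c a = (i : ℕ) + 1} := fun i =>
    Fintype.equivOfCardEq (by simp [hl])
  have h1 : Linked (chiB hd Λ) (genB hd (fiberB hd c hc) ((chiW l₁ m₁).comp (Wr.congr f₁))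
      ((chiW l₂ m₂).comp (Wr.congr f₂)) fun i => spechtRep (l i) {a // c a = (i : ℕ) + 1}) := by
    rw [chiB_eq_genB]
    refine linked_genB_congr (S := fun i => spechtRep (l i) {a // c a = (i : ℕ) + 1})
      (S' := fun i => specht (Λ.tail i)) (γ' := fun i => Fin (Λ.tail i).card)
      hd f₁.symm f₂.symm f₃ (fiberB hd c hc) Λ.blockEquiv
      (isIrreducible_chiW _ _) (isIrreducible_chiW _ _) (fun i => isIrreducible_specht (Λ.tail i))
      ?_ ?_ fun i => ?_
    · exact nonempty_equiv_of_intw (e := LinearEquiv.refl ℂ _) fun g v =>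
        congrArg (fun g => chiW l₁ m₁ g v) (wr_congr_symm f₁ g).symm
    · exact nonempty_equiv_of_intw (e := LinearEquiv.refl ℂ _) fun g v =>
        congrArg (fun g => chiW l₂ m₂ g v) (wr_congr_symm f₂ g).symm
    · exact (linked_specht_spechtRep (f₃ i)).nonempty_equiv (isIrreducible_specht (l i))
        (isIrreducible_comp (f₃ i).permCongrHom.surjective (k₃ i))
  exact h1.nonempty_equiv (isIrreducible_chiB hd Λ)
    (isIrreducible_genB (S := fun i => spechtRep (l i) {a // c a = (i : ℕ) + 1}) hd _ k₁ k₂ k₃)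

end CompleteB

open Representation (ind IndV)

/-! ## Restriction to the kernel of a linear character -/

section Clifford

variable {Γ V W : Type*} [Group Γ] [Finite Γ] [AddCommGroup V] [Module ℂ V]
  [AddCommGroup W] [Module ℂ W] {ρ : Representation ℂ Γ V} {σ : Representation ℂ Γ W}
  {N : Subgroup Γ} {c : Γ →* ℂˣ} {d : ℕ}

lemma sum_pow_eq {z : ℂ} (hz : z ^ d = 1) :
    ∑ k ∈ Finset.range d, z ^ k = if z = 1 then (d : ℂ) else 0 := by
  split_ifs with h
  · simp [h]
  · rw [geom_sum_eq h, hz, sub_self, zero_div]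

/-- The sum of `c g ^ k` over `k < d` is `d` on `N` and zero elsewhere, so only elements of `N`
survive in the averages; each contributes `T` because `T` commutes with `N`. -/
lemma exists_sum_avg [Fintype Γ] (hd : d ≠ 0) (hN : N = c.ker) (hc : c ^ d = 1) :
    ∃ q : ℂ, q ≠ 0 ∧ ∀ T : V →ₗ[ℂ] W, Intw (res N ρ) (res N σ) T →
      ∑ k ∈ Finset.range d, avg ρ (twist (c ^ k) σ) T = q • T := by
  classical
  refine ⟨(Fintype.card Γ : ℂ)⁻¹ * (Fintype.card N * d), ?_, fun T hT => ?_⟩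
  · have h1 : (Fintype.card N : ℂ) ≠ 0 := card_ne_zero' N
    have h2 : (d : ℂ) ≠ 0 := by exact_mod_cast hd
    exact mul_ne_zero (inv_ne_zero (card_ne_zero' Γ)) (mul_ne_zero h1 h2)
  · refine LinearMap.ext fun v => ?_
    rw [LinearMap.sum_apply]
    simp only [avg_apply, twist_apply]
    rw [← Finset.smul_sum, Finset.sum_comm, LinearMap.smul_apply, mul_smul]
    congr 1
    have h1 : ∀ g : Γ, ∑ k ∈ Finset.range d, (((c ^ k) g : ℂˣ) : ℂ) • σ g (T (ρ g⁻¹ v)) =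
        if g ∈ N then (d : ℂ) • T v else 0 := fun g => by
      rw [← Finset.sum_smul]
      have h2 : ∀ k, (((c ^ k) g : ℂˣ) : ℂ) = ((c g : ℂˣ) : ℂ) ^ k := fun k => by simp
      simp only [h2]
      have h3 : ((c g : ℂˣ) : ℂ) ^ d = 1 := by
        rw [← h2, hc]
        simp
      have h4 : g ∈ N ↔ ((c g : ℂˣ) : ℂ) = 1 := by
        rw [hN, MonoidHom.mem_ker, Units.val_eq_one]
      rw [sum_pow_eq h3]
      simp only [← h4]
      split_ifs with h
      · have h5 := hT ⟨g⁻¹, inv_mem h⟩ v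
        change T (ρ g⁻¹ v) = σ g⁻¹ (T v) at h5
        rw [h5, rep_apply_inv]
      · rw [zero_smul]
    simp only [h1]
    rw [← Finset.sum_filter, Finset.sum_const, mul_smul, ← Fintype.card_subtype,
      ← Nat.cast_smul_eq_nsmul ℂ]

/-- A nonzero `N`-map is, up to a nonzero factor, a sum of maps from `ρ` to its target twisted by
powers of `c`, so one of these is nonzero. -/
lemma exists_linked_twist (hd : d ≠ 0) (hN : N = c.ker) (hc : c ^ d = 1)
    (h : Linked (res N ρ) (res N σ)) : ∃ k, Linked ρ (twist (c ^ k) σ) := by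
  cases nonempty_fintype Γ
  obtain ⟨T, hT, h0⟩ := h
  obtain ⟨q, hq, h⟩ := exists_sum_avg (ρ := ρ) (σ := σ) hd hN hc
  by_contra hcon
  push Not at hcon
  have h1 := h T hT
  rw [Finset.sum_eq_zero fun k _ => ?_] at h1
  · exact smul_ne_zero hq h0 h1.symm
  · by_contra hk
    exact hcon k ⟨_, intw_avg T, hk⟩

/-- An isomorphism from `ρ` to `ρ ⊗ c ^ o` of order dividing `m`. -/
structure TwistIso (ρ : Representation ℂ Γ V) (c : Γ →* ℂˣ) (o m : ℕ) (F : V →ₗ[ℂ] V) : Prop where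
  intw : Intw ρ (twist (c ^ o) ρ) F
  pow_eq : ∀ v, (F ^ m) v = v

lemma intw_pow {o : ℕ} {F : V →ₗ[ℂ] V} (h : Intw ρ (twist (c ^ o) ρ) F) (j : ℕ) :
    Intw ρ (twist (c ^ (o * j)) ρ) (F ^ j) := by
  intro g v
  induction j with
  | zero => simp [twist_apply]
  | succ j ih =>
    rw [pow_succ', Module.End.mul_apply, ih, twist_apply, map_smul, h, twist_apply, twist_apply,
      smul_smul, ← Units.val_mul, ← MonoidHom.mul_apply, ← pow_add, Module.End.mul_apply]
    rfl

/-- The `m`-th power of any isomorphism `E` commutes with `ρ`, hence is a nonzero scalar; dividing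
`E` by an `m`-th root of it normalizes the power to the identity. -/
lemma exists_twistIso {o m : ℕ} (hm : m ≠ 0) (hc : c ^ (o * m) = 1) (hρ : ρ.IsIrreducible)
    (h : Nonempty (ρ.Equiv (twist (c ^ o) ρ))) : ∃ F, TwistIso ρ c o m F := by
  obtain ⟨E, hE⟩ := nonempty_equiv_iff.1 h
  have := (isIrreducible_iff.1 hρ).1
  obtain ⟨v, hv⟩ := exists_ne (0 : V)
  obtain ⟨z, hz⟩ := exists_scalar_of_intw hρ (T := E.toLinearMap ^ m) fun g v => by
    rw [intw_pow hE m g v, hc]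
    simp [twist_apply]
  have hz0 : z ≠ 0 := by
    rintro rfl
    have h1 : Function.Injective (E.toLinearMap ^ m) := by
      rw [Module.End.coe_pow]
      exact E.injective.iterate m
    exact hv (h1 (by rw [hz, zero_smul, map_zero]))
  obtain ⟨w, hw⟩ := IsAlgClosed.exists_pow_nat_eq z (Nat.pos_of_ne_zero hm)
  refine ⟨w⁻¹ • E.toLinearMap, fun g v => ?_, fun v => ?_⟩
  · rw [LinearMap.smul_apply, hE, LinearMap.smul_apply, map_smul]
  · rw [smul_pow, LinearMap.smul_apply, hz, smul_smul, inv_pow, hw, inv_mul_cancel₀ hz0, one_smul]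

/-- Decompose `T` by `exists_sum_avg`. The `k`-th average vanishes unless `o ∣ k`, and for `k = o *
j` it is a multiple of `F ^ j` by Schur. So `T` acts as a scalar on each eigenspace of `F`. -/
lemma TwistIso.exists_scalar {o m : ℕ} {F : V →ₗ[ℂ] V} (hF : TwistIso ρ c o m F) (hm : m ≠ 0)
    (hdm : d = o * m) (hd : d ≠ 0) (hN : N = c.ker) (hc : c ^ d = 1) (hρ : ρ.IsIrreducible)
    (ho : ∀ k, Nonempty (ρ.Equiv (twist (c ^ k) ρ)) → o ∣ k)
    {T : V →ₗ[ℂ] V} (hT : Intw (res N ρ) (res N ρ) T) (z : ℂ) :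
    ∃ b : ℂ, ∀ u, F u = z • u → T u = b • u := by
  cases nonempty_fintype Γ
  obtain ⟨q, hq, h⟩ := exists_sum_avg (ρ := ρ) (σ := ρ) hd hN hc
  have hpow : ∀ u, F u = z • u → ∀ j : ℕ, (F ^ j) u = z ^ j • u := fun u hu j => by
    induction j with
    | zero => simp
    | succ j ih => rw [pow_succ, Module.End.mul_apply, hu, map_smul, ih, smul_smul, pow_succ']
  have key : ∀ k, ∃ b : ℂ, ∀ u, F u = z • u → avg ρ (twist (c ^ k) ρ) T u = b • u := by
    intro k
    by_cases h0 : avg ρ (twist (c ^ k) ρ) T = 0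
    · exact ⟨0, fun u _ => by rw [h0, zero_smul, LinearMap.zero_apply]⟩
    · have hB := intw_avg (ρ := ρ) (σ := twist (c ^ k) ρ) T
      obtain ⟨j, rfl⟩ := ho k (Linked.nonempty_equiv ⟨_, hB, h0⟩ hρ (isIrreducible_twist _ hρ))
      obtain ⟨b, hb⟩ := exists_scalar_of_intw hρ
        -- Composing with this power cancels the twist, since `o * j + o * (m - 1) * j = d * j`; the
        -- power also serves as the inverse of `F ^ j`.
        (T := (F ^ ((m - 1) * j)) ∘ₗ avg ρ (twist (c ^ (o * j)) ρ) T) fun g v => by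
          rw [LinearMap.comp_apply, hB g v, twist_apply, map_smul, intw_pow hF.intw, twist_apply,
            smul_smul, ← Units.val_mul, ← MonoidHom.mul_apply, ← pow_add]
          have h1 : o * j + o * ((m - 1) * j) = d * j := by
            obtain ⟨m, rfl⟩ := Nat.exists_eq_succ_of_ne_zero hm
            rw [hdm, Nat.succ_sub_one, Nat.succ_eq_add_one]
            ring
          rw [h1, pow_mul, hc, one_pow, MonoidHom.one_apply, Units.val_one, one_smul]
          rfl
      refine ⟨b * z ^ j, fun u hu => ?_⟩
      have h2 : ∀ v, (F ^ (m * j)) v = v := fun v => by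
        rw [pow_mul, Module.End.coe_pow]
        exact Function.iterate_fixed (hF.pow_eq v) j
      have h3 : m * j = j + (m - 1) * j := by
        obtain ⟨m, rfl⟩ := Nat.exists_eq_succ_of_ne_zero hm
        rw [Nat.succ_sub_one, Nat.succ_eq_add_one]
        ring
      rw [← h2 (avg _ _ _ u), h3, pow_add, Module.End.mul_apply]
      have h4 := hb u
      rw [LinearMap.comp_apply] at h4
      rw [h4, map_smul, hpow u hu, smul_smul]
  choose b hb using key
  refine ⟨q⁻¹ * ∑ k ∈ Finset.range d, b k, fun u hu => ?_⟩
  have h1 := LinearMap.congr_fun (h T hT) u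
  rw [LinearMap.sum_apply, LinearMap.smul_apply,
    Finset.sum_congr rfl fun k _ => hb k u hu, ← Finset.sum_smul] at h1
  rw [mul_smul, h1, smul_smul, inv_mul_cancel₀ hq, one_smul]

lemma isIrreducible_res (hd : d ≠ 0) (hN : N = c.ker) (hc : c ^ d = 1) (hρ : ρ.IsIrreducible)
    (ho : ∀ k, Nonempty (ρ.Equiv (twist (c ^ k) ρ)) → d ∣ k) : (res N ρ).IsIrreducible := by
  -- No proper twist is isomorphic to `ρ`, so `F` is the identity, whose eigenspace for `1` is
  -- everything.
  have hF : TwistIso ρ c d 1 LinearMap.id := ⟨fun g v => by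
    rw [hc]
    simp [twist_apply], fun v => by simp⟩
  have := (isIrreducible_iff.1 hρ).1
  refine isIrreducible_of_scalar fun T hT => ?_
  obtain ⟨b, hb⟩ := hF.exists_scalar one_ne_zero (mul_one d).symm hd hN hc hρ ho hT 1
  exact ⟨b, fun v => hb v (by simp)⟩

/-- The summands are the eigenspaces of the normalized isomorphism `F` for the `m`-th roots of
unity. The element `g₀` permutes them cyclically, which gives conjugacy. An `N`-endomorphism is a
scalar on each of them, which gives both irreducibility and non-isomorphism. -/
lemma restrictionSplits [N.Normal] {o m : ℕ} (hdm : d = o * m) (hd : d ≠ 0) (hN : N = c.ker)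
    (hc : c ^ d = 1) {g₀ : Γ} (hg₀ : IsPrimitiveRoot (c g₀) d) (hρ : ρ.IsIrreducible)
    (ho : ∀ k, Nonempty (ρ.Equiv (twist (c ^ k) ρ)) → o ∣ k)
    (ho' : Nonempty (ρ.Equiv (twist (c ^ o) ρ))) : RestrictionSplits N ρ m := by
  have hm : m ≠ 0 := by
    rintro rfl
    exact hd (by simpa using hdm)
  obtain ⟨F, hF⟩ := exists_twistIso hm (by rw [← hdm, hc]) hρ ho'
  let ζ : ℂ := ((c g₀) ^ o : ℂˣ)
  have hζ : IsPrimitiveRoot ζ m :=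
    IsPrimitiveRoot.coe_units_iff.2 (hg₀.pow (Nat.pos_of_ne_zero hd) hdm)
  have hζ0 : ζ ≠ 0 := hζ.ne_zero hm
  have hcN : ∀ n : N, c n = 1 := fun n => MonoidHom.mem_ker.1 (hN.le n.2)
  let U : Fin m → Subrepresentation (res N ρ) := fun i =>
    { toSubmodule := Module.End.eigenspace F (ζ ^ (i : ℕ))
      apply_mem_toSubmodule := fun n v hv => by
        rw [Module.End.mem_eigenspace_iff] at hv ⊢
        change F (ρ n v) = _ • ρ n v
        rw [hF.intw, twist_apply, MonoidHom.pow_apply, hcN, one_pow, Units.val_one, one_smul, hv,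
          map_smul] }
  have hU : ∀ i v, v ∈ (U i).toSubmodule ↔ F v = ζ ^ (i : ℕ) • v := fun i v =>
    Module.End.mem_eigenspace_iff
  have hinj : Function.Injective fun i : Fin m => ζ ^ (i : ℕ) := fun i j h =>
    Fin.ext (hζ.pow_inj i.2 j.2 h)
  have hind : iSupIndep fun i => (U i).toSubmodule :=
    (Module.End.eigenspaces_iSupIndep F).comp hinj
  have htop : ⨆ i, (U i).toSubmodule = ⊤ := by
    refine eq_top_iff.2 fun v _ => ?_
    -- Discrete Fourier projections of `v`, up to the factor `m`: multiplication by `F` shifts the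
    -- sum cyclically because `F ^ m = 1`, and summing over `i` leaves only the term `j = 0`.
    let P : Fin m → V := fun i => ∑ j ∈ Finset.range m, (ζ ^ (i : ℕ))⁻¹ ^ j • (F ^ j) v
    have hP : ∀ i, P i ∈ (U i).toSubmodule := fun i => by
      rw [hU, map_sum, Finset.smul_sum]
      have h1 : ∀ j, F ((ζ ^ (i : ℕ))⁻¹ ^ j • (F ^ j) v) = ζ ^ (i : ℕ) •
          ((ζ ^ (i : ℕ))⁻¹ ^ (j + 1) • (F ^ (j + 1)) v) := fun j => by
        rw [map_smul, smul_smul, pow_succ' _ j, ← mul_assoc, mul_inv_cancel₀ (pow_ne_zero _ hζ0),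
          one_mul, pow_succ' F, Module.End.mul_apply]
      simp only [h1]
      have h2 := Finset.sum_range_succ' (fun j => ζ ^ (i : ℕ) •
        ((ζ ^ (i : ℕ))⁻¹ ^ j • (F ^ j) v)) m
      rw [Finset.sum_range_succ] at h2
      have h3 : (ζ ^ (i : ℕ))⁻¹ ^ m • (F ^ m) v = (ζ ^ (i : ℕ))⁻¹ ^ 0 • (F ^ 0) v := by
        rw [hF.pow_eq, inv_pow, ← pow_mul, mul_comm, pow_mul, hζ.pow_eq_one]
        simp
      rw [h3] at h2
      exact (add_right_cancel h2).symm
    have hsum : ∑ i, P i = (m : ℂ) • v := by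
      simp only [P]
      rw [Finset.sum_comm]
      simp only [← Finset.sum_smul]
      have h1 : ∀ j ∈ Finset.range m, (∑ i : Fin m, (ζ ^ (i : ℕ))⁻¹ ^ j) • (F ^ j) v
          = if j = 0 then (m : ℂ) • v else 0 := fun j hj => by
        have h2 : ∀ i : Fin m, (ζ ^ (i : ℕ))⁻¹ ^ j = ((ζ⁻¹) ^ j) ^ (i : ℕ) := fun i => by
          rw [← inv_pow, ← pow_mul, ← pow_mul, mul_comm]
        simp only [h2]
        rw [Fin.sum_univ_eq_sum_range fun i => ((ζ⁻¹) ^ j) ^ i, sum_pow_eq]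
        · have h3 : (ζ⁻¹) ^ j = 1 ↔ j = 0 := by
            rw [inv_pow, inv_eq_one, hζ.pow_eq_one_iff_dvd]
            exact ⟨fun h => Nat.eq_zero_of_dvd_of_lt h (Finset.mem_range.1 hj),
              fun h => h ▸ dvd_zero _⟩
          simp only [h3]
          split_ifs with h
          · rw [h, pow_zero]
            rfl
          · rw [zero_smul]
        · rw [← pow_mul, mul_comm, pow_mul, inv_pow, hζ.pow_eq_one]
          simp
      rw [Finset.sum_congr rfl h1, Finset.sum_ite_eq' ]
      simp [Nat.pos_of_ne_zero hm]
    have hm' : (m : ℂ) ≠ 0 := by exact_mod_cast hm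
    rw [← one_smul ℂ v, ← inv_mul_cancel₀ hm', mul_smul, ← hsum]
    exact Submodule.smul_mem _ _ (Submodule.sum_mem _ fun i _ =>
      Submodule.mem_iSup_of_mem i (hP i))
  have hgpow : ∀ (k : ℕ) v (z : ℂ), F v = z • v → F (ρ (g₀ ^ k) v) = (ζ ^ k * z) • ρ (g₀ ^ k) v :=
    fun k v z hv => by
      rw [hF.intw, twist_apply, hv, map_smul, smul_smul, MonoidHom.pow_apply, map_pow, ← pow_mul,
        mul_comm k o, pow_mul, Units.val_pow_eq_pow_val]
  have hgpow' : ∀ (k : ℕ) v (z : ℂ), F v = (ζ ^ k * z) • v →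
      F (ρ (g₀ ^ k)⁻¹ v) = z • ρ (g₀ ^ k)⁻¹ v := fun k v z hv => by
    have h1 : F (ρ (g₀ ^ k) (ρ (g₀ ^ k)⁻¹ v)) = (ζ ^ k) • ρ (g₀ ^ k) (F (ρ (g₀ ^ k)⁻¹ v)) := by
      rw [hF.intw, twist_apply, MonoidHom.pow_apply, map_pow, ← pow_mul,
        mul_comm k o, pow_mul, Units.val_pow_eq_pow_val]
    rw [rep_apply_inv, hv, mul_smul] at h1
    have h2 := smul_right_injective V (pow_ne_zero k hζ0) h1
    rw [← map_smul, h2, rep_inv_apply]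
  have hshift : ∀ i j : Fin m, ∃ k : ℕ, ζ ^ k * ζ ^ (j : ℕ) = ζ ^ (i : ℕ) := fun i j => by
    -- The exponent `i - j` mod `m`, written without truncated subtraction.
    refine ⟨i + (m - j), ?_⟩
    rw [← pow_add, add_assoc, Nat.sub_add_cancel j.2.le, pow_add, hζ.pow_eq_one, mul_one]
  have hconj : ∀ i j, ∃ g : Γ,
      Nonempty ((U j).toRepresentation.Equiv (conjRep N g (U i).toRepresentation)) := by
    intro i j
    obtain ⟨k, hk⟩ := hshift i j
    refine ⟨g₀ ^ k, ?_⟩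
    let E : (U j).toSubmodule ≃ₗ[ℂ] (U i).toSubmodule :=
      { toFun := fun v => ⟨ρ (g₀ ^ k) v, (hU _ _).2 (by
          rw [hgpow k _ _ ((hU _ _).1 v.2), hk])⟩
        invFun := fun v => ⟨ρ (g₀ ^ k)⁻¹ v, (hU _ _).2 (hgpow' k _ _ (by
          rw [hk]
          exact (hU _ _).1 v.2))⟩
        map_add' := fun v w => Subtype.ext (map_add _ _ _)
        map_smul' := fun z v => Subtype.ext (map_smul _ _ _)
        left_inv := fun v => Subtype.ext (rep_inv_apply _ _ _)
        right_inv := fun v => Subtype.ext (rep_apply_inv _ _ _) }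
    refine nonempty_equiv_of_intw (e := E) fun n v => Subtype.ext ?_
    change ρ (g₀ ^ k) (ρ n v) = ρ (g₀ ^ k * n * (g₀ ^ k)⁻¹) (ρ (g₀ ^ k) v)
    rw [map_mul, map_mul, Module.End.mul_apply, Module.End.mul_apply, rep_inv_apply]
  have hnt : ∀ i, Nontrivial (U i).toSubmodule := by
    have hV := (isIrreducible_iff.1 hρ).1
    by_contra hcon
    push Not at hcon
    obtain ⟨i, hi⟩ := hcon
    -- Conjugate summands are isomorphic as vector spaces, so if one vanished they all would, while
    -- they span `V`.
    have h1 : ∀ j, (U j).toSubmodule = ⊥ := fun j => by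
      obtain ⟨g, hg⟩ := hconj i j
      obtain ⟨E, -⟩ := nonempty_equiv_iff.1 hg
      have := E.toEquiv.subsingleton
      exact (Submodule.subsingleton_iff_eq_bot).1 this
    simp only [h1, iSup_bot] at htop
    exact bot_ne_top htop
  have hscalar : ∀ i {T : V →ₗ[ℂ] V}, Intw (res N ρ) (res N ρ) T →
      ∃ b : ℂ, ∀ u ∈ (U i).toSubmodule, T u = b • u := fun i T hT => by
    obtain ⟨b, hb⟩ := hF.exists_scalar hm hdm hd hN hc hρ ho hT (ζ ^ (i : ℕ))
    exact ⟨b, fun u hu => hb u ((hU _ _).1 hu)⟩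
  have hproj : ∀ i, ∃ P : V →ₗ[ℂ] (U i).toSubmodule,
      Intw (res N ρ) (U i).toRepresentation P ∧ ∀ u : (U i).toSubmodule, P u = u := fun i => by
    obtain ⟨P, hP, hPu⟩ := (intw_subtype (U i)).exists_leftInverse
      (U i).toSubmodule.injective_subtype
    exact ⟨P, hP, hPu⟩
  refine ⟨U, DirectSum.isInternal_submodule_of_iSupIndep_of_iSup_eq_top hind htop,
    fun i => ?_, fun i j hij => ?_, hconj⟩
  · have := hnt i
    refine isIrreducible_of_scalar fun t ht => ?_
    obtain ⟨P, hP, hPu⟩ := hproj i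
    obtain ⟨b, hb⟩ := hscalar i ((intw_subtype (U i)).comp (ht.comp hP))
    refine ⟨b, fun v => Subtype.ext ?_⟩
    have h1 := hb v v.2
    simp only [LinearMap.comp_apply, hPu] at h1
    exact h1
  · obtain ⟨E, hE⟩ := nonempty_equiv_iff.1 hij
    obtain ⟨P, hP, hPu⟩ := hproj i
    -- The isomorphism, extended by the projection to all of `V`, is a scalar on `U i`. So a nonzero
    -- vector of `U i` lies in `U j` too, and the eigenvalues agree.
    obtain ⟨b, hb⟩ := hscalar i ((intw_subtype (U j)).comp (hE.comp hP))
    have := hnt i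
    obtain ⟨v, hv⟩ := exists_ne (0 : (U i).toSubmodule)
    have h1 : ((E v : (U j).toSubmodule) : V) = b • (v : V) := by
      have h1 := hb v v.2
      simp only [LinearMap.comp_apply, hPu] at h1
      exact h1
    have hv0 : (v : V) ≠ 0 := fun h => hv (Subtype.ext h)
    have hb0 : b ≠ 0 := by
      rintro rfl
      rw [zero_smul] at h1
      exact hv (E.injective (Subtype.ext (by simpa using h1)))
    have h2 := (hU _ _).1 (E v).2
    rw [h1, map_smul, (hU _ _).1 v.2] at h2
    exact hinj (smul_left_injective ℂ hv0 (smul_right_injective V hb0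
      (h2.trans (smul_comm _ _ _))))

lemma nonempty_equiv_res (hN : N = c.ker) {k : ℕ}
    (h : Nonempty (σ.Equiv (twist (c ^ k) ρ))) : Nonempty ((res N ρ).Equiv (res N σ)) := by
  obtain ⟨E, hE⟩ := nonempty_equiv_iff.1 (nonempty_equiv_symm h)
  refine nonempty_equiv_of_intw (e := E) fun n v => ?_
  have h1 : c n = 1 := MonoidHom.mem_ker.1 (hN.le n.2)
  have h2 := hE n v
  rw [twist_apply, MonoidHom.pow_apply, h1, one_pow, Units.val_one, one_smul] at h2
  exact h2

lemma haveCommonFactor_of_equiv (hρ : ρ.IsIrreducible)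
    (h : Nonempty ((res N ρ).Equiv (res N σ))) : HaveCommonFactor (res N ρ) (res N σ) := by
  have := (isIrreducible_iff.1 hρ).1
  obtain ⟨U, hU⟩ := exists_irreducible_sub (res N ρ)
  obtain ⟨E, hE⟩ := nonempty_equiv_iff.1 h
  exact ⟨U, hU, isFactor_of_injective (hE.comp (intw_subtype U))
    (E.injective.comp U.toSubmodule.injective_subtype)⟩

lemma HaveCommonFactor.linked (h : HaveCommonFactor (res N ρ) (res N σ)) :
    Linked (res N ρ) (res N σ) := by
  obtain ⟨U, hU, hf⟩ := h
  obtain ⟨f, hf, hi⟩ := hf.exists_injective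
  obtain ⟨P, hP, hPu⟩ := (intw_subtype U).exists_leftInverse U.toSubmodule.injective_subtype
  have := (isIrreducible_iff.1 hU).1
  obtain ⟨v, hv⟩ := exists_ne (0 : U.toSubmodule)
  refine ⟨f ∘ₗ P, hf.comp hP, fun h0 => hv (hi ?_)⟩
  rw [map_zero, ← hPu v]
  exact LinearMap.congr_fun h0 _

end Clifford

/-- Induce `τ` to the whole group, choose an irreducible constituent, and return by reciprocity. -/
lemma exists_isFactor_res {Γ : Type} [Group Γ] [Finite Γ] {N : Subgroup Γ} {ι : Type*}
    {Y : ι → Type*} [∀ i, AddCommGroup (Y i)] [∀ i, Module ℂ (Y i)]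
    {χ : ∀ i, Representation ℂ Γ (Y i)} (hχ : ∀ i, (χ i).IsIrreducible) (hcov : Covers.{u} χ)
    {X : Type u} [AddCommGroup X] [Module ℂ X]
    (τ : Representation ℂ N X) (hτ : τ.IsIrreducible) : ∃ i, IsFactor τ (res N (χ i)) := by
  have := (isIrreducible_iff.1 hτ).1
  obtain ⟨i, hi⟩ := hcov _ (ind N.subtype τ) (nontrivial_indV N.subtype_injective τ)
  obtain ⟨f, hf, h0⟩ := (hi.symm_left (hχ i)).of_ind
  exact ⟨i, isFactor_of_injective hf (hf.injective hτ h0)⟩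

section Final

variable {d n : ℕ} [NeZero d]

/-! ## Type `A*` -/

lemma SAstar_eq_ker : SAstar d n = (epsCharA d n).ker := by
  ext g
  change detHom (Cd d) (Fin n) g = 1 ↔ ((detHom (Cd d) (Fin n) g : Cd d) : ℂˣ) ^ 1 = 1
  rw [pow_one]
  exact OneMemClass.coe_eq_one.symm

lemma epsCharA_pow : epsCharA d n ^ d = 1 := by
  ext1 g
  change (((detHom (Cd d) (Fin n) g : Cd d) : ℂˣ) ^ 1) ^ d = 1
  rw [pow_one]
  exact (mem_rootsOfUnity _ _).1 (detHom (Cd d) (Fin n) g).2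

lemma prod_mulSingle {ι M : Type*} [Fintype ι] [DecidableEq ι] [CommMonoid M] (i : ι) (x : M) :
    ∏ a, (Pi.mulSingle i x : ι → M) a = x := by
  rw [Finset.prod_eq_single i (fun b _ hb => ?_) (fun h => absurd (Finset.mem_univ i) h)]
  · exact Pi.mulSingle_eq_same (M := fun _ => M) i x
  · exact Pi.mulSingle_eq_of_ne (M := fun _ => M) hb x

lemma exists_epsCharA_primitive (hn : 1 ≤ n) :
    ∃ g : SA d n, IsPrimitiveRoot (epsCharA d n g) d := by
  obtain ⟨ζ, hζ, -⟩ := exists_primitive d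
  -- A diagonal element with a single primitive entry has primitive determinant; an entry exists
  -- because `1 ≤ n`.
  refine ⟨SemidirectProduct.inl (Pi.mulSingle ⟨0, hn⟩ ζ), ?_⟩
  have h : detHom (Cd d) (Fin n) (SemidirectProduct.inl (Pi.mulSingle ⟨0, hn⟩ ζ)) = ζ :=
    prod_mulSingle (⟨0, hn⟩ : Fin n) ζ
  change IsPrimitiveRoot (((detHom (Cd d) (Fin n) _ : Cd d) : ℂˣ) ^ 1) d
  rw [h, pow_one]
  exact hζ

lemma twist_mul {G V : Type*} [Group G] [AddCommGroup V] [Module ℂ V] (c c' : G →* ℂˣ)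
    (ρ : Representation ℂ G V) : twist (c * c') ρ = twist c (twist c' ρ) := by
  ext g : 1
  refine LinearMap.ext fun v => ?_
  rw [twist_apply, twist_apply, twist_apply, smul_smul]
  rfl

lemma twist_one {G V : Type*} [Group G] [AddCommGroup V] [Module ℂ V]
    (ρ : Representation ℂ G V) : twist 1 ρ = ρ := by
  ext g : 1
  refine LinearMap.ext fun v => ?_
  rw [twist_apply, MonoidHom.one_apply, Units.val_one, one_smul]

lemma nonempty_equiv_refl {G V : Type*} [Group G] [AddCommGroup V] [Module ℂ V]
    (ρ : Representation ℂ G V) : Nonempty (ρ.Equiv ρ) :=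
  nonempty_equiv_of_intw (e := LinearEquiv.refl ℂ V) fun _ _ => rfl

/-- If twisting by `c` corresponds to the permutation `s` of the parameters, then twisting by
`c ^ k` corresponds to the iterate. -/
lemma nonempty_equiv_twist_pow {G ι : Type*} [Group G] {V : ι → Type*} [∀ i, AddCommGroup (V i)]
    [∀ i, Module ℂ (V i)] {χ : ∀ i, Representation ℂ G (V i)} {c : G →* ℂˣ} {s : ι → ι}
    (h : ∀ i, Nonempty ((twist c (χ i)).Equiv (χ (s i)))) (k : ℕ) (i : ι) :
    Nonempty ((twist (c ^ k) (χ i)).Equiv (χ (s^[k] i))) := by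
  induction k generalizing i with
  | zero =>
    have h0 : c ^ 0 = 1 := MonoidHom.ext fun g => pow_zero (c g)
    rw [h0, twist_one]
    exact nonempty_equiv_refl _
  | succ k ih =>
    have h1 : c ^ (k + 1) = c ^ k * c := MonoidHom.ext fun g => pow_succ (c g) k
    rw [h1, twist_mul, Function.iterate_succ_apply]
    exact nonempty_equiv_trans (nonempty_equiv_twist _ (h i)) (ih (s i))

/-- The correspondence between irreducible representations of a finite group and of the kernel of
a linear character of order dividing `d`. -/
lemma haveCommonFactor_iff {G ι : Type*} [Group G] [Finite G] {V : ι → Type*}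
    [∀ i, AddCommGroup (V i)] [∀ i, Module ℂ (V i)] {χ : ∀ i, Representation ℂ G (V i)}
    {c : G →* ℂˣ} {s : ι → ι} {N : Subgroup G} (hd : d ≠ 0) (hN : N = c.ker) (hc : c ^ d = 1)
    (hχ : ∀ i, (χ i).IsIrreducible) (hinj : ∀ i j, Linked (χ i) (χ j) → i = j)
    (h : ∀ i, Nonempty ((twist c (χ i)).Equiv (χ (s i)))) (i j : ι) :
    (HaveCommonFactor (res N (χ i)) (res N (χ j)) ↔ ∃ k, j = s^[k] i) ∧
      ((∃ k, j = s^[k] i) → Nonempty ((res N (χ i)).Equiv (res N (χ j)))) := by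
  have h1 : (∃ k, j = s^[k] i) → Nonempty ((res N (χ i)).Equiv (res N (χ j))) := by
    rintro ⟨k, rfl⟩
    exact nonempty_equiv_res hN (nonempty_equiv_symm (nonempty_equiv_twist_pow h k i))
  have hsymm : (∃ k, i = s^[k] j) → ∃ k, j = s^[k] i := by
    rintro ⟨k, rfl⟩
    have hper : ∀ i, s^[d] i = i := fun i => (hinj _ _ (by
      have h2 := nonempty_equiv_twist_pow h d i
      rw [hc, twist_one] at h2
      have := (isIrreducible_iff.1 (hχ i)).1
      exact linked_of_equiv h2)).symm
    -- The twist has order dividing `d`, so `s^[d]` is the identity and this number of steps undoes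
    -- `k` steps.
    refine ⟨(d - 1) * k, ?_⟩
    rw [← Function.iterate_add_apply]
    have h3 : (d - 1) * k + k = d * k := by
      obtain ⟨d, rfl⟩ := Nat.exists_eq_succ_of_ne_zero hd
      rw [Nat.succ_sub_one, Nat.succ_eq_add_one]
      ring
    rw [h3, Function.iterate_mul]
    exact (Function.iterate_fixed (hper j) k).symm
  refine ⟨⟨fun hcf => hsymm ?_, fun hk => haveCommonFactor_of_equiv (hχ i) (h1 hk)⟩, h1⟩
  obtain ⟨k, hk⟩ := exists_linked_twist hd hN hc hcf.linked
  exact ⟨k, hinj _ _ (hk.trans_equiv (nonempty_equiv_twist_pow h k j))⟩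

lemma nonempty_equiv_twist_iff {G ι : Type*} [Group G] {V : ι → Type*}
    [∀ i, AddCommGroup (V i)] [∀ i, Module ℂ (V i)] {χ : ∀ i, Representation ℂ G (V i)}
    {c : G →* ℂˣ} {s : ι → ι}
    (hχ : ∀ i, (χ i).IsIrreducible) (hinj : ∀ i j, Linked (χ i) (χ j) → i = j)
    (h : ∀ i, Nonempty ((twist c (χ i)).Equiv (χ (s i)))) (k : ℕ) (i : ι) :
    Nonempty ((χ i).Equiv (twist (c ^ k) (χ i))) ↔ s^[k] i = i := by
  have := (isIrreducible_iff.1 (hχ i)).1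
  have h1 := nonempty_equiv_twist_pow h k i
  constructor
  · intro h2
    exact (hinj _ _ (linked_of_equiv (nonempty_equiv_trans h2 h1))).symm
  · intro h2
    rw [h2] at h1
    exact nonempty_equiv_symm h1

lemma Q.o_pos (Λ : Q d n) : 0 < Λ.o :=
  (isPeriodicPt_shift Λ).minimalPeriod_pos (Nat.pos_of_ne_zero (NeZero.ne d))

lemma Q.o_dvd (Λ : Q d n) : Λ.o ∣ d := (isPeriodicPt_shift Λ).minimalPeriod_dvd

/-- The powers of the determinant character fixing `χ_Λ` correspond to the shifts fixing `Λ`, which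
are the multiples of the minimal period. -/
lemma restrictionSplits_chiA (hn : 1 ≤ n) (Λ : Q d n) :
    RestrictionSplits (SAstar d n) (chiA Λ) (d / Λ.o) := by
  obtain ⟨g, hg⟩ := exists_epsCharA_primitive (d := d) hn
  have h := fun k => nonempty_equiv_twist_iff (χ := fun Λ : Q d n => chiA Λ) isIrreducible_chiA
    (fun _ _ => eq_of_linked_chiA) nonempty_equiv_twist_chiA k Λ
  refine restrictionSplits (Nat.mul_div_cancel' Λ.o_dvd).symm (NeZero.ne d) SAstar_eq_ker
    epsCharA_pow hg (isIrreducible_chiA Λ) (fun k hk => ?_) ((h _).2 ?_)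
  · exact Function.IsPeriodicPt.minimalPeriod_dvd ((h k).1 hk)
  · exact Function.iterate_minimalPeriod

lemma parametrizesIrr_chiA : ParametrizesIrr.{u} fun Λ : Q d n => chiA Λ := by
  refine ⟨isIrreducible_chiA, fun Λ Λ' h => ?_, fun X _ _ ρ hρ => ?_⟩
  · have := (isIrreducible_iff.1 (isIrreducible_chiA Λ)).1
    exact eq_of_linked_chiA (linked_of_equiv h)
  · have := (isIrreducible_iff.1 hρ).1
    obtain ⟨Λ, h⟩ := exists_linked_chiA ρ
    exact ⟨Λ, nonempty_equiv_symm (h.nonempty_equiv (isIrreducible_chiA Λ) hρ)⟩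

/-! ## Type `D` -/

lemma parametrizesIrr_chiB (hd : Even d) : ParametrizesIrr.{u} fun Λ : R d n => chiB hd Λ := by
  refine ⟨isIrreducible_chiB hd, fun Λ Λ' h => ?_, fun X _ _ ρ hρ => ?_⟩
  · have := (isIrreducible_iff.1 (isIrreducible_chiB hd Λ)).1
    exact eq_of_linked_chiB hd (linked_of_equiv h)
  · have := (isIrreducible_iff.1 hρ).1
    obtain ⟨Λ, h⟩ := exists_linked_chiB hd ρ
    exact ⟨Λ, nonempty_equiv_symm (h.nonempty_equiv (isIrreducible_chiB hd Λ) hρ)⟩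

lemma signChar_injective : Function.Injective signChar := by
  refine (injective_iff_map_eq_one _).2 fun x hx => ?_
  rcases Int.units_eq_one_or x with rfl | rfl
  · rfl
  · rw [signChar_neg_one] at hx
    have := congrArg Units.val hx
    norm_num at this

lemma SD_eq_ker_epsCharB : SD d n = (epsCharB d n).ker := by
  ext g
  rw [SD_eq_ker, MonoidHom.mem_ker, MonoidHom.mem_ker]
  exact (map_eq_one_iff signChar signChar_injective).symm

lemma epsCharB_sq : epsCharB d n ^ 2 = 1 := by
  ext1 g
  change (signChar (epsB d n g)) ^ 2 = 1
  rw [← map_pow, Int.units_sq, map_one]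

lemma exists_epsB_neg_one (d : ℕ) (hn : 1 ≤ n) : ∃ g : SB d n, epsB d n g = -1 :=
  ⟨SemidirectProduct.inr (SemidirectProduct.inl (Pi.mulSingle ⟨0, hn⟩ (-1))),
    prod_mulSingle (⟨0, hn⟩ : Fin n) (-1 : ℤˣ)⟩

lemma exists_epsCharB_primitive (hn : 1 ≤ n) :
    ∃ g : SB d n, IsPrimitiveRoot (epsCharB d n g) 2 := by
  obtain ⟨g, hg⟩ := exists_epsB_neg_one d hn
  refine ⟨g, ?_⟩
  change IsPrimitiveRoot (signChar (epsB d n g)) 2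
  rw [hg, signChar_neg_one, ← IsPrimitiveRoot.coe_units_iff]
  exact IsPrimitiveRoot.neg_one 0 (by norm_num)

lemma index_SD (hn : 1 ≤ n) : (SD d n).index = 2 := by
  have hs : Function.Surjective (epsB d n) := fun x => by
    rcases Int.units_eq_one_or x with rfl | rfl
    · exact ⟨1, map_one _⟩
    · exact exists_epsB_neg_one d hn
  rw [SD_eq_ker, Subgroup.index_ker, MonoidHom.range_eq_top.2 hs]
  simp

lemma R.swap_swap (Λ : R d n) : Λ.swap.swap = Λ := rfl

lemma R.exists_iterate_swap_iff {Λ Λ' : R d n} :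
    (∃ k, Λ' = R.swap^[k] Λ) ↔ Λ' = Λ ∨ Λ' = Λ.swap := by
  constructor
  · rintro ⟨k, rfl⟩
    induction k with
    | zero => exact Or.inl rfl
    | succ k ih =>
      rw [Function.iterate_succ_apply']
      rcases ih with h | h
      · exact Or.inr (congrArg R.swap h)
      · exact Or.inl (congrArg R.swap h)
  · rintro (rfl | rfl)
    · exact ⟨0, rfl⟩
    · exact ⟨1, rfl⟩

lemma R.swap_eq_iff {Λ : R d n} : Λ.swap = Λ ↔ (Λ.lam1, Λ.lam2) = (Λ.mu1, Λ.mu2) := by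
  rw [Prod.mk.injEq]
  constructor
  · intro h
    exact ⟨congrArg R.mu1 h, congrArg R.mu2 h⟩
  · rintro ⟨h1, h2⟩
    exact R.ext h1.symm h1 h2.symm h2 rfl

lemma nonempty_equiv_twist_chiB_iff (hd : Even d) (Λ : R d n) (k : ℕ) :
    Nonempty ((chiB hd Λ).Equiv (twist (epsCharB d n ^ k) (chiB hd Λ))) ↔ R.swap^[k] Λ = Λ :=
  nonempty_equiv_twist_iff (χ := fun Λ : R d n => chiB hd Λ) (isIrreducible_chiB hd)
    (fun _ _ => eq_of_linked_chiB hd) (nonempty_equiv_twist_chiB hd) k Λ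

/-- An odd number of swaps acts as one swap, which moves `Λ` here; so only even powers of the sign
character fix `χ_Λ`. -/
lemma isIrreducible_res_chiB (hd : Even d) {Λ : R d n}
    (h : (Λ.lam1, Λ.lam2) ≠ (Λ.mu1, Λ.mu2)) : (res (SD d n) (chiB hd Λ)).IsIrreducible := by
  refine isIrreducible_res two_ne_zero SD_eq_ker_epsCharB epsCharB_sq (isIrreducible_chiB hd Λ)
    fun k hk => ?_
  rw [nonempty_equiv_twist_chiB_iff] at hk
  by_contra h2
  have h3 : k % 2 = 1 := by omega
  rw [Function.Involutive.iterate_odd (f := R.swap) R.swap_swap (Nat.odd_iff.2 h3)] at hk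
  exact h (R.swap_eq_iff.1 hk)

lemma restrictionSplits_chiB (hd : Even d) (hn : 1 ≤ n) {Λ : R d n}
    (h : (Λ.lam1, Λ.lam2) = (Λ.mu1, Λ.mu2)) : RestrictionSplits (SD d n) (chiB hd Λ) 2 := by
  obtain ⟨g, hg⟩ := exists_epsCharB_primitive (d := d) hn
  exact restrictionSplits (o := 1) (one_mul 2).symm two_ne_zero SD_eq_ker_epsCharB epsCharB_sq hg
    (isIrreducible_chiB hd Λ) (fun k _ => one_dvd k)
    ((nonempty_equiv_twist_chiB_iff hd Λ 1).2 (R.swap_eq_iff.2 h))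

end Final

end YokonumaIrr

end

theorem mainTheorem7 (d n : ℕ) [NeZero d] (hd : Even d) (hn : 1 ≤ n) :
    -- Type A
    ((∀ Λ : YokonumaIrr.Q d n,
        Function.Injective Λ.emb ∧
        Set.range Λ.emb = {g : YokonumaIrr.SA d n |
          ∀ t : Fin n → YokonumaIrr.Cd d, YokonumaIrr.torusChar Λ.psi (YokonumaIrr.permAut _ _ g.right⁻¹ t) =
            YokonumaIrr.torusChar Λ.psi t}) ∧
      YokonumaIrr.ParametrizesIrr.{u} (fun Λ : YokonumaIrr.Q d n => YokonumaIrr.chiA Λ)) ∧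
    -- Type A*
    ((∀ Λ : YokonumaIrr.Q d n,
        Nonempty ((YokonumaIrr.twist (YokonumaIrr.epsCharA d n) (YokonumaIrr.chiA Λ)).Equiv
          (YokonumaIrr.chiA Λ.shift)) ∧
        0 < Λ.o ∧ Λ.o ∣ d ∧
        YokonumaIrr.RestrictionSplits (YokonumaIrr.SAstar d n) (YokonumaIrr.chiA Λ) (d / Λ.o)) ∧
      (∀ Λ Λ' : YokonumaIrr.Q d n,
        (YokonumaIrr.HaveCommonFactor (YokonumaIrr.res (YokonumaIrr.SAstar d n)
            (YokonumaIrr.chiA Λ))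
          (YokonumaIrr.res (YokonumaIrr.SAstar d n) (YokonumaIrr.chiA Λ')) ↔
            ∃ k : ℕ, Λ' = YokonumaIrr.Q.shift^[k] Λ) ∧
        ((∃ k : ℕ, Λ' = YokonumaIrr.Q.shift^[k] Λ) →
          Nonempty ((YokonumaIrr.res (YokonumaIrr.SAstar d n) (YokonumaIrr.chiA Λ)).Equiv
            (YokonumaIrr.res (YokonumaIrr.SAstar d n) (YokonumaIrr.chiA Λ'))))) ∧
      ∀ (X : Type u) [AddCommGroup X] [Module ℂ X]
        (ρ : Representation ℂ (YokonumaIrr.SAstar d n) X), ρ.IsIrreducible →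
          ∃ Λ : YokonumaIrr.Q d n, YokonumaIrr.IsFactor ρ
            (YokonumaIrr.res (YokonumaIrr.SAstar d n) (YokonumaIrr.chiA Λ))) ∧
    -- Types B and C
    ((∀ Λ : YokonumaIrr.R d n,
        Function.Injective Λ.emb ∧
        Set.range Λ.emb = {g : YokonumaIrr.SB d n |
          ∀ t : Fin n → YokonumaIrr.Cd d, YokonumaIrr.torusChar Λ.psi (YokonumaIrr.signedAut _ _ g.right⁻¹ t) =
            YokonumaIrr.torusChar Λ.psi t}) ∧
      YokonumaIrr.ParametrizesIrr.{u} (fun Λ : YokonumaIrr.R d n => YokonumaIrr.chiB hd Λ)) ∧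
    -- Type D
    ((YokonumaIrr.SD d n).index = 2 ∧
      (∀ Λ : YokonumaIrr.R d n,
        Nonempty ((YokonumaIrr.twist (YokonumaIrr.epsCharB d n) (YokonumaIrr.chiB hd Λ)).Equiv
          (YokonumaIrr.chiB hd Λ.swap)) ∧
        ((Λ.lam1, Λ.lam2) ≠ (Λ.mu1, Λ.mu2) →
          (YokonumaIrr.res (YokonumaIrr.SD d n) (YokonumaIrr.chiB hd Λ)).IsIrreducible) ∧
        ((Λ.lam1, Λ.lam2) = (Λ.mu1, Λ.mu2) →
          YokonumaIrr.RestrictionSplits (YokonumaIrr.SD d n) (YokonumaIrr.chiB hd Λ) 2)) ∧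
      (∀ Λ Λ' : YokonumaIrr.R d n,
        (YokonumaIrr.HaveCommonFactor (YokonumaIrr.res (YokonumaIrr.SD d n)
            (YokonumaIrr.chiB hd Λ))
          (YokonumaIrr.res (YokonumaIrr.SD d n) (YokonumaIrr.chiB hd Λ')) ↔
            Λ' = Λ ∨ Λ' = Λ.swap) ∧
        (Λ' = Λ ∨ Λ' = Λ.swap →
          Nonempty ((YokonumaIrr.res (YokonumaIrr.SD d n) (YokonumaIrr.chiB hd Λ)).Equiv
            (YokonumaIrr.res (YokonumaIrr.SD d n) (YokonumaIrr.chiB hd Λ'))))) ∧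
      ∀ (X : Type u) [AddCommGroup X] [Module ℂ X]
        (ρ : Representation ℂ (YokonumaIrr.SD d n) X), ρ.IsIrreducible →
          ∃ Λ : YokonumaIrr.R d n, YokonumaIrr.IsFactor ρ
            (YokonumaIrr.res (YokonumaIrr.SD d n) (YokonumaIrr.chiB hd Λ))) := by
  refine ⟨⟨fun Λ => ⟨YokonumaIrr.embA_injective Λ.blockEquiv, YokonumaIrr.range_emb Λ⟩,
    YokonumaIrr.parametrizesIrr_chiA⟩, ⟨fun Λ => ⟨YokonumaIrr.nonempty_equiv_twist_chiA Λ,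
      Λ.o_pos, Λ.o_dvd, YokonumaIrr.restrictionSplits_chiA hn Λ⟩, fun Λ Λ' => ?_,
      fun X _ _ ρ hρ => ?_⟩,
    ⟨fun Λ => ⟨YokonumaIrr.embB_blockEquiv_injective Λ, YokonumaIrr.range_embB hd Λ⟩,
      YokonumaIrr.parametrizesIrr_chiB hd⟩,
    YokonumaIrr.index_SD hn, fun Λ => ⟨YokonumaIrr.nonempty_equiv_twist_chiB hd Λ,
      YokonumaIrr.isIrreducible_res_chiB hd, YokonumaIrr.restrictionSplits_chiB hd hn⟩,
      fun Λ Λ' => ?_, fun X _ _ ρ hρ => ?_⟩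
  · exact YokonumaIrr.haveCommonFactor_iff (χ := fun Λ : YokonumaIrr.Q d n => YokonumaIrr.chiA Λ)
      (NeZero.ne d) YokonumaIrr.SAstar_eq_ker YokonumaIrr.epsCharA_pow
      YokonumaIrr.isIrreducible_chiA (fun _ _ => YokonumaIrr.eq_of_linked_chiA)
      YokonumaIrr.nonempty_equiv_twist_chiA Λ Λ'
  · exact YokonumaIrr.exists_isFactor_res
      (χ := fun Λ : YokonumaIrr.Q d n => YokonumaIrr.chiA Λ) YokonumaIrr.isIrreducible_chiA
      (fun Z _ _ τ _ => YokonumaIrr.exists_linked_chiA τ) ρ hρ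
  · rw [← YokonumaIrr.R.exists_iterate_swap_iff]
    exact YokonumaIrr.haveCommonFactor_iff
      (χ := fun Λ : YokonumaIrr.R d n => YokonumaIrr.chiB hd Λ)
      two_ne_zero YokonumaIrr.SD_eq_ker_epsCharB YokonumaIrr.epsCharB_sq
      (YokonumaIrr.isIrreducible_chiB hd) (fun _ _ => YokonumaIrr.eq_of_linked_chiB hd)
      (YokonumaIrr.nonempty_equiv_twist_chiB hd) Λ Λ'
  · exact YokonumaIrr.exists_isFactor_res
      (χ := fun Λ : YokonumaIrr.R d n => YokonumaIrr.chiB hd Λ) (YokonumaIrr.isIrreducible_chiB hd)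
      (fun Z _ _ τ _ => YokonumaIrr.exists_linked_chiB hd τ) ρ hρ
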